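/- **Setting.** Let $d\ge 1$ and let $\Omega\subset\mathbb R^d$ be a nonempty open set whose isometry group is irreducible: no linear subspace other than $\{0\}$ and $\mathbb R^d$ is invariant under the linear parts of all isometries of $\mathbb R^d$ that map $\Omega$ onto itself. Let $T$ be an invertible real $d\times d$ matrix, with transpose $T^\dagger$ and $T^{-\dagger}=(T^{-1})^\dagger$. Let $\beta>0$ be such that $H_0^\beta(\Omega)$, the closure of $C_c^\infty(\Omega)$ in the norm $\left(\int(1+|\xi|^{2\beta})|\hat u|^2\,d\xi\right)^{1/2}$, embeds compactly into $L^2$. A function $g$ is called *polynomially bounded* if $|g(t)|\le C(1+t)^m$ for all $t>0$ and some $C,m$, and *elliptic of order $\beta$* if $g(t)\ge c\,t^\beta-C$ for all $t>0$ and some $c>0$, $C$. For a multiplier $g(|\xi|^2)$ and an open set $D$, the operator is understood weakly, through the form $Q(u,v)=\int_{\mathbb R^d} g(|\xi|^2)\,\hat u(\xi)\overline{\hat v(\xi)}\,d\xi$ on the closure of $C_c^\infty(D)$ in the norm $\left(\int (1+|g(|\xi|^2)|)|\hat u|^2\,d\xi\right)^{1/2}$ (this closure is $H_0^\beta(D)$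 when $g(t)$ is polynomially bounded and comparable to $t^\beta$ for large $t$). Its eigenvalues $\lambda_1\le\lambda_2\le\dots$, counted with multiplicity, are denoted $\lambda_k\big|_{g,D}$. To say that the spectrum is discrete means that $\lambda_k\to\infty$ and that there is an orthonormal basis of $L^2(D)$ consisting of weak eigenfunctions. For functions $\Phi_1,\Phi_2$ on $(0,\infty)$ put $$F[\Phi_1,\Phi_2,T](t)=\frac1d\operatorname{tr}\Phi_1\!\left(t\,T^{-1}T^{-\dagger}\right)-\Phi_2\!\left(\frac td\operatorname{tr}T^{-1}T^{-\dagger}\right),$$ where $\Phi_1$ of a symmetric matrix is defined by acting on the eigenvalues in a spectral decomposition. **Theorem.** 1. Let $f=\Phi_1-\Phi_2$ on $(0,\infty)$ with $\Phi_1,\Phi_2$ convex on $(0,\infty)$. Suppose that $f$ is polynomially bounded and elliptic of order $\beta$ and that $F[\Phi_1,\Phi_2,T]$ is polynomially bounded. Then the spectra of the operators with multiplier $f(|\xi|^2)$ on $T(\Omega)$ and with multiplier $F[\Phi_1,\Phi_2,T](|\xi|^2)$ on $\Omega$ are discrete, and for every $n$ $$\lambda_1+\dots+\lambda_n\Big|_{f,\,T(\Omega)}\le\lambda_1+\dots+\lambda_n\Big|_{F[\Phi_1,\Phi_2,T],\,\Omega},$$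 with equality when $T$ is a multiple of an orthogonal matrix. 2. Let $f=\Psi\circ\Phi$ on $(0,\infty)$, where $\Phi$ is convex and bounded below on $(0,\infty)$ and $\Psi$ is concave on a convex set containing $\Phi((0,\infty))$. Suppose that $f$ is polynomially bounded and elliptic of order $\beta$. Then the spectra of the operators with multiplier $f(|\xi|^2)$ on $T(\Omega)$ and with multiplier $\Psi\circ F[\Phi,0,T](|\xi|^2)$ on $\Omega$ are discrete, and for every $n$ $$\lambda_1+\dots+\lambda_n\Big|_{f,\,T(\Omega)}\le\lambda_1+\dots+\lambda_n\Big|_{\Psi\circ F[\Phi,0,T],\,\Omega}.$$ -/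

import Mathlib

open MeasureTheory Set Filter Topology
open scoped ENNReal ContDiff FourierTransform InnerProductSpace

noncomputable section

/-- Euclidean space of dimension `d`. -/
abbrev Eucl (d : ℕ) : Type := EuclideanSpace ℝ (Fin d)

/-- Complex-valued square integrable functions on Euclidean space. -/
abbrev L2Space (d : ℕ) : Type := Lp (α := Eucl d) ℂ 2 volume

/-- The classes in `L²` of the smooth functions whose compact support lies in `Ω`. -/
def testFunctions {d : ℕ} (Ω : Set (Eucl d)) : Set (L2Space d) :=
  {u | ∃ φ : Eucl d → ℂ, ContDiff ℝ ∞ φ ∧ HasCompactSupport φ ∧ tsupport φ ⊆ Ω ∧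
    (u : Eucl d → ℂ) =ᵐ[volume] φ}

/-- `∫ (1 + |f(|ξ|²)|) |û(ξ)|² dξ`. For `f t = t ^ β` this is the square of the Sobolev norm,
`‖u‖₀² + ‖u‖_β²`. -/
def energy {d : ℕ} (f : ℝ → ℝ) (u : L2Space d) : ℝ≥0∞ :=
  ∫⁻ ξ : Eucl d, ENNReal.ofReal ((1 + |f (‖ξ‖ ^ 2)|) * ‖(𝓕 u : L2Space d) ξ‖ ^ 2)

/-- The form domain of the operator with multiplier `f(|ξ|²)` on `Ω` with Dirichlet condition:
the closure of the test functions on `Ω` in the norm `(energy f)^(1/2)`. Its elements are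
extended by zero to the whole space. If `f(t)` is comparable to `t ^ β` for large `t` and locally
bounded, then this is the Sobolev space `H₀^β(Ω)`. -/
def formDomain {d : ℕ} (f : ℝ → ℝ) (Ω : Set (Eucl d)) : Set (L2Space d) :=
  {u | ∀ ε : ℝ≥0∞, 0 < ε → ∃ φ ∈ testFunctions Ω, energy f (u - φ) < ε}

/-- The Sobolev space `H₀^β(Ω)`: the closure of the test functions on `Ω` in the Sobolev norm. -/
def sobolevZero {d : ℕ} (β : ℝ) (Ω : Set (Eucl d)) : Set (L2Space d) :=
  formDomain (fun t : ℝ => t ^ β) Ω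

/-- The embedding of `H₀^β(Ω)` into `L²` is compact. -/
def SobolevCompactEmbedding {d : ℕ} (β : ℝ) (Ω : Set (Eucl d)) : Prop :=
  IsCompact (closure {u : L2Space d | u ∈ sobolevZero β Ω ∧ energy (fun t : ℝ => t ^ β) u ≤ 1})

/-- The form `Q(u, v) = ∫ f(|ξ|²) û(ξ) conj(v̂(ξ)) dξ`. -/
def multiplierForm {d : ℕ} (f : ℝ → ℝ) (u v : L2Space d) : ℂ :=
  ∫ ξ : Eucl d, (f (‖ξ‖ ^ 2) : ℂ) * (𝓕 u : L2Space d) ξ * star ((𝓕 v : L2Space d) ξ)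

/-- `u` is in the form domain and satisfies `A u = l u` weakly, `A` being the operator on `Ω` with
multiplier `f(|ξ|²)`. -/
def IsWeakEigenfunction {d : ℕ} (f : ℝ → ℝ) (Ω : Set (Eucl d)) (l : ℝ) (u : L2Space d) : Prop :=
  u ∈ formDomain f Ω ∧
    ∀ v ∈ formDomain f Ω, multiplierForm f u v = (l : ℂ) * ⟪v, u⟫_ℂ

/-- The spectrum of the operator on `Ω` with multiplier `f(|ξ|²)` is discrete, and `a 0 ≤ a 1 ≤ …`
lists its eigenvalues with multiplicity: `a` is nondecreasing and tends to infinity, and there is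
an orthonormal family of weak eigenfunctions `u k`, with eigenvalues `a k`, that is complete in
`L²(Ω)` (the functions in `L²` that vanish almost everywhere outside `Ω`). -/
def IsEigenvalueSequence {d : ℕ} (f : ℝ → ℝ) (Ω : Set (Eucl d)) (a : ℕ → ℝ) : Prop :=
  Monotone a ∧ Tendsto a atTop atTop ∧
    ∃ u : ℕ → L2Space d, Orthonormal ℂ u ∧ (∀ k, IsWeakEigenfunction f Ω (a k) (u k)) ∧
      ∀ w : L2Space d, (∀ᵐ x ∂(volume : Measure (Eucl d)), x ∉ Ω → w x = 0) →
        (∀ k, ⟪u k, w⟫_ℂ = 0) → w = 0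

/-- The linear parts of the isometries of space that map `Ω` onto itself act irreducibly. -/
def HasIrreducibleIsometryGroup {d : ℕ} (Ω : Set (Eucl d)) : Prop :=
  ∀ W : Submodule ℝ (Eucl d),
    (∀ g : Eucl d ≃ᵃⁱ[ℝ] Eucl d, g '' Ω = Ω → ∀ w ∈ W, g.linearIsometryEquiv w ∈ W) →
      W = ⊥ ∨ W = ⊤

/-- The image `T(Ω)`. -/
def linearImage {d : ℕ} (T : Matrix (Fin d) (Fin d) ℝ) (Ω : Set (Eucl d)) : Set (Eucl d) :=
  (fun x : Eucl d => Matrix.toEuclideanLin T x) '' Ω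

/-- `f` grows at most polynomially on `(0, ∞)`. -/
def PolynomiallyBounded (f : ℝ → ℝ) : Prop :=
  ∃ (C : ℝ) (m : ℕ), ∀ t : ℝ, 0 < t → |f t| ≤ C * (1 + t) ^ m

/-- `f` is bounded below by a positive multiple of `t ^ β` minus a constant: after a constant is
added to it, the operator with multiplier `f(|ξ|²)` is elliptic on `H₀^β`. -/
def EllipticOfOrder (β : ℝ) (f : ℝ → ℝ) : Prop :=
  ∃ c C : ℝ, 0 < c ∧ ∀ t : ℝ, 0 < t → c * t ^ β - C ≤ f t

theorem isHermitian_smul_mul_transpose {d : ℕ} (t : ℝ) (S : Matrix (Fin d) (Fin d) ℝ) :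
    (t • (S * S.transpose)).IsHermitian := by
  unfold Matrix.IsHermitian
  rw [Matrix.conjTranspose_eq_transpose_of_trivial, Matrix.transpose_smul, Matrix.transpose_mul,
    Matrix.transpose_transpose]

/-- `F[Φ₁, Φ₂, T](t) = (1/d) tr Φ₁(t T⁻¹ T⁻ᵀ) - Φ₂((t/d) tr(T⁻¹ T⁻ᵀ))`, where `Φ₁` is applied to a
symmetric matrix by acting on the eigenvalues in a spectral decomposition. -/
def transformedMultiplier {d : ℕ} (Φ₁ Φ₂ : ℝ → ℝ) (T : Matrix (Fin d) (Fin d) ℝ) (t : ℝ) : ℝ :=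
  (1 / (d : ℝ)) * Matrix.trace ((isHermitian_smul_mul_transpose t T⁻¹).cfc Φ₁) -
    Φ₂ ((t / (d : ℝ)) * Matrix.trace (T⁻¹ * (T⁻¹).transpose))

/-- `T` is a multiple of an orthogonal matrix. -/
def IsMultipleOfOrthogonal {d : ℕ} (T : Matrix (Fin d) (Fin d) ℝ) : Prop :=
  ∃ (c : ℝ) (O : Matrix (Fin d) (Fin d) ℝ), O ∈ Matrix.orthogonalGroup (Fin d) ℝ ∧ T = c • O

end

/-! The sum of the lowest n eigenvalues is the least value of the summed quadratic form over
orthonormal n-tuples, so eigenfunctions on Ω, transplanted to T(Ω), serve as trial functions there.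
If g is an isometry of Ω with linear part R, then v ↦ |det T|^(-1/2) v(g T⁻¹x) preserves the L² norm
and, on the Fourier side, replaces f(|ξ|²) by f(|T⁻ᵀR⁻¹ξ|²). With eigenpairs (μᵢ, eᵢ) of T⁻¹T⁻ᵀ, one
has |T⁻ᵀR⁻¹ξ|² = |ξ|² ∑ᵢ pᵢ μᵢ, where pᵢ = ⟨R eᵢ, ξ⟩²/|ξ|² and ∑ᵢ pᵢ = 1.

Irreducibility yields finitely many isometries g_k and weights w_k with ∑_k w_k p_{k,i} = 1/d for
every i and ξ (`exists_average_inner_sq`, `exists_averaging_maps`): the convex hull of the orbit of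
the operators eᵢ ⊗ eᵢ contains an invariant tuple, and Schur's lemma makes it scalar. Averaging the
trial functions over k then reduces the theorem to Jensen's inequality
(`average_le_transformedMultiplier`): for Φ₁ in the index i, for Φ₂ in the index k. In the second
part Jensen is applied to Ψ in k and to Φ in i, and Ψ is nondecreasing because f is unbounded above
(`ConcaveOn.monotoneOn_of_unbounded`). When T is a multiple of an orthogonal matrix, transplanting
back by T gives the reverse inequality.

The comparison `sum_eigenvalues_le_of_average` transplants only test functions that approximate the
eigenfunctions. The variational bound is kept in the form ∑_{k<n} (a_k - a_n)|⟨u_k, ψ⟩|² ≤ Q(ψ) -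
a_n‖ψ‖², which can be averaged and whose left side is continuous in L².

Discreteness comes from minimising Rayleigh quotients successively
(`SesqForm.HasCompactResolvent.exists_eigenvectors`); compactness is pulled back from the Sobolev
embedding on Ω by ellipticity (`hasCompactTestFunctions_of_elliptic`). -/

noncomputable section

/-! ### Averaging rank-one forms over an irreducible group -/

/-- A nonempty convex set, not necessarily closed, that is mapped onto itself by a family of linear
isometries contains a common fixed point of the family. -/
theorem exists_fixedPoint_mem_of_convex {X : Type*} [NormedAddCommGroup X] [InnerProductSpace ℝ X]
    [FiniteDimensional ℝ X] (G : Set (X ≃ₗᵢ[ℝ] X)) (C : Set X) (hC : Convex ℝ C)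
    (hne : C.Nonempty) (hG : ∀ g ∈ G, g '' C = C) :
    ∃ p ∈ C, ∀ g ∈ G, g p = p := by
  obtain ⟨x, hx⟩ := hne.intrinsicInterior hC
  set A : AffineSubspace ℝ X := affineSpan ℝ C with hA
  obtain ⟨r, hr, hxr⟩ : ∃ r > 0, ∀ y ∈ A, dist y x < r → y ∈ C := by
    rw [mem_intrinsicInterior] at hx
    obtain ⟨x', hx', rfl⟩ := hx
    rw [mem_interior_iff_mem_nhds, Metric.mem_nhds_iff] at hx'
    obtain ⟨r, hr, h⟩ := hx'
    exact ⟨r, hr, fun y hy hd => @h ⟨y, hy⟩ hd⟩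
  have hxA : x ∈ A := subset_affineSpan ℝ C (intrinsicInterior_subset hx)
  -- Since C need not be closed, it is shrunk to the points whose relative r-ball lies in C. This
  -- set is closed, convex and invariant, and it contains the relative interior point x.
  let D : Set X := {y | y ∈ A ∧ ∀ z ∈ A, dist z y < r → z ∈ C}
  have hxD : x ∈ D := ⟨hxA, hxr⟩
  have hDC : D ⊆ C := fun y hy => hy.2 y hy.1 (by simpa using hr)
  have hAcl : IsClosed (A : Set X) := A.closed_of_finiteDimensional
  have hDcl : IsClosed D := by
    rw [← isSeqClosed_iff_isClosed]
    intro y y0 hy hlim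
    refine ⟨hAcl.mem_of_tendsto hlim (Eventually.of_forall fun n => (hy n).1), fun z hz hd => ?_⟩
    have h1 : Tendsto (fun n => dist z (y n)) atTop (𝓝 (dist z y0)) := tendsto_const_nhds.dist hlim
    obtain ⟨n, hn⟩ := (h1.eventually_lt_const hd).exists
    exact (hy n).2 z hz hn
  have hDcv : Convex ℝ D := by
    intro y hy z hz a b ha hb hab
    refine ⟨A.convex hy.1 hz.1 ha hb hab, fun v hv hd => ?_⟩
    set e := v - (a • y + b • z) with he
    have hmem : ∀ y' ∈ D, y' + e ∈ C := by
      intro y' hy'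
      refine hy'.2 _ ?_ ?_
      · have : e ∈ A.direction := A.vsub_mem_direction hv (A.convex hy.1 hz.1 ha hb hab)
        have := A.vadd_mem_of_mem_direction this hy'.1
        rwa [vadd_eq_add, add_comm] at this
      · simpa [dist_eq_norm, he] using hd
    have h2 := hC (hmem y hy) (hmem z hz) ha hb hab
    have h3 : a • (y + e) + b • (z + e) = v := by
      rw [smul_add, smul_add]
      have : a • y + a • e + (b • z + b • e) = a • y + b • z + (a + b) • e := by
        rw [add_smul]; abel
      rw [this, hab, one_smul, he]; abel
    rwa [h3] at h2
  have hAG : ∀ g ∈ G, ∀ y, y ∈ A ↔ g y ∈ A := by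
    intro g hg y
    have h1 : A.map g.toAffineEquiv.toAffineMap = A := by
      rw [hA, AffineSubspace.map_span]
      congr 1
      exact hG g hg
    have h2 : g y ∈ A.map g.toAffineEquiv.toAffineMap ↔ y ∈ A :=
      AffineSubspace.mem_map_iff_mem_of_injective (f := g.toAffineEquiv.toAffineMap) g.injective
    rw [← h2, h1]
  have hDG : ∀ g ∈ G, ∀ y ∈ D, g y ∈ D := by
    intro g hg y hy
    refine ⟨(hAG g hg y).1 hy.1, fun z hz hd => ?_⟩
    have h1 : g.symm z ∈ C := by
      refine hy.2 _ ((hAG g hg _).2 (by simpa using hz)) ?_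
      rw [← g.dist_map]; simpa using hd
    rw [← hG g hg]
    exact ⟨_, h1, by simp⟩
  obtain ⟨p, hp, hmin⟩ := exists_norm_eq_iInf_of_complete_convex ⟨x, hxD⟩ hDcl.isComplete hDcv 0
  have hle : ∀ q ∈ D, ‖p‖ ≤ ‖q‖ := by
    intro q hq
    have : ‖(0 : X) - p‖ ≤ ‖(0 : X) - q‖ := by
      rw [hmin]
      exact ciInf_le ⟨0, by rintro _ ⟨w, rfl⟩; positivity⟩ (⟨q, hq⟩ : D)
    simpa using this
  refine ⟨p, hDC hp, fun g hg => ?_⟩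
  -- The midpoint of p and g p is again in D, so it is no shorter than p; as p and g p have equal
  -- norm, the parallelogram law forces them to coincide.
  have h1 := hle _ (hDcv hp (hDG g hg p hp) (by norm_num : (0 : ℝ) ≤ 1 / 2)
    (by norm_num : (0 : ℝ) ≤ 1 / 2) (by norm_num))
  have h2 := parallelogram_law_with_norm ℝ p (g p)
  have h3 : ‖(1 / 2 : ℝ) • p + (1 / 2 : ℝ) • g p‖ = 1 / 2 * ‖p + g p‖ := by
    rw [← smul_add, norm_smul]; norm_num
  rw [h3] at h1
  rw [g.norm_map] at h2
  have h4 : ‖p - g p‖ * ‖p - g p‖ ≤ 0 := by nlinarith [norm_nonneg p, norm_nonneg (p + g p)]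
  have h5 : ‖p - g p‖ = 0 := by nlinarith [norm_nonneg (p - g p)]
  exact (sub_eq_zero.1 (norm_eq_zero.1 h5)).symm

/-- The Hilbert–Schmidt inner product on finite families of operators. -/
@[reducible] def hilbertSchmidtCore (E : Type*) [NormedAddCommGroup E] [InnerProductSpace ℝ E]
    [FiniteDimensional ℝ E] (n : ℕ) : InnerProductSpace.Core ℝ (Fin n → E →ₗ[ℝ] E) where
  inner x y := ∑ i, LinearMap.trace ℝ E (LinearMap.adjoint (x i) ∘ₗ y i)
  conj_inner_symm x y := by
    simp only [conj_trivial]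
    refine Finset.sum_congr rfl fun i _ => ?_
    rw [LinearMap.trace_eq_sum_inner _ (stdOrthonormalBasis ℝ E),
      LinearMap.trace_eq_sum_inner _ (stdOrthonormalBasis ℝ E)]
    refine Finset.sum_congr rfl fun j _ => ?_
    simp only [LinearMap.comp_apply, LinearMap.adjoint_inner_right]
    rw [real_inner_comm]
  re_inner_nonneg x := by
    change 0 ≤ ∑ i, LinearMap.trace ℝ E (LinearMap.adjoint (x i) ∘ₗ x i)
    refine Finset.sum_nonneg fun i _ => ?_
    rw [LinearMap.trace_eq_sum_inner _ (stdOrthonormalBasis ℝ E)]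
    refine Finset.sum_nonneg fun j _ => ?_
    simp only [LinearMap.comp_apply, LinearMap.adjoint_inner_right]
    exact real_inner_self_nonneg
  add_left x y z := by
    rw [← Finset.sum_add_distrib]
    refine Finset.sum_congr rfl fun i _ => ?_
    rw [Pi.add_apply, map_add, LinearMap.add_comp, map_add]
  smul_left x y r := by
    rw [Finset.mul_sum]
    refine Finset.sum_congr rfl fun i _ => ?_
    simp [LinearMap.smul_comp]
  definite x hx := by
    have hnn : ∀ i ∈ Finset.univ, 0 ≤ LinearMap.trace ℝ E (LinearMap.adjoint (x i) ∘ₗ x i) := by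
      intro i _
      rw [LinearMap.trace_eq_sum_inner _ (stdOrthonormalBasis ℝ E)]
      refine Finset.sum_nonneg fun j _ => ?_
      simp only [LinearMap.comp_apply, LinearMap.adjoint_inner_right]
      exact real_inner_self_nonneg
    have h1 := (Finset.sum_eq_zero_iff_of_nonneg hnn).1 hx
    funext i
    have h2 := h1 i (Finset.mem_univ i)
    rw [LinearMap.trace_eq_sum_inner _ (stdOrthonormalBasis ℝ E), Finset.sum_eq_zero_iff_of_nonneg
      (fun j _ => by
        simp only [LinearMap.comp_apply, LinearMap.adjoint_inner_right]
        exact real_inner_self_nonneg)] at h2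
    refine (stdOrthonormalBasis ℝ E).toBasis.ext fun j => ?_
    have h3 := h2 j (Finset.mem_univ j)
    simp only [LinearMap.comp_apply, LinearMap.adjoint_inner_right] at h3
    simpa using h3

/-- Under an irreducible group of linear isometries, finitely many quadratic forms of rank one
become scalar after a suitable finite averaging. -/
theorem exists_average_inner_sq {E : Type*} [NormedAddCommGroup E] [InnerProductSpace ℝ E]
    [FiniteDimensional ℝ E] [Nontrivial E] (G : Subgroup (E ≃ₗᵢ[ℝ] E))
    (hirr : ∀ W : Submodule ℝ E, (∀ g ∈ G, ∀ w ∈ W, g w ∈ W) → W = ⊥ ∨ W = ⊤)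
    {n : ℕ} (v : Fin n → E) :
    ∃ (ι : Type) (_ : Fintype ι) (w : ι → ℝ) (g : ι → E ≃ₗᵢ[ℝ] E), (∀ k, 0 ≤ w k) ∧
      ∑ k, w k = 1 ∧ (∀ k, g k ∈ G) ∧
      ∀ i ξ, ∑ k, w k * ⟪g k (v i), ξ⟫_ℝ ^ 2 = ‖v i‖ ^ 2 * ‖ξ‖ ^ 2 / Module.finrank ℝ E := by
  let X := Fin n → E →ₗ[ℝ] E
  -- The Hilbert–Schmidt norm is used because conjugation by an isometry preserves it, so the group
  -- acts on tuples of operators by isometries.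
  let core : InnerProductSpace.Core ℝ X := hilbertSchmidtCore E n
  let : NormedAddCommGroup X := core.toNormedAddCommGroup
  let : InnerProductSpace ℝ X := InnerProductSpace.ofCore core.toCore
  let act : (E ≃ₗᵢ[ℝ] E) → (X ≃ₗᵢ[ℝ] X) := fun g =>
    LinearEquiv.isometryOfInner (LinearEquiv.piCongrRight fun _ => g.toLinearEquiv.conj) (by
      intro x y
      change ∑ i, LinearMap.trace ℝ E (LinearMap.adjoint (g.toLinearEquiv.conj (x i)) ∘ₗ
        g.toLinearEquiv.conj (y i)) = ∑ i, LinearMap.trace ℝ E (LinearMap.adjoint (x i) ∘ₗ y i)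
      refine Finset.sum_congr rfl fun i _ => ?_
      rw [← LinearMap.trace_conj' (LinearMap.adjoint (x i) ∘ₗ y i) g.toLinearEquiv]
      congr 1
      refine LinearMap.ext fun z => ext_inner_left ℝ fun z' => ?_
      simp only [LinearMap.comp_apply, LinearEquiv.conj_apply, LinearMap.adjoint_inner_right,
        LinearEquiv.coe_coe, LinearIsometryEquiv.coe_toLinearEquiv]
      rw [LinearIsometryEquiv.inner_map_map, ← g.symm.inner_map_map z']
      simp [LinearMap.adjoint_inner_right])
  let P : E → (E →ₗ[ℝ] E) := fun u => (innerₛₗ ℝ u).smulRight u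
  have hP : ∀ u z, P u z = ⟪u, z⟫_ℝ • u := fun u z => rfl
  let orb : (E ≃ₗᵢ[ℝ] E) → X := fun g i => P (g (v i))
  have hact : ∀ g h, act g (orb h) = orb (g * h) := by
    intro g h
    funext i
    refine LinearMap.ext fun z => ?_
    change g (P (h (v i)) (g.symm z)) = P (g (h (v i))) z
    rw [hP, hP, map_smul, ← g.inner_map_map]
    simp
  -- The hull is not closed up: a fixed point in the hull itself is a finite convex combination,
  -- which is what gives finitely many group elements. One hull of tuples serves all the vectors at
  -- once.
  let C : Set X := convexHull ℝ (orb '' G)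
  obtain ⟨p, hp, hfix⟩ := exists_fixedPoint_mem_of_convex (act '' G) C (convex_convexHull ℝ _)
    (Set.Nonempty.convexHull ⟨_, 1, G.one_mem, rfl⟩) (by
      rintro _ ⟨g, hg, rfl⟩
      have : (act g : X → X) '' C = convexHull ℝ ((act g : X → X) '' (orb '' G)) :=
        (act g).toLinearEquiv.toLinearMap.image_convexHull _
      rw [this]
      congr 1
      ext x
      constructor
      · rintro ⟨_, ⟨h, hh, rfl⟩, rfl⟩
        exact ⟨g * h, G.mul_mem hg hh, (hact g h).symm⟩
      · rintro ⟨h, hh, rfl⟩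
        exact ⟨_, ⟨g⁻¹ * h, G.mul_mem (G.inv_mem hg) hh, rfl⟩, by rw [hact]; simp⟩)
  obtain ⟨ι, hι, w, z, hw0, hw1, hz, hsum⟩ := mem_convexHull_iff_exists_fintype.1 hp
  choose g hg hgz using hz
  refine ⟨ι, hι, w, g, hw0, hw1, hg, fun i ξ => ?_⟩
  have hpi : ∀ y, p i y = ∑ k, w k • ⟪g k (v i), y⟫_ℝ • g k (v i) := by
    intro y
    rw [← hsum, Finset.sum_apply, LinearMap.sum_apply]
    refine Finset.sum_congr rfl fun k _ => ?_
    rw [← hgz]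
    rfl
  have hcomm : ∀ h ∈ G, ∀ y, p i (h y) = h (p i y) := by
    intro h hh y
    have h1 : act h p = p := hfix _ ⟨h, hh, rfl⟩
    have h2 : h (p i (h.symm (h y))) = p i (h y) := LinearMap.congr_fun (congrFun h1 i) (h y)
    rw [← h2]; simp
  have hsymm : (p i).IsSymmetric := by
    intro x y
    rw [hpi, hpi, sum_inner, inner_sum]
    refine Finset.sum_congr rfl fun k _ => ?_
    simp only [inner_smul_left, inner_smul_right, conj_trivial]
    rw [real_inner_comm x]; ring
  -- Schur's lemma in the real symmetric case: a real eigenvalue exists, and its eigenspace is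
  -- nonzero and invariant, hence everything.
  obtain ⟨c, hc⟩ : ∃ c : ℝ, ∀ y, p i y = c • y := by
    obtain ⟨c, hev⟩ : ∃ c : ℝ, Module.End.HasEigenvalue (p i) c :=
      ⟨_, hsymm.hasEigenvalue_iSup_of_finiteDimensional⟩
    refine ⟨c, fun y => ?_⟩
    rcases hirr (Module.End.eigenspace (p i) c) (fun h hh u hu => by
      rw [Module.End.mem_eigenspace_iff] at hu ⊢
      rw [hcomm h hh, hu, map_smul]) with h | h
    · exact absurd h hev
    · exact Module.End.mem_eigenspace_iff.1 (h ▸ Submodule.mem_top)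
  have hquad : ∀ y, c * ‖y‖ ^ 2 = ∑ k, w k * ⟪g k (v i), y⟫_ℝ ^ 2 := by
    intro y
    rw [← real_inner_self_eq_norm_sq, ← real_inner_smul_left, ← hc, hpi, sum_inner]
    refine Finset.sum_congr rfl fun k _ => ?_
    simp only [inner_smul_left, conj_trivial]
    ring
  -- The scalar is read off from the trace, each rank-one term having trace ‖v i‖².
  have htr : c * Module.finrank ℝ E = ‖v i‖ ^ 2 := by
    have h1 : ∑ j, c * ‖stdOrthonormalBasis ℝ E j‖ ^ 2 = c * Module.finrank ℝ E := by
      simp [mul_comm]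
    rw [← h1]
    simp_rw [hquad]
    rw [Finset.sum_comm]
    have h2 : ∀ k, ∑ j, w k * ⟪g k (v i), stdOrthonormalBasis ℝ E j⟫_ℝ ^ 2 = w k * ‖v i‖ ^ 2 := by
      intro k
      rw [← Finset.mul_sum, ← (g k).norm_map (v i),
        ← (stdOrthonormalBasis ℝ E).sum_sq_inner_left (g k (v i))]
    simp_rw [h2]
    rw [← Finset.sum_mul, hw1, one_mul]
  have hdim : (Module.finrank ℝ E : ℝ) ≠ 0 := by
    exact_mod_cast (Module.finrank_pos (R := ℝ) (M := E)).ne'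
  rw [← hquad, ← htr]
  field_simp

/-- Finitely many isometries of `Ω` average finitely many quadratic forms of rank one. -/
theorem HasIrreducibleIsometryGroup.exists_average {d n : ℕ} (hd : 0 < d) {Ω : Set (Eucl d)}
    (hirr : HasIrreducibleIsometryGroup Ω) (v : Fin n → Eucl d) :
    ∃ (ι : Type) (_ : Fintype ι) (w : ι → ℝ) (g : ι → Eucl d ≃ᵃⁱ[ℝ] Eucl d), (∀ k, 0 ≤ w k) ∧
      ∑ k, w k = 1 ∧ (∀ k, g k '' Ω = Ω) ∧
      ∀ i ξ, ∑ k, w k * ⟪(g k).linearIsometryEquiv (v i), ξ⟫_ℝ ^ 2 =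
        ‖v i‖ ^ 2 * ‖ξ‖ ^ 2 / d := by
  have : Nonempty (Fin d) := ⟨⟨0, hd⟩⟩
  let G : Subgroup (Eucl d ≃ₗᵢ[ℝ] Eucl d) :=
    { carrier := {R | ∃ g : Eucl d ≃ᵃⁱ[ℝ] Eucl d, g '' Ω = Ω ∧ g.linearIsometryEquiv = R}
      mul_mem' := by
        rintro _ _ ⟨g, hg, rfl⟩ ⟨h, hh, rfl⟩
        refine ⟨g * h, ?_, rfl⟩
        rw [AffineIsometryEquiv.coe_mul, image_comp, hh, hg]
      one_mem' := ⟨1, by simp, rfl⟩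
      inv_mem' := by
        rintro _ ⟨g, hg, rfl⟩
        refine ⟨g⁻¹, ?_, rfl⟩
        nth_rw 1 [← hg]
        rw [← image_comp, ← AffineIsometryEquiv.coe_mul]
        simp }
  obtain ⟨ι, hι, w, R, hw0, hw1, hR, hav⟩ := exists_average_inner_sq G
    (fun W hW => hirr W fun g hg => hW _ ⟨g, hg, rfl⟩) v
  choose g hg hgR using hR
  refine ⟨ι, hι, w, g, hw0, hw1, hg, fun i ξ => ?_⟩
  simp_rw [hgR, hav]
  simp

/-! ### Hermitian forms and the variational bound for eigenvalue sums -/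

section SesquilinearForm

variable {V : Type*} [NormedAddCommGroup V] [InnerProductSpace ℂ V]

/-- A sesquilinear form, conjugate-linear in the first variable. -/
abbrev SesqForm (V : Type*) [NormedAddCommGroup V] [InnerProductSpace ℂ V] : Type _ :=
  V →ₗ⋆[ℂ] V →ₗ[ℂ] ℂ

namespace SesqForm

/-- The form is Hermitian. -/
def IsHerm (B : SesqForm V) : Prop := ∀ u v, B v u = star (B u v)

/-- The (real) quadratic form. -/
def quad (B : SesqForm V) (v : V) : ℝ := (B v v).re

/-- `u` satisfies the weak eigenvalue equation. -/
def IsEigenvector (B : SesqForm V) (l : ℝ) (u : V) : Prop := ∀ v, B v u = (l : ℂ) * ⟪v, u⟫_ℂ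

/-- The form shifted by a multiple of the inner product. -/
def shift (B : SesqForm V) (c : ℝ) : SesqForm V := B + (c : ℂ) • innerₛₗ ℂ

variable {B : SesqForm V}

theorem shift_apply (B : SesqForm V) (c : ℝ) (u v : V) :
    B.shift c u v = B u v + (c : ℂ) * ⟪u, v⟫_ℂ := rfl

theorem quad_shift (B : SesqForm V) (c : ℝ) (v : V) : (B.shift c).quad v = B.quad v + c * ‖v‖ ^ 2 := by
  have : ⟪v, v⟫_ℂ = ((‖v‖ ^ 2 : ℝ) : ℂ) := by rw [inner_self_eq_norm_sq_to_K]; norm_cast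
  rw [quad, shift_apply, this, ← Complex.ofReal_mul, Complex.add_re, Complex.ofReal_re, quad]

theorem IsHerm.shift (hB : B.IsHerm) (c : ℝ) : (B.shift c).IsHerm := by
  intro u v
  rw [shift_apply, shift_apply, hB u v, star_add, star_mul']
  simp

theorem IsHerm.quad_add (hB : B.IsHerm) (x y : V) :
    B.quad (x + y) = B.quad x + B.quad y + 2 * (B x y).re := by
  have : (B y x).re = (B x y).re := by rw [hB x y]; simp
  simp only [quad, map_add, LinearMap.add_apply, Complex.add_re]
  rw [this]; ring

theorem IsHerm.quad_sub (hB : B.IsHerm) (x y : V) :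
    B.quad (x - y) = B.quad x + B.quad y - 2 * (B x y).re := by
  have : (B y x).re = (B x y).re := by rw [hB x y]; simp
  simp only [quad, map_sub, LinearMap.sub_apply, Complex.sub_re]
  rw [this]; ring

theorem quad_smul (B : SesqForm V) (c : ℂ) (x : V) : B.quad (c • x) = ‖c‖ ^ 2 * B.quad x := by
  rw [quad, quad, map_smul, LinearMap.map_smulₛₗ, LinearMap.smul_apply, smul_eq_mul, smul_eq_mul,
    ← mul_assoc, Complex.mul_conj', ← Complex.ofReal_pow, Complex.re_ofReal_mul]

/-- The Cauchy–Schwarz inequality for a form that is nonnegative on a subspace. -/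
theorem IsHerm.re_sq_le (hB : B.IsHerm) {W : Submodule ℂ V} (hpos : ∀ v ∈ W, 0 ≤ B.quad v)
    {x y : V} (hx : x ∈ W) (hy : y ∈ W) : (B x y).re ^ 2 ≤ B.quad x * B.quad y := by
  have h : ∀ t : ℝ, 0 ≤ B.quad y * (t * t) + (2 * (B x y).re) * t + B.quad x := by
    intro t
    have h1 := hpos _ (W.add_mem hx (W.smul_mem (t : ℂ) hy))
    rw [hB.quad_add, quad_smul, map_smul, smul_eq_mul, Complex.re_ofReal_mul,
      Complex.norm_real, Real.norm_eq_abs, sq_abs] at h1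
    nlinarith
  have h2 := discrim_le_zero h
  rw [discrim] at h2
  nlinarith

/-- By Cauchy–Schwarz a null vector of a nonnegative form lies in its radical; testing with i·x as
well handles the imaginary part. This turns minimality of a Rayleigh quotient into the eigenvalue
equation. -/
theorem IsHerm.eq_zero_of_quad_eq_zero (hB : B.IsHerm) {W : Submodule ℂ V}
    (hpos : ∀ v ∈ W, 0 ≤ B.quad v) {x y : V} (hx : x ∈ W) (hy : y ∈ W) (h0 : B.quad y = 0) :
    B x y = 0 := by
  have key : ∀ z ∈ W, (B z y).re = 0 := by
    intro z hz
    have := hB.re_sq_le hpos hz hy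
    rw [h0, mul_zero] at this
    exact pow_eq_zero_iff (two_ne_zero) |>.1 (le_antisymm this (sq_nonneg _))
  refine Complex.ext (key x hx) ?_
  have h1 := key _ (W.smul_mem Complex.I hx)
  rw [LinearMap.map_smulₛₗ, LinearMap.smul_apply] at h1
  simpa using h1

/-- Removing the components along eigenvectors lowers the quadratic form by the expected sum. -/
theorem IsHerm.quad_sub_sum (hB : B.IsHerm) {u : ℕ → V} (hu : Orthonormal ℂ u) {a : ℕ → ℝ}
    (ha : ∀ k, B.IsEigenvector (a k) (u k)) (ψ : V) (N : ℕ) :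
    B.quad (ψ - ∑ k ∈ Finset.range N, ⟪u k, ψ⟫_ℂ • u k) =
      B.quad ψ - ∑ k ∈ Finset.range N, a k * ‖⟪u k, ψ⟫_ℂ‖ ^ 2 := by
  set s := ∑ k ∈ Finset.range N, ⟪u k, ψ⟫_ℂ • u k with hs
  have h1 : ∀ v, B v s = ∑ k ∈ Finset.range N, ⟪u k, ψ⟫_ℂ * ((a k : ℂ) * ⟪v, u k⟫_ℂ) := by
    intro v
    rw [hs, map_sum]
    refine Finset.sum_congr rfl fun k _ => ?_
    rw [map_smul, smul_eq_mul, ha k v]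
  have h2 : ∀ k ∈ Finset.range N, ⟪s, u k⟫_ℂ = star ⟪u k, ψ⟫_ℂ := by
    intro k hk
    rw [hs, hu.inner_left_sum _ hk]
    rfl
  have h3 : ∀ k, ⟪u k, ψ⟫_ℂ * ((a k : ℂ) * star ⟪u k, ψ⟫_ℂ) =
      ((a k * ‖⟪u k, ψ⟫_ℂ‖ ^ 2 : ℝ) : ℂ) := by
    intro k
    rw [mul_left_comm, Complex.star_def, Complex.mul_conj']
    push_cast; ring
  have h4 : (B ψ s).re = ∑ k ∈ Finset.range N, a k * ‖⟪u k, ψ⟫_ℂ‖ ^ 2 := by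
    rw [h1, Complex.re_sum]
    refine Finset.sum_congr rfl fun k _ => ?_
    have : ⟪ψ, u k⟫_ℂ = star ⟪u k, ψ⟫_ℂ := (inner_conj_symm _ _).symm
    rw [this, h3, Complex.ofReal_re]
  have h5 : B.quad s = ∑ k ∈ Finset.range N, a k * ‖⟪u k, ψ⟫_ℂ‖ ^ 2 := by
    rw [quad, h1, Complex.re_sum]
    refine Finset.sum_congr rfl fun k hk => ?_
    rw [h2 k hk, h3, Complex.ofReal_re]
  rw [hB.quad_sub, h4, h5]; ring

end SesqForm

/-- This is `quad_sub_sum` for the inner product itself, seen as the zero form shifted by 1, for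
which every vector is an eigenvector with eigenvalue 1. -/
theorem Orthonormal.norm_sub_sum_sq {u : ℕ → V} (hu : Orthonormal ℂ u) (ψ : V) (N : ℕ) :
    ‖ψ - ∑ k ∈ Finset.range N, ⟪u k, ψ⟫_ℂ • u k‖ ^ 2 =
      ‖ψ‖ ^ 2 - ∑ k ∈ Finset.range N, ‖⟪u k, ψ⟫_ℂ‖ ^ 2 := by
  have hH : (0 : SesqForm V).IsHerm := fun u v => by simp
  have h := (hH.shift 1).quad_sub_sum hu (a := fun _ => 1)
    (fun k v => by rw [SesqForm.shift_apply]; simp) ψ N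
  rw [SesqForm.quad_shift, SesqForm.quad_shift] at h
  simpa [SesqForm.quad] using h

/-- An orthonormal sequence that is complete in a closed subspace satisfies Parseval's identity. -/
theorem Orthonormal.tendsto_sum_norm_inner_sq [CompleteSpace V] {u : ℕ → V} (hu : Orthonormal ℂ u)
    {L : Submodule ℂ V} (hL : IsClosed (L : Set V)) (huL : ∀ k, u k ∈ L)
    (hcompl : ∀ w ∈ L, (∀ k, ⟪u k, w⟫_ℂ = 0) → w = 0) {ψ : V} (hψ : ψ ∈ L) :
    Tendsto (fun N => ∑ k ∈ Finset.range N, ‖⟪u k, ψ⟫_ℂ‖ ^ 2) atTop (𝓝 (‖ψ‖ ^ 2)) := by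
  have hs : Summable fun k => ⟪u k, ψ⟫_ℂ • u k :=
    (hu.orthogonalFamily.summable_iff_norm_sq_summable fun k => ⟪u k, ψ⟫_ℂ).2
      (hu.inner_products_summable ψ)
  have ht := hs.hasSum.tendsto_sum_nat
  set s := ∑' k, ⟪u k, ψ⟫_ℂ • u k
  have hsL : s ∈ L := hL.mem_of_tendsto ht
    (Eventually.of_forall fun N => L.sum_mem fun k _ => L.smul_mem _ (huL k))
  have hψs : ψ - s = 0 := by
    refine hcompl _ (L.sub_mem hψ hsL) fun k => ?_
    have h1 : Tendsto (fun N => ⟪u k, ∑ l ∈ Finset.range N, ⟪u l, ψ⟫_ℂ • u l⟫_ℂ) atTop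
        (𝓝 ⟪u k, s⟫_ℂ) := tendsto_const_nhds.inner ht
    have h2 : Tendsto (fun N => ⟪u k, ∑ l ∈ Finset.range N, ⟪u l, ψ⟫_ℂ • u l⟫_ℂ) atTop
        (𝓝 ⟪u k, ψ⟫_ℂ) := by
      refine tendsto_const_nhds.congr' ?_
      filter_upwards [eventually_gt_atTop k] with N hN
      rw [hu.inner_right_sum _ (Finset.mem_range.2 hN)]
    rw [inner_sub_right, tendsto_nhds_unique h2 h1, sub_self]
  have h3 : Tendsto (fun N => ‖ψ‖ ^ 2 - ‖ψ - ∑ k ∈ Finset.range N, ⟪u k, ψ⟫_ℂ • u k‖ ^ 2) atTop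
      (𝓝 (‖ψ‖ ^ 2 - ‖ψ - s‖ ^ 2)) :=
    tendsto_const_nhds.sub (((tendsto_const_nhds.sub ht).norm).pow 2)
  rw [hψs, norm_zero, zero_pow two_ne_zero, sub_zero] at h3
  refine h3.congr fun N => ?_
  rw [hu.norm_sub_sum_sq]; ring

/-- The min-max lower bound behind the variational principle for sums of eigenvalues. -/
theorem SesqForm.IsHerm.sum_le_quad {B : SesqForm V} (hB : B.IsHerm) {C : ℝ}
    (hC : ∀ v, 0 ≤ B.quad v + C * ‖v‖ ^ 2) {u : ℕ → V} (hu : Orthonormal ℂ u) {a : ℕ → ℝ}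
    (hmono : Monotone a) (ha : ∀ k, B.IsEigenvector (a k) (u k)) {ψ : V}
    (hψ : Tendsto (fun N => ∑ k ∈ Finset.range N, ‖⟪u k, ψ⟫_ℂ‖ ^ 2) atTop (𝓝 (‖ψ‖ ^ 2)))
    (n : ℕ) :
    ∑ k ∈ Finset.range n, (a k - a n) * ‖⟪u k, ψ⟫_ℂ‖ ^ 2 ≤ B.quad ψ - a n * ‖ψ‖ ^ 2 := by
  -- The form of the remainder is at least -C times its squared norm, which tends to 0; convergence
  -- of the expansion in the form norm is not needed.
  have h1 : Tendsto (fun N => B.quad ψ + C * (‖ψ‖ ^ 2 - ∑ k ∈ Finset.range N, ‖⟪u k, ψ⟫_ℂ‖ ^ 2) -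
      a n * ∑ k ∈ Finset.range N, ‖⟪u k, ψ⟫_ℂ‖ ^ 2) atTop
      (𝓝 (B.quad ψ + C * (‖ψ‖ ^ 2 - ‖ψ‖ ^ 2) - a n * ‖ψ‖ ^ 2)) :=
    (tendsto_const_nhds.add ((tendsto_const_nhds.sub hψ).const_mul C)).sub (hψ.const_mul _)
  rw [sub_self, mul_zero, add_zero] at h1
  refine ge_of_tendsto h1 ?_
  filter_upwards [eventually_ge_atTop n] with N hN
  have h2 := hC (ψ - ∑ k ∈ Finset.range N, ⟪u k, ψ⟫_ℂ • u k)
  rw [hB.quad_sub_sum hu ha, hu.norm_sub_sum_sq] at h2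
  -- The terms with n ≤ k < N have a k ≥ a n and may be dropped.
  have h3 : ∑ k ∈ Finset.range n, (a k - a n) * ‖⟪u k, ψ⟫_ℂ‖ ^ 2 ≤
      ∑ k ∈ Finset.range N, (a k - a n) * ‖⟪u k, ψ⟫_ℂ‖ ^ 2 := by
    refine Finset.sum_le_sum_of_subset_of_nonneg (Finset.range_mono hN) fun k _ hk => ?_
    have : a n ≤ a k := hmono (by simpa using hk)
    exact mul_nonneg (by linarith) (sq_nonneg _)
  have h4 : ∑ k ∈ Finset.range N, (a k - a n) * ‖⟪u k, ψ⟫_ℂ‖ ^ 2 =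
      ∑ k ∈ Finset.range N, a k * ‖⟪u k, ψ⟫_ℂ‖ ^ 2 -
        a n * ∑ k ∈ Finset.range N, ‖⟪u k, ψ⟫_ℂ‖ ^ 2 := by
    rw [Finset.mul_sum, ← Finset.sum_sub_distrib]
    exact Finset.sum_congr rfl fun k _ => by ring
  linarith

end SesquilinearForm

/-! ### Existence of eigenvectors by successive minimisation -/

section Existence

variable {H : Type*} [NormedAddCommGroup H] [InnerProductSpace ℂ H]

/-- A closed form, bounded below, whose sublevel sets are relatively compact in the ambient
Hilbert space and whose domain has infinite dimension. -/
structure SesqForm.HasCompactResolvent {V : Submodule ℂ H} (B : SesqForm V) : Prop where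
  herm : B.IsHerm
  bddBelow : ∃ C : ℝ, ∀ v, 0 ≤ B.quad v + C * ‖v‖ ^ 2
  compact : ∀ (v : ℕ → V) (R : ℝ), (∀ m, ‖v m‖ ≤ R) → (∀ m, B.quad (v m) ≤ R) →
    ∃ (w : H) (σ : ℕ → ℕ), StrictMono σ ∧ Tendsto (fun m => (v (σ m) : H)) atTop (𝓝 w)
  closed : ∀ (v : ℕ → V) (w : H), Tendsto (fun m => (v m : H)) atTop (𝓝 w) →
    (∀ ε > 0, ∃ N, ∀ m ≥ N, ∀ l ≥ N, B.quad (v m - v l) ≤ ε) →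
    ∃ w' : V, (w' : H) = w ∧ Tendsto (fun m => B.quad (v m - w')) atTop (𝓝 0)
  infinite : ∀ W : Submodule ℂ V, FiniteDimensional ℂ W → W ≠ ⊤

variable {V : Submodule ℂ H} {B : SesqForm V}

theorem SesqForm.HasCompactResolvent.exists_minimizer (hB : B.HasCompactResolvent)
    (W : Submodule ℂ V) (hW : FiniteDimensional ℂ W) :
    ∃ u ∈ Wᗮ, ‖u‖ = 1 ∧ ∀ v ∈ Wᗮ, B.quad u * ‖v‖ ^ 2 ≤ B.quad v := by
  obtain ⟨C, hC⟩ := hB.bddBelow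
  let S : Set ℝ := {r | ∃ v ∈ Wᗮ, ‖v‖ = 1 ∧ B.quad v = r}
  have hSne : S.Nonempty := by
    have h1 : Wᗮ ≠ ⊥ := fun h => hB.infinite W hW (Submodule.orthogonal_eq_bot_iff.1 h)
    obtain ⟨v, hv, hv0⟩ := Submodule.exists_mem_ne_zero_of_ne_bot h1
    refine ⟨_, ((‖v‖⁻¹ : ℝ) : ℂ) • v, Wᗮ.smul_mem _ hv, ?_, rfl⟩
    rw [norm_smul, Complex.norm_real, norm_inv, norm_norm, inv_mul_cancel₀ (norm_ne_zero_iff.2 hv0)]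
  have hSbdd : BddBelow S := ⟨-C, by
    rintro _ ⟨v, -, hv1, rfl⟩
    have := hC v
    rw [hv1] at this
    linarith⟩
  set l := sInf S with hl
  have hmin : ∀ v ∈ Wᗮ, l * ‖v‖ ^ 2 ≤ B.quad v := by
    intro v hv
    by_cases hv0 : v = 0
    · simp [hv0, SesqForm.quad]
    have hn : ‖v‖ ≠ 0 := norm_ne_zero_iff.2 hv0
    have h1 : l ≤ B.quad (((‖v‖⁻¹ : ℝ) : ℂ) • v) := by
      refine csInf_le hSbdd ⟨_, Wᗮ.smul_mem _ hv, ?_, rfl⟩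
      rw [norm_smul, Complex.norm_real, norm_inv, norm_norm, inv_mul_cancel₀ hn]
    rw [SesqForm.quad_smul, Complex.norm_real, norm_inv, norm_norm] at h1
    calc l * ‖v‖ ^ 2 ≤ (‖v‖⁻¹ ^ 2 * B.quad v) * ‖v‖ ^ 2 := by gcongr
      _ = B.quad v := by field_simp
  obtain ⟨r, -, hr, hrS⟩ := exists_seq_tendsto_sInf hSne hSbdd
  choose v hvW hv1 hvr using hrS
  have hQ : Tendsto (fun m => B.quad (v m)) atTop (𝓝 l) := by simpa only [hvr] using hr
  obtain ⟨R, hR⟩ := hQ.bddAbove_range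
  obtain ⟨w, σ, hσ, hlim⟩ := hB.compact v (max 1 R) (fun m => by rw [hv1]; exact le_max_left _ _)
    fun m => (hR ⟨m, rfl⟩).trans (le_max_right _ _)
  have hQσ : Tendsto (fun m => B.quad (v (σ m))) atTop (𝓝 l) := hQ.comp hσ.tendsto_atTop
  -- A minimising sequence that converges in H is Cauchy for the form: the parallelogram identity
  -- holds for Q too, and Q of the sum is at least l times its squared norm, which is nearly 4.
  have hCauchy : ∀ ε > 0, ∃ N, ∀ m ≥ N, ∀ k ≥ N, B.quad (v (σ m) - v (σ k)) ≤ ε := by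
    intro ε hε
    have h1 : ∀ᶠ m in atTop, B.quad (v (σ m)) < l + ε / 8 := hQσ.eventually_lt_const (by linarith)
    -- The infimum l may have either sign, hence |l|; the denominator |l| + 1 avoids division by
    -- zero.
    obtain ⟨δ, hδ, hδε⟩ : ∃ δ > 0, |l| * δ ^ 2 ≤ ε / 2 := by
      refine ⟨√(ε / 2 / (|l| + 1)), by positivity, ?_⟩
      rw [Real.sq_sqrt (by positivity), mul_div_assoc', div_le_iff₀ (by positivity)]
      nlinarith [abs_nonneg l]
    obtain ⟨N1, hN1⟩ := Metric.cauchySeq_iff.1 hlim.cauchySeq δ hδ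
    obtain ⟨N2, hN2⟩ := eventually_atTop.1 h1
    refine ⟨max N1 N2, fun m hm k hk => ?_⟩
    have h2 := hN1 m (le_of_max_le_left hm) k (le_of_max_le_left hk)
    have h3 := hN2 m (le_of_max_le_right hm)
    have h4 := hN2 k (le_of_max_le_right hk)
    have h5 := hmin _ (Wᗮ.add_mem (hvW (σ m)) (hvW (σ k)))
    have h6 := hB.herm.quad_add (v (σ m)) (v (σ k))
    have h7 := hB.herm.quad_sub (v (σ m)) (v (σ k))
    have h8 := parallelogram_law_with_norm ℂ (v (σ m)) (v (σ k))
    rw [hv1, hv1] at h8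
    have h9 : ‖v (σ m) - v (σ k)‖ < δ := by
      rw [dist_eq_norm] at h2
      exact h2
    have h10 : l * ‖v (σ m) - v (σ k)‖ ^ 2 ≤ ε / 2 := by
      refine le_trans ?_ hδε
      refine mul_le_mul (le_abs_self l) ?_ (sq_nonneg _) (abs_nonneg _)
      exact pow_le_pow_left₀ (norm_nonneg _) h9.le 2
    have h11 : ‖v (σ m) + v (σ k)‖ ^ 2 = 4 - ‖v (σ m) - v (σ k)‖ ^ 2 := by linarith
    rw [h11, mul_sub] at h5
    linarith
  obtain ⟨u, rfl, hu⟩ := hB.closed (fun m => v (σ m)) w hlim hCauchy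
  have hlimV : Tendsto (fun m => v (σ m)) atTop (𝓝 u) := tendsto_subtype_rng.2 hlim
  have huW : u ∈ Wᗮ := W.isClosed_orthogonal.mem_of_tendsto hlimV
    (Eventually.of_forall fun m => hvW _)
  have hu1 : ‖u‖ = 1 := by
    refine tendsto_nhds_unique hlimV.norm ?_
    simp only [hv1]
    exact tendsto_const_nhds
  have hpos : ∀ v ∈ (⊤ : Submodule ℂ V), 0 ≤ (B.shift C).quad v := by
    intro v _
    rw [SesqForm.quad_shift]
    exact hC v
  -- Continuity of Q along the sequence is proved for the nonnegative form Q + C‖·‖², where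
  -- Cauchy–Schwarz controls the cross term.
  have hd : Tendsto (fun m => (B.shift C).quad (v (σ m) - u)) atTop (𝓝 0) := by
    have h1 : Tendsto (fun m => ‖v (σ m) - u‖ ^ 2) atTop (𝓝 0) := by
      have := ((hlimV.sub_const u).norm).pow 2
      simpa using this
    simpa [SesqForm.quad_shift] using hu.add (h1.const_mul C)
  have hcross : Tendsto (fun m => ((B.shift C) (v (σ m) - u) u).re) atTop (𝓝 0) := by
    have h1 : Tendsto (fun m => (B.shift C).quad (v (σ m) - u) * (B.shift C).quad u) atTop (𝓝 0) := by
      simpa using hd.mul_const ((B.shift C).quad u)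
    have h2 : Tendsto (fun m => (((B.shift C) (v (σ m) - u) u).re) ^ 2) atTop (𝓝 0) :=
      squeeze_zero (fun m => sq_nonneg _) (fun m => (hB.herm.shift C).re_sq_le hpos
        Submodule.mem_top Submodule.mem_top) h1
    have h3 := h2.sqrt
    simp only [Real.sqrt_sq_eq_abs, Real.sqrt_zero] at h3
    exact (tendsto_zero_iff_abs_tendsto_zero _).2 h3
  have hQu : (B.shift C).quad u = l + C := by
    have h1 : Tendsto (fun m => (B.shift C).quad (v (σ m))) atTop (𝓝 (l + C)) := by
      simpa [SesqForm.quad_shift, hv1] using hQσ.add_const C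
    have h2 : Tendsto (fun m => (B.shift C).quad (v (σ m))) atTop (𝓝 ((B.shift C).quad u)) := by
      have h3 := (hd.add_const ((B.shift C).quad u)).add (hcross.const_mul 2)
      simp only [zero_add, mul_zero, add_zero] at h3
      refine h3.congr fun m => ?_
      rw [← (hB.herm.shift C).quad_add, sub_add_cancel]
    exact tendsto_nhds_unique h2 h1
  rw [SesqForm.quad_shift, hu1] at hQu
  refine ⟨u, huW, hu1, fun v hv => ?_⟩
  have : B.quad u = l := by linarith
  rw [this]
  exact hmin v hv

/-- A form with compact resolvent has an orthonormal sequence of eigenvectors whose eigenvalues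
increase to infinity and whose span is dense in the form domain. -/
theorem SesqForm.HasCompactResolvent.exists_eigenvectors (hB : B.HasCompactResolvent) :
    ∃ (a : ℕ → ℝ) (u : ℕ → V), Monotone a ∧ Tendsto a atTop atTop ∧ Orthonormal ℂ u ∧
      (∀ k, B.IsEigenvector (a k) (u k)) ∧
      ∀ ψ, Tendsto (fun N => ∑ k ∈ Finset.range N, ⟪u k, ψ⟫_ℂ • u k) atTop (𝓝 ψ) := by
  let F := {W : Submodule ℂ V // FiniteDimensional ℂ W}
  have hex : ∀ W : F, ∃ u ∈ W.1ᗮ, ‖u‖ = 1 ∧ ∀ v ∈ W.1ᗮ, B.quad u * ‖v‖ ^ 2 ≤ B.quad v :=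
    fun W => hB.exists_minimizer W.1 W.2
  choose step hstepW hstep1 hstepmin using hex
  -- W n is the span of the first n minimisers, and the next one is sought in its orthogonal
  -- complement.
  let W : ℕ → F := fun n => Nat.rec (⟨⊥, inferInstance⟩ : F)
    (fun _ W => (⟨W.1 ⊔ Submodule.span ℂ {step W}, by
      have := W.2
      infer_instance⟩ : F)) n
  have hWsucc : ∀ n, (W (n + 1)).1 = (W n).1 ⊔ Submodule.span ℂ {step (W n)} := fun n => rfl
  let u : ℕ → V := fun n => step (W n)
  let a : ℕ → ℝ := fun n => B.quad (u n)
  have hWmono : Monotone fun n => (W n).1 := monotone_nat_of_le_succ fun n => by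
    rw [hWsucc]; exact le_sup_left
  have huW : ∀ n, u n ∈ (W (n + 1)).1 := fun n => by
    rw [hWsucc]; exact Submodule.mem_sup_right (Submodule.mem_span_singleton_self _)
  have hu : Orthonormal ℂ u := by
    refine ⟨fun n => hstep1 _, ?_⟩
    have key : ∀ m n, m < n → ⟪u m, u n⟫_ℂ = 0 := fun m n hmn =>
      (Submodule.mem_orthogonal _ _).1 (hstepW (W n)) _ (hWmono (Nat.succ_le_of_lt hmn) (huW m))
    intro m n hmn
    rcases lt_or_gt_of_ne hmn with h | h
    · exact key m n h
    · exact inner_eq_zero_symm.1 (key n m h)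
  have hmono : Monotone a := monotone_nat_of_le_succ fun n => by
    have h1 := hstepmin (W n) (u (n + 1))
      (Submodule.orthogonal_le (hWmono n.le_succ) (hstepW (W (n + 1))))
    rwa [show ‖u (n + 1)‖ = 1 from hstep1 _, one_pow, mul_one] at h1
  -- On the complement of W n the form shifted by -a n is nonnegative and vanishes at u n, so u n is
  -- in its radical there.
  have horth : ∀ n, ∀ v ∈ (W n).1ᗮ, B v (u n) = (a n : ℂ) * ⟪v, u n⟫_ℂ := by
    intro n v hv
    have h1 := (hB.herm.shift (-a n)).eq_zero_of_quad_eq_zero (W := (W n).1ᗮ) (x := v) (y := u n)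
      (fun z hz => by
        rw [SesqForm.quad_shift]
        have := hstepmin (W n) z hz
        change a n * ‖z‖ ^ 2 ≤ B.quad z at this
        linarith) hv (hstepW (W n)) (by
        rw [SesqForm.quad_shift, show ‖u n‖ = 1 from hstep1 _]
        change a n + _ = 0
        ring)
    rw [SesqForm.shift_apply] at h1
    push_cast at h1
    linear_combination h1
  -- The form does not couple W n to its complement; this extends the eigenvalue equation from test
  -- vectors in the complement to all of them.
  have hinv : ∀ n, ∀ w ∈ (W n).1, ∀ v ∈ (W n).1ᗮ, B w v = 0 := by
    intro n
    induction n with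
    | zero =>
      intro w hw v _
      have : w = 0 := (Submodule.mem_bot ℂ).1 hw
      rw [this, map_zero]; rfl
    | succ n ih =>
      intro w hw v hv
      have hv' : v ∈ (W n).1ᗮ := Submodule.orthogonal_le (hWmono n.le_succ) hv
      rw [hWsucc, Submodule.mem_sup] at hw
      obtain ⟨w0, hw0, w1, hw1, rfl⟩ := hw
      obtain ⟨c, rfl⟩ := Submodule.mem_span_singleton.1 hw1
      have h1 : B v (u n) = 0 := by
        rw [horth n v hv', inner_eq_zero_symm.1
          ((Submodule.mem_orthogonal _ _).1 hv _ (huW n)), mul_zero]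
      rw [map_add, LinearMap.add_apply, ih w0 hw0 v hv', LinearMap.map_smulₛₗ, LinearMap.smul_apply,
        hB.herm v, show step (W n) = u n from rfl, h1]
      simp
  have heig : ∀ k, B.IsEigenvector (a k) (u k) := by
    intro k v
    have := (W k).2
    obtain ⟨y, hy, z, hz, rfl⟩ := (W k).1.exists_add_mem_mem_orthogonal v
    rw [map_add, LinearMap.add_apply, hinv k y hy _ (hstepW (W k)), horth k z hz, inner_add_left,
      (Submodule.mem_orthogonal _ _).1 (hstepW (W k)) y hy]
    ring
  -- Bounded eigenvalues would give an orthonormal sequence with a convergent subsequence, although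
  -- its members are √2 apart.
  have htop : Tendsto a atTop atTop := by
    rcases tendsto_atTop_of_monotone hmono with h | ⟨l, hl⟩
    · exact h
    exfalso
    obtain ⟨w, σ, hσ, hlim⟩ := hB.compact u (max 1 l) (fun m => (hu.1 m).le.trans (le_max_left _ _))
      fun m => (hmono.ge_of_tendsto hl m).trans (le_max_right _ _)
    obtain ⟨N, hN⟩ := Metric.cauchySeq_iff.1 hlim.cauchySeq 1 one_pos
    have h1 := hN N le_rfl (N + 1) N.le_succ
    rw [dist_eq_norm] at h1
    have h2 : ‖u (σ N) - u (σ (N + 1))‖ < 1 := h1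
    have h3 : ‖u (σ N) - u (σ (N + 1))‖ ^ 2 = 2 := by
      rw [@norm_sub_sq ℂ, hu.1, hu.1, hu.2 (hσ (Nat.lt_succ_self N)).ne]
      norm_num
    nlinarith [norm_nonneg (u (σ N) - u (σ (N + 1)))]
  refine ⟨a, u, hmono, htop, hu, heig, fun ψ => ?_⟩
  obtain ⟨C, hC⟩ := hB.bddBelow
  have hWorth : ∀ N v, (∀ k < N, ⟪u k, v⟫_ℂ = 0) → v ∈ (W N).1ᗮ := by
    intro N v
    induction N with
    | zero =>
      intro _
      change v ∈ (⊥ : Submodule ℂ V)ᗮ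
      rw [Submodule.bot_orthogonal_eq_top]
      trivial
    | succ n ih =>
      intro h
      rw [hWsucc, ← Submodule.inf_orthogonal]
      refine ⟨ih fun k hk => h k (hk.trans n.lt_succ_self), ?_⟩
      exact Submodule.mem_orthogonal_singleton_iff_inner_right.2 (h n n.lt_succ_self)
  set r : ℕ → V := fun N => ψ - ∑ k ∈ Finset.range N, ⟪u k, ψ⟫_ℂ • u k with hr
  -- The remainder r N is admissible for the N-th minimisation, and its form is bounded uniformly in
  -- N; as a N → ∞, the remainder tends to 0.
  have hbound : ∀ N, a N * ‖r N‖ ^ 2 ≤ B.quad ψ + |C| * ‖ψ‖ ^ 2 := by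
    intro N
    have h1 : a N * ‖r N‖ ^ 2 ≤ B.quad (r N) := by
      refine hstepmin (W N) _ (hWorth N _ fun k hk => ?_)
      rw [hr]
      simp only
      rw [inner_sub_right, hu.inner_right_sum _ (Finset.mem_range.2 hk), sub_self]
    have h2 : B.quad (r N) = _ := hB.herm.quad_sub_sum hu heig ψ N
    have h3 : ‖r N‖ ^ 2 = _ := hu.norm_sub_sum_sq ψ N
    have h4 : ∀ k, -C ≤ a k := fun k => by
      have := hC (u k)
      rw [hu.1 k] at this
      change 0 ≤ a k + _ at this
      linarith
    have h5 : -|C| * ∑ k ∈ Finset.range N, ‖⟪u k, ψ⟫_ℂ‖ ^ 2 ≤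
        ∑ k ∈ Finset.range N, a k * ‖⟪u k, ψ⟫_ℂ‖ ^ 2 := by
      rw [Finset.mul_sum]
      refine Finset.sum_le_sum fun k _ => ?_
      gcongr
      exact (neg_le_neg (le_abs_self C)).trans (h4 k)
    have h6 := sq_nonneg ‖r N‖
    nlinarith [abs_nonneg C]
  have hr0 : Tendsto (fun N => ‖r N‖ ^ 2) atTop (𝓝 0) := by
    have h1 : Tendsto (fun N => (B.quad ψ + |C| * ‖ψ‖ ^ 2) / a N) atTop (𝓝 0) :=
      tendsto_const_nhds.div_atTop htop
    refine squeeze_zero' (Eventually.of_forall fun N => sq_nonneg _) ?_ h1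
    filter_upwards [htop.eventually_gt_atTop 0] with N hN
    rw [le_div_iff₀ hN, mul_comm]
    exact hbound N
  have hr1 : Tendsto r atTop (𝓝 0) := by
    rw [tendsto_zero_iff_norm_tendsto_zero]
    have := hr0.sqrt
    simpa using this
  have := tendsto_const_nhds (x := ψ) |>.sub hr1
  simpa [hr] using this

end Existence

/-! ### The energy of a multiplier on the Fourier side -/

section Energy

variable {d : ℕ}

/-- The hypotheses on multipliers concern positive arguments only. The frequency 0 is discarded as a
null set, which is where positive dimension is needed. -/
theorem ae_norm_sq_pos (hd : 0 < d) : ∀ᵐ ξ : Eucl d ∂volume, 0 < ‖ξ‖ ^ 2 := by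
  have : Nonempty (Fin d) := ⟨⟨0, hd⟩⟩
  have h : ∀ᵐ ξ : Eucl d ∂volume, ξ ≠ 0 := by
    rw [ae_iff]
    simp
  filter_upwards [h] with ξ hξ
  have := norm_pos_iff.2 hξ
  positivity

/-- A polynomially bounded symbol, bounded below, whose multiplier is measurable. -/
structure IsSymbol (d : ℕ) (g : ℝ → ℝ) : Prop where
  aemeasurable : AEMeasurable (fun ξ : Eucl d => g (‖ξ‖ ^ 2)) volume
  polynomiallyBounded : PolynomiallyBounded g
  bddBelow : ∃ C : ℝ, 0 ≤ C ∧ ∀ t : ℝ, 0 < t → -C ≤ g t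

theorem fourier_coe_add (u v : L2Space d) :
    ((𝓕 (u + v) : L2Space d) : Eucl d → ℂ) =ᵐ[volume]
      fun ξ => (𝓕 u : L2Space d) ξ + (𝓕 v : L2Space d) ξ := by
  rw [FourierTransform.fourier_add]
  exact Lp.coeFn_add _ _

theorem fourier_coe_smul (c : ℂ) (u : L2Space d) :
    ((𝓕 (c • u) : L2Space d) : Eucl d → ℂ) =ᵐ[volume] fun ξ => c * (𝓕 u : L2Space d) ξ := by
  rw [FourierTransform.fourier_smul]
  exact Lp.coeFn_smul _ _

theorem aemeasurable_fourier (u : L2Space d) :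
    AEMeasurable (fun ξ : Eucl d => (𝓕 u : L2Space d) ξ) volume :=
  (Lp.aestronglyMeasurable _).aemeasurable

theorem integral_norm_fourier_sq (u : L2Space d) :
    Integrable (fun ξ : Eucl d => ‖(𝓕 u : L2Space d) ξ‖ ^ 2) volume ∧
      ∫ ξ : Eucl d, ‖(𝓕 u : L2Space d) ξ‖ ^ 2 = ‖u‖ ^ 2 := by
  refine ⟨(memLp_two_iff_integrable_sq_norm (Lp.aestronglyMeasurable _)).1 (Lp.memLp _), ?_⟩
  have h : ⟪(𝓕 u : L2Space d), (𝓕 u : L2Space d)⟫_ℂ = ((‖u‖ ^ 2 : ℝ) : ℂ) := by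
    rw [inner_self_eq_norm_sq_to_K, Lp.norm_fourier_eq]
    norm_cast
  rw [L2.inner_def] at h
  apply Complex.ofReal_injective
  rw [← h, ← integral_complex_ofReal]
  refine integral_congr_ae (Eventually.of_forall fun ξ => ?_)
  simp only [inner_self_eq_norm_sq_to_K]
  norm_cast

theorem aemeasurable_energy_density {g : ℝ → ℝ}
    (hg : AEMeasurable (fun ξ : Eucl d => g (‖ξ‖ ^ 2)) volume) (u : L2Space d) :
    AEMeasurable (fun ξ : Eucl d =>
      ENNReal.ofReal ((1 + |g (‖ξ‖ ^ 2)|) * ‖(𝓕 u : L2Space d) ξ‖ ^ 2)) volume := by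
  have h1 : AEMeasurable (fun ξ : Eucl d => |g (‖ξ‖ ^ 2)|) volume := hg.norm
  exact (((h1.const_add 1).mul ((aemeasurable_fourier u).norm.pow_const 2))).ennreal_ofReal

/-- From |a + b|² ≤ 2|a|² + 2|b|² pointwise. This substitute for the triangle inequality is enough
for all closure arguments and holds for infinite energies as well. -/
theorem energy_add_le {g : ℝ → ℝ} (hg : AEMeasurable (fun ξ : Eucl d => g (‖ξ‖ ^ 2)) volume)
    (u v : L2Space d) : energy g (u + v) ≤ 2 * energy g u + 2 * energy g v := by
  have h2 : (2 : ℝ≥0∞) = ENNReal.ofReal 2 := by simp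
  rw [energy, energy, energy, ← lintegral_const_mul'' _ (aemeasurable_energy_density hg u),
    ← lintegral_const_mul'' _ (aemeasurable_energy_density hg v),
    ← lintegral_add_left' ((aemeasurable_energy_density hg u).const_mul 2)]
  refine lintegral_mono_ae ?_
  filter_upwards [fourier_coe_add u v] with ξ hξ
  have h3 : ∀ x : ℝ, 2 * ENNReal.ofReal x = ENNReal.ofReal (2 * x) := fun x => by
    rw [ENNReal.ofReal_mul zero_le_two, ← h2]
  rw [hξ, h3, h3, ← ENNReal.ofReal_add (by positivity) (by positivity)]
  refine ENNReal.ofReal_le_ofReal ?_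
  set a := (𝓕 u : L2Space d) ξ
  set b := (𝓕 v : L2Space d) ξ
  have h1 : ‖a + b‖ ^ 2 ≤ 2 * ‖a‖ ^ 2 + 2 * ‖b‖ ^ 2 := by
    nlinarith [norm_add_le a b, norm_nonneg (a + b), sq_nonneg (‖a‖ - ‖b‖)]
  nlinarith [mul_le_mul_of_nonneg_left h1 (by positivity : 0 ≤ 1 + |g (‖ξ‖ ^ 2)|)]

theorem energy_smul (g : ℝ → ℝ) (c : ℂ) (u : L2Space d) :
    energy g (c • u) = ENNReal.ofReal (‖c‖ ^ 2) * energy g u := by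
  rw [energy, energy, ← lintegral_const_mul' _ _ ENNReal.ofReal_ne_top]
  refine lintegral_congr_ae ?_
  filter_upwards [fourier_coe_smul c u] with ξ hξ
  rw [hξ, ← ENNReal.ofReal_mul (by positivity), norm_mul]
  congr 1
  ring

theorem energy_zero (g : ℝ → ℝ) : energy g (0 : L2Space d) = 0 := by
  have := energy_smul g (0 : ℂ) (0 : L2Space d)
  simpa using this

theorem energy_sub_le {g : ℝ → ℝ} (hg : AEMeasurable (fun ξ : Eucl d => g (‖ξ‖ ^ 2)) volume)
    (u v w : L2Space d) : energy g (u - w) ≤ 2 * energy g (u - v) + 2 * energy g (v - w) := by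
  have := energy_add_le hg (u - v) (v - w)
  rwa [sub_add_sub_cancel] at this

theorem energy_neg (g : ℝ → ℝ) (u : L2Space d) : energy g (-u) = energy g u := by
  have := energy_smul g (-1 : ℂ) u
  simpa using this

theorem integrable_of_energy_lt_top {g : ℝ → ℝ}
    (hg : AEMeasurable (fun ξ : Eucl d => g (‖ξ‖ ^ 2)) volume) {u : L2Space d}
    (hu : energy g u < ⊤) :
    Integrable (fun ξ : Eucl d => g (‖ξ‖ ^ 2) * ‖(𝓕 u : L2Space d) ξ‖ ^ 2) volume := by
  refine ⟨(hg.mul ((aemeasurable_fourier u).norm.pow_const 2)).aestronglyMeasurable,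
    lt_of_le_of_lt (lintegral_mono fun ξ => ?_) hu⟩
  rw [← ofReal_norm]
  refine ENNReal.ofReal_le_ofReal ?_
  rw [norm_mul, Real.norm_eq_abs, norm_pow, norm_norm]
  gcongr
  linarith [abs_nonneg (g (‖ξ‖ ^ 2))]

theorem energy_eq_ofReal_integral {g : ℝ → ℝ}
    (hg : AEMeasurable (fun ξ : Eucl d => g (‖ξ‖ ^ 2)) volume) {u : L2Space d}
    (hu : energy g u < ⊤) :
    energy g u = ENNReal.ofReal
      (∫ ξ : Eucl d, (1 + |g (‖ξ‖ ^ 2)|) * ‖(𝓕 u : L2Space d) ξ‖ ^ 2) := by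
  rw [energy, ofReal_integral_eq_lintegral_ofReal]
  · have h1 : (fun ξ : Eucl d => (1 + |g (‖ξ‖ ^ 2)|) * ‖(𝓕 u : L2Space d) ξ‖ ^ 2) =
        fun ξ : Eucl d => ‖(𝓕 u : L2Space d) ξ‖ ^ 2 +
          ‖g (‖ξ‖ ^ 2) * ‖(𝓕 u : L2Space d) ξ‖ ^ 2‖ := by
      funext ξ
      rw [norm_mul, Real.norm_eq_abs, norm_pow, norm_norm]; ring
    rw [h1]
    exact (integral_norm_fourier_sq u).1.add (integrable_of_energy_lt_top hg hu).norm
  · exact Eventually.of_forall fun ξ => by positivity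

theorem norm_sq_le_energy (g : ℝ → ℝ) (u : L2Space d) :
    ENNReal.ofReal (‖u‖ ^ 2) ≤ energy g u := by
  rw [← (integral_norm_fourier_sq u).2, ofReal_integral_eq_lintegral_ofReal
    (integral_norm_fourier_sq u).1 (Eventually.of_forall fun ξ => by positivity)]
  refine lintegral_mono fun ξ => ENNReal.ofReal_le_ofReal ?_
  have := abs_nonneg (g (‖ξ‖ ^ 2))
  exact le_mul_of_one_le_left (by positivity) (by linarith)

/-- Lower semicontinuity of the energy under convergence in `L²`. -/
theorem energy_le_of_tendsto {g : ℝ → ℝ}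
    (hg : AEMeasurable (fun ξ : Eucl d => g (‖ξ‖ ^ 2)) volume) {u : ℕ → L2Space d} {w : L2Space d}
    (hlim : Tendsto u atTop (𝓝 w)) {R : ℝ≥0∞} (hR : ∀ᶠ m in atTop, energy g (u m) ≤ R) :
    energy g w ≤ R := by
  -- By Plancherel the transforms converge in L², so a subsequence converges almost everywhere and
  -- Fatou's lemma applies.
  have h1 : Tendsto (fun m => (𝓕 (u m) : L2Space d)) atTop (𝓝 (𝓕 w)) :=
    ((Lp.fourierTransformₗᵢ (Eucl d) ℂ).continuous.tendsto w).comp hlim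
  obtain ⟨σ, hσ, hae⟩ := (tendstoInMeasure_of_tendsto_Lp h1).exists_seq_tendsto_ae
  have h2 : energy g w ≤ liminf (fun m => energy g (u (σ m))) atTop := by
    refine le_trans (lintegral_mono_ae ?_) (lintegral_liminf_le'
      (fun m => aemeasurable_energy_density hg (u (σ m))))
    filter_upwards [hae] with ξ hξ
    refine le_of_eq (Tendsto.liminf_eq ?_).symm
    exact ENNReal.tendsto_ofReal (((hξ.norm).pow 2).const_mul _)
  refine h2.trans (liminf_le_of_frequently_le' ?_)
  exact (hσ.tendsto_atTop.eventually hR).frequently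

end Energy

/-! ### Test functions and functions supported in Ω -/

section TestFunctions

variable {d : ℕ} {Ω : Set (Eucl d)}

theorem exists_mem_testFunctions {φ : Eucl d → ℂ} (h1 : ContDiff ℝ ∞ φ)
    (h2 : HasCompactSupport φ) (h3 : tsupport φ ⊆ Ω) :
    ∃ u ∈ testFunctions Ω, (u : Eucl d → ℂ) =ᵐ[volume] φ := by
  have h := (h1.continuous.memLp_of_hasCompactSupport (p := 2) (μ := volume) h2)
  exact ⟨h.toLp φ, ⟨φ, h1, h2, h3, h.coeFn_toLp⟩, h.coeFn_toLp⟩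

/-- The test functions form a subspace. -/
def testSubmodule (Ω : Set (Eucl d)) : Submodule ℂ (L2Space d) where
  carrier := testFunctions Ω
  zero_mem' := ⟨0, contDiff_const, HasCompactSupport.zero, by simp [tsupport], Lp.coeFn_zero _ _ _⟩
  add_mem' := by
    rintro u v ⟨φ, hφ1, hφ2, hφ3, hφ⟩ ⟨ψ, hψ1, hψ2, hψ3, hψ⟩
    refine ⟨φ + ψ, hφ1.add hψ1, hφ2.add hψ2,
      (tsupport_add φ ψ).trans (union_subset hφ3 hψ3), ?_⟩
    filter_upwards [Lp.coeFn_add u v, hφ, hψ] with x h1 h2 h3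
    rw [h1, Pi.add_apply, h2, h3]; rfl
  smul_mem' := by
    rintro c u ⟨φ, hφ1, hφ2, hφ3, hφ⟩
    refine ⟨fun x => c • φ x, hφ1.const_smul c, hφ2.smul_left (f := fun _ => c),
      (tsupport_smul_subset_right (fun _ => c) φ).trans hφ3, ?_⟩
    filter_upwards [Lp.coeFn_smul c u, hφ] with x h1 h2
    rw [h1, Pi.smul_apply, h2]

/-- The L² transform extends the Fourier integral on Schwartz functions. This gives access to
pointwise formulas and rapid decay. -/
theorem fourier_ae_eq_of_mem_testFunctions {u : L2Space d} {φ : Eucl d → ℂ}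
    (h1 : ContDiff ℝ ∞ φ) (h2 : HasCompactSupport φ) (hu : (u : Eucl d → ℂ) =ᵐ[volume] φ) :
    ((𝓕 u : L2Space d) : Eucl d → ℂ) =ᵐ[volume]
      (𝓕 (h2.toSchwartzMap h1) : SchwartzMap (Eucl d) ℂ) := by
  have h : u = (h2.toSchwartzMap h1).toLp 2 := by
    refine Lp.ext (hu.trans ?_)
    exact ((h2.toSchwartzMap h1).coeFn_toLp 2 volume).symm
  rw [h, SchwartzMap.toLp_fourier_eq]
  exact SchwartzMap.coeFn_toLp _ 2 volume

/-- The transform s is Schwartz: one factor of |s|² absorbs the growth (1 + |ξ|²)^m ≤ (1 + |ξ|)^(2m)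
of the multiplier, and the other is integrable. -/
theorem energy_lt_top_of_mem_testFunctions (hd : 0 < d) {g : ℝ → ℝ} (hg : PolynomiallyBounded g)
    {u : L2Space d} (hu : u ∈ testFunctions Ω) : energy g u < ⊤ := by
  obtain ⟨φ, h1, h2, -, hφ⟩ := hu
  obtain ⟨C, m, hC⟩ := hg
  set s : SchwartzMap (Eucl d) ℂ := 𝓕 (h2.toSchwartzMap h1) with hs
  have hF := fourier_ae_eq_of_mem_testFunctions h1 h2 hφ
  obtain ⟨D, hD⟩ : ∃ D : ℝ, ∀ ξ, (1 + ‖ξ‖) ^ (2 * m) * ‖s ξ‖ ≤ D := by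
    refine ⟨2 ^ (2 * m) * ((Finset.Iic (2 * m, 0)).sup fun n => SchwartzMap.seminorm ℝ n.1 n.2) s,
      fun ξ => ?_⟩
    have := SchwartzMap.one_add_le_sup_seminorm_apply (𝕜 := ℝ) (m := (2 * m, 0)) le_rfl le_rfl s ξ
    rwa [norm_iteratedFDeriv_zero] at this
  have hbound : ∀ᵐ ξ : Eucl d ∂volume,
      ENNReal.ofReal ((1 + |g (‖ξ‖ ^ 2)|) * ‖(𝓕 u : L2Space d) ξ‖ ^ 2) ≤
        ENNReal.ofReal ((1 + |C|) * D * ‖s ξ‖) := by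
    filter_upwards [hF, ae_norm_sq_pos hd] with ξ hξ hpos
    rw [hξ]
    refine ENNReal.ofReal_le_ofReal ?_
    have ha : (1 : ℝ) + ‖ξ‖ ^ 2 ≤ (1 + ‖ξ‖) ^ 2 := by nlinarith [norm_nonneg ξ]
    have hb : (1 + ‖ξ‖ ^ 2) ^ m ≤ (1 + ‖ξ‖) ^ (2 * m) := by
      rw [pow_mul]; exact pow_le_pow_left₀ (by positivity) ha m
    have hc : 1 ≤ (1 + ‖ξ‖) ^ (2 * m) := one_le_pow₀ (by linarith [norm_nonneg ξ])
    have hdd : 1 + |g (‖ξ‖ ^ 2)| ≤ (1 + |C|) * (1 + ‖ξ‖) ^ (2 * m) := by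
      have h3 := hC _ hpos
      have h4 : C * (1 + ‖ξ‖ ^ 2) ^ m ≤ |C| * (1 + ‖ξ‖) ^ (2 * m) :=
        mul_le_mul (le_abs_self C) hb (by positivity) (abs_nonneg C)
      linarith
    calc (1 + |g (‖ξ‖ ^ 2)|) * ‖s ξ‖ ^ 2
        ≤ ((1 + |C|) * (1 + ‖ξ‖) ^ (2 * m)) * ‖s ξ‖ ^ 2 := by gcongr
      _ = (1 + |C|) * ((1 + ‖ξ‖) ^ (2 * m) * ‖s ξ‖) * ‖s ξ‖ := by ring
      _ ≤ (1 + |C|) * D * ‖s ξ‖ := by gcongr; exact hD ξ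
  refine lt_of_le_of_lt (lintegral_mono_ae hbound) ?_
  have hint : Integrable (fun ξ => (1 + |C|) * D * ‖s ξ‖) volume :=
    (s.integrable.norm).const_mul _
  exact hint.lintegral_lt_top

/-- Square integrable functions that vanish almost everywhere outside `Ω`. -/
def supportedSubmodule (Ω : Set (Eucl d)) : Submodule ℂ (L2Space d) where
  carrier := {w | ∀ᵐ x ∂(volume : Measure (Eucl d)), x ∉ Ω → w x = 0}
  zero_mem' := by
    filter_upwards [Lp.coeFn_zero ℂ 2 (volume : Measure (Eucl d))] with x hx _
    rw [hx]; rfl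
  add_mem' := by
    intro u v hu hv
    change ∀ᵐ x ∂(volume : Measure (Eucl d)), x ∉ Ω → (u + v) x = 0
    filter_upwards [Lp.coeFn_add u v, hu, hv] with x h1 h2 h3 hx
    rw [h1, Pi.add_apply, h2 hx, h3 hx, add_zero]
  smul_mem' := by
    intro c u hu
    change ∀ᵐ x ∂(volume : Measure (Eucl d)), x ∉ Ω → (c • u) x = 0
    filter_upwards [Lp.coeFn_smul c u, hu] with x h1 h2 hx
    rw [h1, Pi.smul_apply, h2 hx, smul_zero]

theorem isClosed_supportedSubmodule (Ω : Set (Eucl d)) :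
    IsClosed (supportedSubmodule Ω : Set (L2Space d)) := by
  rw [← isSeqClosed_iff_isClosed]
  intro u w hu hlim
  obtain ⟨σ, -, hae⟩ := (tendstoInMeasure_of_tendsto_Lp hlim).exists_seq_tendsto_ae
  have hall : ∀ᵐ x ∂(volume : Measure (Eucl d)), ∀ m, x ∉ Ω → u m x = 0 := ae_all_iff.2 hu
  change ∀ᵐ x ∂(volume : Measure (Eucl d)), x ∉ Ω → w x = 0
  filter_upwards [hae, hall] with x h1 h2 hx
  refine tendsto_nhds_unique h1 ?_
  simp only [h2 _ hx]
  exact tendsto_const_nhds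

theorem testFunctions_subset_supported : testFunctions Ω ⊆ supportedSubmodule Ω := by
  rintro u ⟨φ, -, -, h3, hφ⟩
  change ∀ᵐ x ∂(volume : Measure (Eucl d)), x ∉ Ω → u x = 0
  filter_upwards [hφ] with x hx hxΩ
  rw [hx]
  exact image_eq_zero_of_notMem_tsupport fun h => hxΩ (h3 h)

/-- A function in `L²(Ω)` that is orthogonal to the test functions on `Ω` vanishes. -/
theorem eq_zero_of_inner_testFunctions (hΩ : IsOpen Ω) {w : L2Space d}
    (hw : w ∈ supportedSubmodule Ω) (h : ∀ φ ∈ testFunctions Ω, ⟪φ, w⟫_ℂ = 0) : w = 0 := by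
  have hloc : LocallyIntegrable (w : Eucl d → ℂ) volume :=
    (Lp.memLp w).locallyIntegrable (by norm_num)
  have h0 := hΩ.ae_eq_zero_of_integral_contDiff_smul_eq_zero (hloc.locallyIntegrableOn Ω) (by
    intro g hg1 hg2 hg3
    obtain ⟨u, hu, hug⟩ := exists_mem_testFunctions (Ω := Ω) (φ := fun x => (g x : ℂ))
      (Complex.ofRealCLM.contDiff.comp hg1) (hg2.comp_left (g := Complex.ofReal) rfl)
      ((closure_mono (by intro x hx hgx; exact hx (by simp [hgx]))).trans hg3)
    rw [← h u hu, L2.inner_def]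
    refine integral_congr_ae ?_
    filter_upwards [hug] with x hx
    rw [hx]
    simp [mul_comm])
  refine Lp.ext ?_
  filter_upwards [h0, hw, Lp.coeFn_zero ℂ 2 (volume : Measure (Eucl d))] with x h1 h2 h3
  rw [h3]
  by_cases hx : x ∈ Ω
  · exact h1 hx
  · exact h2 hx

/-- A nonempty open set carries an orthogonal sequence of nonzero test functions. -/
theorem exists_orthogonal_testFunctions (hd : 0 < d) (hΩ : IsOpen Ω) (hne : Ω.Nonempty) :
    ∃ u : ℕ → L2Space d, (∀ n, u n ∈ testFunctions Ω) ∧ (∀ n, u n ≠ 0) ∧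
      Pairwise fun m n => ⟪u m, u n⟫_ℂ = 0 := by
  have : Nonempty (Fin d) := ⟨⟨0, hd⟩⟩
  obtain ⟨x0, hx0⟩ := hne
  have hinf : Infinite Ω := (infinite_of_mem_nhds x0 (hΩ.mem_nhds hx0)).to_subtype
  obtain ⟨U, hUinf, hUo, hdisj⟩ := exists_seq_infinite_isOpen_pairwise_disjoint Ω
  have hopen : ∀ n, IsOpen ((↑) '' U n : Set (Eucl d)) := fun n =>
    hΩ.isOpenMap_subtype_val _ (hUo n)
  have hdisj' : Pairwise fun m n => Disjoint ((↑) '' U m : Set (Eucl d)) ((↑) '' U n) :=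
    fun m n hmn => (disjoint_image_iff Subtype.val_injective).2 (hdisj hmn)
  have hbump : ∀ n, ∃ f : Eucl d → ℝ, tsupport f ⊆ (↑) '' U n ∧ HasCompactSupport f ∧
      ContDiff ℝ ∞ f ∧ ∃ x, f x = 1 := by
    intro n
    obtain ⟨x, hx⟩ := (hUinf n).nonempty
    obtain ⟨f, h1, h2, h3, -, h4⟩ := exists_contDiff_tsupport_subset (n := (⊤ : ℕ∞))
      ((hopen n).mem_nhds ⟨x, hx, rfl⟩)
    exact ⟨f, h1, h2, h3, _, h4⟩
  choose f hf1 hf2 hf3 hf4 using hbump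
  have hsub : ∀ n, tsupport (fun x => (f n x : ℂ)) ⊆ (↑) '' U n := fun n =>
    (closure_mono (by intro x hx hgx; exact hx (by simp [hgx]))).trans (hf1 n)
  have hex := fun n => exists_mem_testFunctions (Ω := Ω) (φ := fun x => (f n x : ℂ))
      (Complex.ofRealCLM.contDiff.comp (hf3 n)) ((hf2 n).comp_left (g := Complex.ofReal) rfl)
      ((hsub n).trans (by rintro _ ⟨x, -, rfl⟩; exact x.2))
  choose u hu huf using hex
  refine ⟨u, hu, fun n h0 => ?_, fun m n hmn => ?_⟩
  · obtain ⟨x, hx⟩ := hf4 n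
    have h1 : (fun x => (f n x : ℂ)) =ᵐ[volume] fun _ => 0 := by
      filter_upwards [huf n, Lp.coeFn_zero ℂ 2 (volume : Measure (Eucl d))] with y h1 h2
      rw [← h1, h0, h2]; rfl
    have h2 := (Continuous.ae_eq_iff_eq volume
      (Complex.continuous_ofReal.comp (hf3 n).continuous) continuous_const).1 h1
    have h3 := congrFun h2 x
    simp [hx] at h3
  · change ⟪u m, u n⟫_ℂ = 0
    rw [L2.inner_def]
    refine integral_eq_zero_of_ae ?_
    filter_upwards [huf m, huf n] with x h1 h2
    rw [h1, h2]
    by_cases hx : x ∈ ((↑) '' U m : Set (Eucl d))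
    · have : x ∉ tsupport (fun x => (f n x : ℂ)) := fun h =>
        (Set.disjoint_left.1 (hdisj' hmn) hx) (hsub n h)
      have h0 : (f n x : ℂ) = 0 := image_eq_zero_of_notMem_tsupport (f := fun x => (f n x : ℂ)) this
      simp [h0]
    · have : x ∉ tsupport (fun x => (f m x : ℂ)) := fun h => hx (hsub m h)
      have h0 : (f m x : ℂ) = 0 := image_eq_zero_of_notMem_tsupport (f := fun x => (f m x : ℂ)) this
      simp [h0]

end TestFunctions

/-! ### The closed form of a multiplier and discreteness of its spectrum -/

section FormDomain

variable {d : ℕ} {Ω : Set (Eucl d)} {g : ℝ → ℝ}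

theorem testFunctions_subset_formDomain (g : ℝ → ℝ) (Ω : Set (Eucl d)) :
    testFunctions Ω ⊆ formDomain g Ω := fun φ hφ ε hε => ⟨φ, hφ, by rwa [sub_self, energy_zero]⟩

/-- The form domain as a subspace. -/
def formSubmodule (hg : IsSymbol d g) (Ω : Set (Eucl d)) : Submodule ℂ (L2Space d) where
  carrier := formDomain g Ω
  zero_mem' := testFunctions_subset_formDomain g Ω (testSubmodule Ω).zero_mem
  add_mem' := by
    intro u v hu hv ε hε
    obtain ⟨φ, hφ, h1⟩ := hu (ε / 4) (ENNReal.div_pos hε.ne' (by norm_num))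
    obtain ⟨ψ, hψ, h2⟩ := hv (ε / 4) (ENNReal.div_pos hε.ne' (by norm_num))
    refine ⟨φ + ψ, (testSubmodule Ω).add_mem hφ hψ, ?_⟩
    rw [add_sub_add_comm]
    have h3 : (2 : ℝ≥0∞) * (ε / 4) + 2 * (ε / 4) = ε := by
      rw [← add_mul, show (2 : ℝ≥0∞) + 2 = 4 by norm_num, ENNReal.mul_div_cancel (by norm_num)
        (by norm_num)]
    calc _ ≤ 2 * energy g (u - φ) + 2 * energy g (v - ψ) := energy_add_le hg.aemeasurable _ _
      _ < 2 * (ε / 4) + 2 * (ε / 4) := by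
        refine ENNReal.add_lt_add ?_ ?_
        · exact (ENNReal.mul_lt_mul_iff_right (by norm_num) (by norm_num)).2 h1
        · exact (ENNReal.mul_lt_mul_iff_right (by norm_num) (by norm_num)).2 h2
      _ = ε := h3
  smul_mem' := by
    intro c u hu ε hε
    obtain ⟨φ, hφ, h1⟩ := hu (ε / ENNReal.ofReal (‖c‖ ^ 2 + 1))
      (ENNReal.div_pos hε.ne' ENNReal.ofReal_ne_top)
    refine ⟨c • φ, (testSubmodule Ω).smul_mem c hφ, ?_⟩
    rw [← smul_sub, energy_smul]
    have hpos : ENNReal.ofReal (‖c‖ ^ 2 + 1) ≠ 0 := by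
      simp only [ne_eq, ENNReal.ofReal_eq_zero, not_le]; positivity
    rw [ENNReal.lt_div_iff_mul_lt (Or.inl hpos) (Or.inl ENNReal.ofReal_ne_top)] at h1
    refine lt_of_le_of_lt ?_ h1
    rw [mul_comm]
    gcongr
    linarith

theorem energy_lt_top_of_mem_formDomain (hd : 0 < d) (hg : IsSymbol d g) {u : L2Space d}
    (hu : u ∈ formDomain g Ω) : energy g u < ⊤ := by
  obtain ⟨φ, hφ, h⟩ := hu 1 one_pos
  have h1 := energy_add_le hg.aemeasurable (u - φ) φ
  rw [sub_add_cancel] at h1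
  refine lt_of_le_of_lt h1 (ENNReal.add_lt_top.2 ⟨?_, ?_⟩)
  · exact ENNReal.mul_lt_top (by norm_num) (h.trans ENNReal.one_lt_top)
  · exact ENNReal.mul_lt_top (by norm_num)
      (energy_lt_top_of_mem_testFunctions hd hg.polynomiallyBounded hφ)

/-- Functions in the form domain are limits of test functions, in energy and in `L²`. -/
theorem exists_seq_testFunctions {u : L2Space d} (hu : u ∈ formDomain g Ω) :
    ∃ φ : ℕ → L2Space d, (∀ m, φ m ∈ testFunctions Ω) ∧
      Tendsto (fun m => energy g (u - φ m)) atTop (𝓝 0) ∧ Tendsto φ atTop (𝓝 u) := by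
  have hpos : ∀ m : ℕ, (0 : ℝ≥0∞) < ENNReal.ofReal (1 / (m + 1)) := fun m => by
    rw [ENNReal.ofReal_pos]; positivity
  choose φ hφ hlt using fun m : ℕ => hu _ (hpos m)
  have h0 : Tendsto (fun m : ℕ => ENNReal.ofReal (1 / ((m : ℝ) + 1))) atTop (𝓝 0) := by
    have := ENNReal.tendsto_ofReal tendsto_one_div_add_atTop_nhds_zero_nat
    rwa [ENNReal.ofReal_zero] at this
  have h1 : Tendsto (fun m => energy g (u - φ m)) atTop (𝓝 0) :=
    tendsto_of_tendsto_of_tendsto_of_le_of_le tendsto_const_nhds h0 (fun _ => zero_le)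
      fun m => (hlt m).le
  refine ⟨φ, hφ, h1, ?_⟩
  have h2 : Tendsto (fun m => ‖u - φ m‖ ^ 2) atTop (𝓝 0) := by
    have h3 := tendsto_of_tendsto_of_tendsto_of_le_of_le tendsto_const_nhds h1 (fun _ => zero_le)
      fun m => norm_sq_le_energy g (u - φ m)
    have h4 := (ENNReal.tendsto_toReal ENNReal.zero_ne_top).comp h3
    refine h4.congr fun m => ?_
    simp only [Function.comp_apply]
    rw [ENNReal.toReal_ofReal (by positivity)]
  have h3 := h2.sqrt
  simp only [Real.sqrt_zero, Real.sqrt_sq (norm_nonneg _)] at h3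
  have h4 : Tendsto (fun m => u - φ m) atTop (𝓝 0) := tendsto_zero_iff_norm_tendsto_zero.2 h3
  have h5 := h4.const_sub u
  simpa using h5

theorem formDomain_subset_supported : formDomain g Ω ⊆ supportedSubmodule Ω := by
  intro u hu
  obtain ⟨φ, hφ, -, hlim⟩ := exists_seq_testFunctions hu
  exact (isClosed_supportedSubmodule Ω).mem_of_tendsto hlim
    (Eventually.of_forall fun m => testFunctions_subset_supported (hφ m))

theorem integrable_multiplierForm (hg : AEMeasurable (fun ξ : Eucl d => g (‖ξ‖ ^ 2)) volume)
    {u v : L2Space d} (hu : energy g u < ⊤) (hv : energy g v < ⊤) :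
    Integrable (fun ξ : Eucl d =>
      (g (‖ξ‖ ^ 2) : ℂ) * (𝓕 u : L2Space d) ξ * star ((𝓕 v : L2Space d) ξ)) volume := by
  have h1 := (integrable_of_energy_lt_top hg hu).norm
  have h2 := (integrable_of_energy_lt_top hg hv).norm
  refine (h1.add h2).mono' ?_ (Eventually.of_forall fun ξ => ?_)
  · have hgc : AEMeasurable (fun ξ : Eucl d => (g (‖ξ‖ ^ 2) : ℂ)) volume :=
      Complex.measurable_ofReal.comp_aemeasurable hg
    have hstar : AEMeasurable (fun ξ : Eucl d => star ((𝓕 v : L2Space d) ξ)) volume :=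
      continuous_star.measurable.comp_aemeasurable (aemeasurable_fourier v)
    exact ((hgc.mul (aemeasurable_fourier u)).mul hstar).aestronglyMeasurable
  · simp only [Pi.add_apply, norm_mul, norm_star, Complex.norm_real, norm_pow, norm_norm]
    rw [← mul_add, mul_assoc]
    gcongr
    nlinarith [sq_nonneg (‖(𝓕 u : L2Space d) ξ‖ - ‖(𝓕 v : L2Space d) ξ‖),
      norm_nonneg ((𝓕 u : L2Space d) ξ), norm_nonneg ((𝓕 v : L2Space d) ξ)]

theorem multiplierForm_add_left (hg : AEMeasurable (fun ξ : Eucl d => g (‖ξ‖ ^ 2)) volume)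
    {u v w : L2Space d} (hu : energy g u < ⊤) (hv : energy g v < ⊤) (hw : energy g w < ⊤) :
    multiplierForm g (u + v) w = multiplierForm g u w + multiplierForm g v w := by
  rw [multiplierForm, multiplierForm, multiplierForm, ← integral_add
    (integrable_multiplierForm hg hu hw) (integrable_multiplierForm hg hv hw)]
  refine integral_congr_ae ?_
  filter_upwards [fourier_coe_add u v] with ξ hξ
  rw [hξ]; ring

theorem multiplierForm_smul_left (g : ℝ → ℝ) (c : ℂ) (u w : L2Space d) :
    multiplierForm g (c • u) w = c * multiplierForm g u w := by
  rw [multiplierForm, multiplierForm, ← integral_const_mul]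
  refine integral_congr_ae ?_
  filter_upwards [fourier_coe_smul c u] with ξ hξ
  rw [hξ]; ring

theorem multiplierForm_symm (g : ℝ → ℝ) (u v : L2Space d) :
    multiplierForm g v u = star (multiplierForm g u v) := by
  rw [multiplierForm, multiplierForm, Complex.star_def, ← integral_conj]
  refine integral_congr_ae (Eventually.of_forall fun ξ => ?_)
  simp only [map_mul, Complex.conj_ofReal, Complex.conj_conj]
  ring

theorem re_multiplierForm_self (hg : AEMeasurable (fun ξ : Eucl d => g (‖ξ‖ ^ 2)) volume)
    {u : L2Space d} (hu : energy g u < ⊤) :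
    (multiplierForm g u u).re = ∫ ξ : Eucl d, g (‖ξ‖ ^ 2) * ‖(𝓕 u : L2Space d) ξ‖ ^ 2 := by
  have h := integral_re (integrable_multiplierForm hg hu hu)
  rw [multiplierForm]
  refine Eq.trans h.symm (integral_congr_ae (Eventually.of_forall fun ξ => ?_))
  simp only [mul_assoc, Complex.star_def, Complex.mul_conj']
  rw [← Complex.ofReal_pow, ← Complex.ofReal_mul]
  exact Complex.ofReal_re _

/-- The form of the multiplier on its form domain. -/
def symbolForm (hd : 0 < d) (hg : IsSymbol d g) (Ω : Set (Eucl d)) :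
    SesqForm (formSubmodule hg Ω) :=
  LinearMap.mk₂'ₛₗ (starRingEnd ℂ) (RingHom.id ℂ)
    -- The arguments are exchanged: `SesqForm` is conjugate-linear in its first variable,
    -- `multiplierForm` in its second.
    (fun v u => multiplierForm g (u : L2Space d) (v : L2Space d))
    (fun v₁ v₂ u => by
      have h := fun v : formSubmodule hg Ω => energy_lt_top_of_mem_formDomain hd hg v.2
      rw [multiplierForm_symm g _ (u : L2Space d), multiplierForm_symm g (v₁ : L2Space d),
        multiplierForm_symm g (v₂ : L2Space d), ← star_add]
      exact congrArg star (multiplierForm_add_left hg.aemeasurable (h v₁) (h v₂) (h u)))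
    (fun c v u => by
      rw [multiplierForm_symm, multiplierForm_symm g (v : L2Space d), smul_eq_mul,
        Complex.star_def, ← map_mul]
      exact congrArg star (multiplierForm_smul_left g c _ _))
    (fun v u₁ u₂ => by
      have h := fun v : formSubmodule hg Ω => energy_lt_top_of_mem_formDomain hd hg v.2
      exact multiplierForm_add_left hg.aemeasurable (h u₁) (h u₂) (h v))
    (fun c v u => multiplierForm_smul_left g c _ _)

theorem symbolForm_isHerm (hd : 0 < d) (hg : IsSymbol d g) : (symbolForm hd hg Ω).IsHerm :=
  fun _ _ => multiplierForm_symm g _ _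

theorem symbolForm_quad (hd : 0 < d) (hg : IsSymbol d g) (u : formSubmodule hg Ω) :
    (symbolForm hd hg Ω).quad u =
      ∫ ξ : Eucl d, g (‖ξ‖ ^ 2) * ‖(𝓕 (u : L2Space d) : L2Space d) ξ‖ ^ 2 :=
  re_multiplierForm_self hg.aemeasurable (energy_lt_top_of_mem_formDomain hd hg u.2)

/-- If g ≥ -C with C ≥ 0 then |g| ≤ g + 2C; the 1 in the energy density accounts for the rest of 2C
+ 1. Form bounds thereby become energy bounds. -/
theorem energy_le_integral (hd : 0 < d) {C : ℝ}
    (hm : AEMeasurable (fun ξ : Eucl d => g (‖ξ‖ ^ 2)) volume) (hC0 : 0 ≤ C)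
    (hC : ∀ t : ℝ, 0 < t → -C ≤ g t) {u : L2Space d} (hu : energy g u < ⊤) :
    energy g u ≤ ENNReal.ofReal
      ((∫ ξ : Eucl d, g (‖ξ‖ ^ 2) * ‖(𝓕 u : L2Space d) ξ‖ ^ 2) + (2 * C + 1) * ‖u‖ ^ 2) := by
  have hi := integrable_of_energy_lt_top hm hu
  have hn := integral_norm_fourier_sq u
  rw [← hn.2, ← integral_const_mul, ← integral_add hi (hn.1.const_mul _),
    ofReal_integral_eq_lintegral_ofReal (f := fun ξ : Eucl d =>
      g (‖ξ‖ ^ 2) * ‖(𝓕 u : L2Space d) ξ‖ ^ 2 + (2 * C + 1) * ‖(𝓕 u : L2Space d) ξ‖ ^ 2)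
      (hi.add (hn.1.const_mul _))]
  · refine lintegral_mono_ae ?_
    filter_upwards [ae_norm_sq_pos hd] with ξ hξ
    refine ENNReal.ofReal_le_ofReal ?_
    rw [← add_mul]
    refine mul_le_mul_of_nonneg_right ?_ (sq_nonneg _)
    have := hC _ hξ
    rcases abs_cases (g (‖ξ‖ ^ 2)) with ⟨h, -⟩ | ⟨h, -⟩ <;> linarith
  · filter_upwards [ae_norm_sq_pos hd] with ξ hξ
    rw [← add_mul]
    have := hC _ hξ
    refine mul_nonneg ?_ (sq_nonneg _)
    linarith

theorem ofReal_integral_le_energy (hm : AEMeasurable (fun ξ : Eucl d => g (‖ξ‖ ^ 2)) volume)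
    {u : L2Space d} (hu : energy g u < ⊤) :
    ENNReal.ofReal (∫ ξ : Eucl d, g (‖ξ‖ ^ 2) * ‖(𝓕 u : L2Space d) ξ‖ ^ 2) ≤ energy g u := by
  rw [energy_eq_ofReal_integral hm hu]
  refine ENNReal.ofReal_le_ofReal (integral_mono (integrable_of_energy_lt_top hm hu) ?_ fun ξ => ?_)
  · have := (integral_norm_fourier_sq u).1.add (integrable_of_energy_lt_top hm hu).norm
    refine this.congr (Eventually.of_forall fun ξ => ?_)
    simp only [Pi.add_apply, norm_mul, norm_pow, norm_norm]
    rw [Real.norm_eq_abs]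
    ring
  · simp only
    gcongr
    linarith [le_abs_self (g (‖ξ‖ ^ 2))]

theorem neg_mul_norm_sq_le_integral (hd : 0 < d) {C : ℝ}
    (hm : AEMeasurable (fun ξ : Eucl d => g (‖ξ‖ ^ 2)) volume)
    (hC : ∀ t : ℝ, 0 < t → -C ≤ g t) {u : L2Space d} (hu : energy g u < ⊤) :
    -C * ‖u‖ ^ 2 ≤ ∫ ξ : Eucl d, g (‖ξ‖ ^ 2) * ‖(𝓕 u : L2Space d) ξ‖ ^ 2 := by
  have hn := integral_norm_fourier_sq u
  rw [← hn.2, ← integral_const_mul]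
  refine integral_mono_ae (hn.1.const_mul _) (integrable_of_energy_lt_top hm hu) ?_
  filter_upwards [ae_norm_sq_pos hd] with ξ hξ
  gcongr
  exact hC _ hξ

/-- Sequences of test functions of bounded energy have subsequences converging in `L²`. -/
def HasCompactTestFunctions (g : ℝ → ℝ) (Ω : Set (Eucl d)) : Prop :=
  ∀ (φ : ℕ → L2Space d) (R : ℝ), (∀ m, φ m ∈ testFunctions Ω) →
    (∀ m, energy g (φ m) ≤ ENNReal.ofReal R) →
    ∃ (w : L2Space d) (σ : ℕ → ℕ), StrictMono σ ∧ Tendsto (fun m => φ (σ m)) atTop (𝓝 w)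

/-- Compactness passes from test functions to the form domain by approximation in energy, closedness
is Fatou's lemma, and bumps with disjoint supports give infinite dimension. -/
theorem symbolForm_hasCompactResolvent (hd : 0 < d) (hg : IsSymbol d g) (hΩ : IsOpen Ω)
    (hne : Ω.Nonempty) (hcpt : HasCompactTestFunctions g Ω) :
    (symbolForm hd hg Ω).HasCompactResolvent := by
  obtain ⟨C, hC0, hC⟩ := hg.bddBelow
  have hfin := fun v : formSubmodule hg Ω => energy_lt_top_of_mem_formDomain hd hg v.2
  have hupper : ∀ v : formSubmodule hg Ω, energy g (v : L2Space d) ≤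
      ENNReal.ofReal ((symbolForm hd hg Ω).quad v + (2 * C + 1) * ‖v‖ ^ 2) := fun v => by
    rw [symbolForm_quad]
    exact energy_le_integral hd hg.aemeasurable hC0 hC (hfin v)
  have hlower : ∀ v : formSubmodule hg Ω, -C * ‖v‖ ^ 2 ≤ (symbolForm hd hg Ω).quad v := fun v => by
    rw [symbolForm_quad]
    exact neg_mul_norm_sq_le_integral hd hg.aemeasurable hC (hfin v)
  refine ⟨symbolForm_isHerm hd hg, ⟨C, fun v => by linarith [hlower v]⟩, ?_, ?_, ?_⟩
  · intro v R hvn hvq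
    have hpos : ∀ m : ℕ, (0 : ℝ≥0∞) < ENNReal.ofReal (1 / (m + 1)) := fun m => by
      rw [ENNReal.ofReal_pos]; positivity
    -- Test functions within 1/(m+1) of v m in energy, hence also in squared L² norm; their energies
    -- stay bounded and a subsequence converges, so v m converges along it to the same limit.
    choose φ hφ hlt using fun m : ℕ => (v m).2 _ (hpos m)
    have hR0 : 0 ≤ R := (norm_nonneg _).trans (hvn 0)
    have hφR : ∀ m, energy g (φ m) ≤ ENNReal.ofReal (2 * 1 + 2 * (R + (2 * C + 1) * R ^ 2)) := by
      intro m
      have h2 : (2 : ℝ≥0∞) = ENNReal.ofReal 2 := by simp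
      have h1 := energy_sub_le hg.aemeasurable (φ m) (v m) 0
      rw [sub_zero, sub_zero, ← energy_neg g (φ m - _), neg_sub] at h1
      refine h1.trans ?_
      rw [ENNReal.ofReal_add (by positivity) (by positivity), ENNReal.ofReal_mul zero_le_two,
        ENNReal.ofReal_mul zero_le_two, ← h2]
      gcongr
      · refine (hlt m).le.trans (ENNReal.ofReal_le_ofReal ?_)
        rw [div_le_one (by positivity)]
        linarith [(Nat.cast_nonneg m : (0 : ℝ) ≤ m)]
      · refine (hupper (v m)).trans (ENNReal.ofReal_le_ofReal ?_)
        have := hvn m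
        have := hvq m
        gcongr
    obtain ⟨w, σ, hσ, hlim⟩ := hcpt φ _ hφ hφR
    refine ⟨w, σ, hσ, ?_⟩
    have h1 : ∀ m, ‖(v m : L2Space d) - φ m‖ ≤ √(1 / ((m : ℝ) + 1)) := by
      intro m
      refine Real.le_sqrt_of_sq_le ?_
      have := (norm_sq_le_energy g ((v m : L2Space d) - φ m)).trans (hlt m).le
      rwa [ENNReal.ofReal_le_ofReal_iff (by positivity)] at this
    have h2 : Tendsto (fun m : ℕ => √(1 / ((m : ℝ) + 1))) atTop (𝓝 0) := by
      have := (tendsto_one_div_add_atTop_nhds_zero_nat (𝕜 := ℝ)).sqrt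
      rwa [Real.sqrt_zero] at this
    have h3 : Tendsto (fun m => (v m : L2Space d) - φ m) atTop (𝓝 0) :=
      squeeze_zero_norm h1 h2
    have h4 := (h3.comp hσ.tendsto_atTop).add hlim
    simpa using h4
  · intro v w hlim hCauchy
    -- Fix one index of the Cauchy condition and let the other tend to infinity; the energy is lower
    -- semicontinuous. The L² tolerance is chosen so that the term (2C + 1)‖·‖² contributes at most
    -- ε/2.
    have hen : ∀ ε : ℝ, 0 < ε → ∃ N, ∀ m ≥ N,
        energy g ((v m : L2Space d) - w) ≤ ENNReal.ofReal ε := by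
      intro ε hε
      obtain ⟨N1, hN1⟩ := hCauchy (ε / 2) (by positivity)
      obtain ⟨N2, hN2⟩ := Metric.cauchySeq_iff.1 hlim.cauchySeq (√(ε / 2 / (2 * C + 1)))
        (by positivity)
      refine ⟨max N1 N2, fun m hm => ?_⟩
      refine energy_le_of_tendsto hg.aemeasurable (tendsto_const_nhds.sub hlim) ?_
      filter_upwards [eventually_ge_atTop (max N1 N2)] with l hl
      have h1 := hN1 m (le_of_max_le_left hm) l (le_of_max_le_left hl)
      have h2 := hN2 m (le_of_max_le_right hm) l (le_of_max_le_right hl)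
      rw [dist_eq_norm, Real.lt_sqrt (norm_nonneg _), lt_div_iff₀ (by positivity)] at h2
      have h3 := hupper (v m - v l)
      refine h3.trans (ENNReal.ofReal_le_ofReal ?_)
      have h4 : ‖v m - v l‖ ^ 2 * (2 * C + 1) < ε / 2 := h2
      linarith
    have hmem : w ∈ formDomain g Ω := by
      intro ε hε
      obtain ⟨δ, hδ, hδε⟩ : ∃ δ : ℝ, 0 < δ ∧ 2 * ENNReal.ofReal δ + 2 * ENNReal.ofReal δ < ε := by
        have h1 : Tendsto (fun δ : ℝ => 2 * ENNReal.ofReal δ + 2 * ENNReal.ofReal δ) (𝓝[>] 0)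
            (𝓝 0) := by
          have h2 : Tendsto (fun δ : ℝ => ENNReal.ofReal δ) (𝓝[>] 0) (𝓝 0) := by
            have := (ENNReal.continuous_ofReal.tendsto 0).mono_left
              (nhdsWithin_le_nhds (s := Ioi (0 : ℝ)))
            rwa [ENNReal.ofReal_zero] at this
          have h3 := ENNReal.Tendsto.const_mul h2 (Or.inr (by norm_num : (2 : ℝ≥0∞) ≠ ⊤))
          simpa using h3.add h3
        obtain ⟨δ, h2, h3⟩ := ((h1.eventually_lt_const hε).and self_mem_nhdsWithin).exists
        exact ⟨δ, h3, h2⟩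
      obtain ⟨N, hN⟩ := hen δ hδ
      obtain ⟨φ, hφ, h1⟩ := (v N).2 (ENNReal.ofReal δ) (ENNReal.ofReal_pos.2 hδ)
      refine ⟨φ, hφ, lt_of_le_of_lt ?_ hδε⟩
      refine (energy_sub_le hg.aemeasurable w (v N) φ).trans ?_
      gcongr
      rw [← energy_neg, neg_sub]
      exact hN N le_rfl
    refine ⟨⟨w, hmem⟩, rfl, ?_⟩
    have hnorm : Tendsto (fun m => ‖v m - (⟨w, hmem⟩ : formSubmodule hg Ω)‖ ^ 2) atTop (𝓝 0) := by
      have := ((hlim.sub_const w).norm).pow 2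
      simpa using this
    refine Metric.tendsto_atTop.2 fun ε hε => ?_
    obtain ⟨N1, hN1⟩ := hen (ε / 2) (by positivity)
    have hnC := hnorm.const_mul C
    rw [mul_zero] at hnC
    obtain ⟨N2, hN2⟩ := eventually_atTop.1 (hnC.eventually_lt_const hε)
    refine ⟨max N1 N2, fun m hm => ?_⟩
    have h1 := hlower (v m - (⟨w, hmem⟩ : formSubmodule hg Ω))
    have h2 := hN2 m (le_of_max_le_right hm)
    have h3 := ofReal_integral_le_energy hg.aemeasurable
      (hfin (v m - (⟨w, hmem⟩ : formSubmodule hg Ω)))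
    rw [← symbolForm_quad hd hg (v m - (⟨w, hmem⟩ : formSubmodule hg Ω))] at h3
    have h4 := h3.trans (hN1 m (le_of_max_le_left hm))
    rw [ENNReal.ofReal_le_ofReal_iff (by positivity)] at h4
    rw [Real.dist_eq, sub_zero, abs_lt]
    constructor <;> linarith
  · intro W hW htop
    obtain ⟨u, hu, hu0, horth⟩ := exists_orthogonal_testFunctions hd hΩ hne
    subst htop
    let u' : ℕ → formSubmodule hg Ω := fun n => ⟨u n, testFunctions_subset_formDomain g Ω (hu n)⟩
    have hli : LinearIndependent ℂ u' := by
      refine linearIndependent_of_ne_zero_of_inner_eq_zero (fun n h => hu0 n ?_) ?_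
      · exact congrArg Subtype.val h
      · exact horth
    have : FiniteDimensional ℂ (formSubmodule hg Ω) := Module.finite_def.2 (Module.Finite.iff_fg.1 hW)
    exact not_finite_iff_infinite.2 (inferInstance : Infinite ℕ) hli.finite

/-- Discreteness of the spectrum. -/
theorem exists_isEigenvalueSequence (hd : 0 < d) (hg : IsSymbol d g) (hΩ : IsOpen Ω)
    (hne : Ω.Nonempty) (hcpt : HasCompactTestFunctions g Ω) :
    ∃ a, IsEigenvalueSequence g Ω a := by
  obtain ⟨a, u, hmono, htop, hu, heig, hdense⟩ :=
    (symbolForm_hasCompactResolvent hd hg hΩ hne hcpt).exists_eigenvectors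
  refine ⟨a, hmono, htop, fun k => u k, hu, fun k => ⟨(u k).2, fun v hv => heig k ⟨v, hv⟩⟩, ?_⟩
  intro w hw horth
  -- It is enough to test w against test functions, and these are limits of finite combinations of
  -- eigenfunctions.
  refine eq_zero_of_inner_testFunctions hΩ hw fun φ hφ => ?_
  let φ' : formSubmodule hg Ω := ⟨φ, testFunctions_subset_formDomain g Ω hφ⟩
  have h1 : Tendsto (fun N => ((∑ k ∈ Finset.range N, ⟪u k, φ'⟫_ℂ • u k : formSubmodule hg Ω) :
      L2Space d)) atTop (𝓝 φ) := tendsto_subtype_rng.1 (hdense φ')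
  have h2 := h1.inner (tendsto_const_nhds (x := w)) (𝕜 := ℂ)
  refine tendsto_nhds_unique h2 ?_
  refine tendsto_const_nhds.congr fun N => ?_
  rw [Submodule.coe_sum, sum_inner]
  symm
  refine Finset.sum_eq_zero fun k _ => ?_
  rw [Submodule.coe_smul, inner_smul_left, horth, mul_zero]

end FormDomain

/-! ### Affine changes of variable in L² and on the Fourier side -/

section AffinePullback

variable {d : ℕ}

theorem LinearMap.det_adjoint_real {E : Type*} [NormedAddCommGroup E] [InnerProductSpace ℝ E]
    [FiniteDimensional ℝ E] (M : E →ₗ[ℝ] E) : LinearMap.det (LinearMap.adjoint M) = LinearMap.det M := by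
  have b := stdOrthonormalBasis ℝ E
  rw [← LinearMap.det_toMatrix b.toBasis, ← LinearMap.det_toMatrix b.toBasis,
    LinearMap.toMatrix_adjoint, Matrix.det_conjTranspose, star_trivial]

variable {M : Eucl d →ₗ[ℝ] Eucl d}

/-- The affine homeomorphism `x ↦ M x + b`. -/
def affineHomeo (hM : LinearMap.det M ≠ 0) (b : Eucl d) : Eucl d ≃ₜ Eucl d :=
  (M.equivOfDetNeZero hM).toContinuousLinearEquiv.toHomeomorph.trans (Homeomorph.addRight b)

theorem affineHomeo_apply (hM : LinearMap.det M ≠ 0) (b x : Eucl d) :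
    affineHomeo hM b x = M x + b := rfl

theorem map_affineHomeo (hM : LinearMap.det M ≠ 0) (b : Eucl d) :
    Measure.map (affineHomeo hM b) volume =
      ENNReal.ofReal |LinearMap.det M|⁻¹ • (volume : Measure (Eucl d)) := by
  have h1 : (affineHomeo hM b : Eucl d → Eucl d) = (fun x => x + b) ∘ M := rfl
  rw [h1, ← Measure.map_map (measurable_add_const b) M.continuous_of_finiteDimensional.measurable,
    Measure.map_linearMap_addHaar_eq_smul_addHaar volume hM, Measure.map_smul,
    map_add_right_eq_self, abs_inv]

theorem quasiMeasurePreserving_affineHomeo (hM : LinearMap.det M ≠ 0) (b : Eucl d) :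
    Measure.QuasiMeasurePreserving (affineHomeo hM b) volume volume :=
  ⟨(affineHomeo hM b).continuous.measurable, by
    rw [map_affineHomeo]
    exact Measure.smul_absolutelyContinuous⟩

theorem integral_comp_affineHomeo {F : Type*} [NormedAddCommGroup F] [NormedSpace ℝ F]
    (hM : LinearMap.det M ≠ 0) (b : Eucl d) (G : Eucl d → F) :
    ∫ x, G (affineHomeo hM b x) = |LinearMap.det M|⁻¹ • ∫ y, G y := by
  rw [← (affineHomeo hM b).measurableEmbedding.integral_map, map_affineHomeo,
    integral_smul_measure, ENNReal.toReal_ofReal (by positivity)]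

theorem lintegral_comp_affineHomeo (hM : LinearMap.det M ≠ 0) (b : Eucl d)
    (G : Eucl d → ℝ≥0∞) :
    ∫⁻ x, G (affineHomeo hM b x) = ENNReal.ofReal |LinearMap.det M|⁻¹ * ∫⁻ y, G y := by
  rw [← (affineHomeo hM b).measurableEmbedding.lintegral_map, map_affineHomeo,
    lintegral_smul_measure, smul_eq_mul]

theorem memLp_comp_affineHomeo (hM : LinearMap.det M ≠ 0) (b : Eucl d) (u : L2Space d) :
    MemLp ((u : Eucl d → ℂ) ∘ affineHomeo hM b) 2 volume := by
  refine MemLp.comp_of_map ?_ (affineHomeo hM b).continuous.aemeasurable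
  rw [map_affineHomeo]
  exact (Lp.memLp u).smul_measure ENNReal.ofReal_ne_top

theorem L2Space.norm_sq_eq_integral (u : L2Space d) : ‖u‖ ^ 2 = ∫ x, ‖u x‖ ^ 2 := by
  have h : ⟪u, u⟫_ℂ = ((‖u‖ ^ 2 : ℝ) : ℂ) := by
    rw [inner_self_eq_norm_sq_to_K]
    norm_cast
  rw [L2.inner_def] at h
  apply Complex.ofReal_injective
  rw [← h, ← integral_complex_ofReal]
  refine integral_congr_ae (Eventually.of_forall fun ξ => ?_)
  simp only [inner_self_eq_norm_sq_to_K]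
  norm_cast

theorem affinePullback_coe_aux (hM : LinearMap.det M ≠ 0) (b : Eucl d) (u : L2Space d) :
    (((√|LinearMap.det M| : ℝ) : ℂ) • (memLp_comp_affineHomeo hM b u).toLp _ :
      L2Space d) =ᵐ[volume]
      fun x => ((√|LinearMap.det M| : ℝ) : ℂ) * u (affineHomeo hM b x) := by
  filter_upwards [Lp.coeFn_smul ((√|LinearMap.det M| : ℝ) : ℂ)
    ((memLp_comp_affineHomeo hM b u).toLp _),
    (memLp_comp_affineHomeo hM b u).coeFn_toLp] with x h1 h2
  rw [h1, Pi.smul_apply, h2]; rfl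

/-- The isometry `u ↦ |det M|^(1/2) u(M · + b)` of `L²`. -/
def affinePullback (hM : LinearMap.det M ≠ 0) (b : Eucl d) : L2Space d →ₗᵢ[ℂ] L2Space d where
  toFun u := ((√|LinearMap.det M| : ℝ) : ℂ) • (memLp_comp_affineHomeo hM b u).toLp _
  map_add' u v := by
    refine Lp.ext ?_
    filter_upwards [affinePullback_coe_aux hM b (u + v), affinePullback_coe_aux hM b u,
      affinePullback_coe_aux hM b v, Lp.coeFn_add
        (((√|LinearMap.det M| : ℝ) : ℂ) • (memLp_comp_affineHomeo hM b u).toLp _)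
        (((√|LinearMap.det M| : ℝ) : ℂ) • (memLp_comp_affineHomeo hM b v).toLp _),
      (quasiMeasurePreserving_affineHomeo hM b).ae_eq_comp (Lp.coeFn_add u v)]
      with x h1 h2 h3 h4 h5
    simp only [Function.comp_apply, Pi.add_apply] at h5
    rw [h1, h4, Pi.add_apply, h2, h3, h5, mul_add]
  map_smul' c u := by
    refine Lp.ext ?_
    filter_upwards [affinePullback_coe_aux hM b (c • u), affinePullback_coe_aux hM b u,
      Lp.coeFn_smul c
        (((√|LinearMap.det M| : ℝ) : ℂ) • (memLp_comp_affineHomeo hM b u).toLp _),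
      (quasiMeasurePreserving_affineHomeo hM b).ae_eq_comp (Lp.coeFn_smul c u)]
      with x h1 h2 h3 h4
    simp only [Function.comp_apply, Pi.smul_apply, smul_eq_mul] at h4
    rw [RingHom.id_apply, h1, h3, Pi.smul_apply, h2, h4, smul_eq_mul]
    ring
  norm_map' u := by
    change ‖((√|LinearMap.det M| : ℝ) : ℂ) • (memLp_comp_affineHomeo hM b u).toLp _‖ = ‖u‖
    refine (sq_eq_sq₀ (norm_nonneg _) (norm_nonneg _)).1 ?_
    have h1 : ∀ᵐ x, ‖(((√|LinearMap.det M| : ℝ) : ℂ) •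
        (memLp_comp_affineHomeo hM b u).toLp _ : L2Space d) x‖ ^ 2 =
        |LinearMap.det M| * ‖u (affineHomeo hM b x)‖ ^ 2 := by
      filter_upwards [affinePullback_coe_aux hM b u] with x hx
      rw [hx, norm_mul, mul_pow, Complex.norm_real, Real.norm_eq_abs, sq_abs,
        Real.sq_sqrt (abs_nonneg _)]
    rw [L2Space.norm_sq_eq_integral, L2Space.norm_sq_eq_integral, integral_congr_ae h1,
      integral_const_mul, integral_comp_affineHomeo hM b (fun y => ‖u y‖ ^ 2), smul_eq_mul,
      mul_inv_cancel_left₀ (abs_ne_zero.2 hM)]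

theorem affinePullback_coe (hM : LinearMap.det M ≠ 0) (b : Eucl d) (u : L2Space d) :
    (affinePullback hM b u : Eucl d → ℂ) =ᵐ[volume]
      fun x => ((√|LinearMap.det M| : ℝ) : ℂ) * u (affineHomeo hM b x) :=
  affinePullback_coe_aux hM b u

theorem affinePullback_representative (hM : LinearMap.det M ≠ 0) (b : Eucl d) {u : L2Space d}
    {φ : Eucl d → ℂ} (hu : (u : Eucl d → ℂ) =ᵐ[volume] φ) :
    (affinePullback hM b u : Eucl d → ℂ) =ᵐ[volume]
      fun x => ((√|LinearMap.det M| : ℝ) : ℂ) • φ (affineHomeo hM b x) := by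
  filter_upwards [affinePullback_coe hM b u,
    (quasiMeasurePreserving_affineHomeo hM b).ae_eq_comp hu] with x h1 h2
  simp only [Function.comp_apply] at h2
  rw [h1, h2, smul_eq_mul]

theorem contDiff_comp_affineHomeo (hM : LinearMap.det M ≠ 0) (b : Eucl d) {φ : Eucl d → ℂ}
    (c : ℂ) (hφ : ContDiff ℝ ∞ φ) : ContDiff ℝ ∞ fun x => c • φ (affineHomeo hM b x) := by
  have h : ContDiff ℝ ∞ (affineHomeo hM b) :=
    ((LinearMap.toContinuousLinearMap M).contDiff).add contDiff_const
  exact (hφ.comp h).const_smul c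

theorem hasCompactSupport_comp_affineHomeo (hM : LinearMap.det M ≠ 0) (b : Eucl d)
    {φ : Eucl d → ℂ} (c : ℂ) (hφ : HasCompactSupport φ) :
    HasCompactSupport fun x => c • φ (affineHomeo hM b x) :=
  (hφ.comp_isClosedEmbedding (affineHomeo hM b).isClosedEmbedding).smul_left (f := fun _ => c)

theorem affinePullback_mem_testFunctions (hM : LinearMap.det M ≠ 0) (b : Eucl d)
    {Ω₁ Ω₂ : Set (Eucl d)} (hΩ : (affineHomeo hM b) ⁻¹' Ω₂ ⊆ Ω₁) {u : L2Space d}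
    (hu : u ∈ testFunctions Ω₂) : affinePullback hM b u ∈ testFunctions Ω₁ := by
  obtain ⟨φ, h1, h2, h3, hφ⟩ := hu
  refine ⟨_, contDiff_comp_affineHomeo hM b _ h1,
    hasCompactSupport_comp_affineHomeo hM b _ h2, ?_, affinePullback_representative hM b hφ⟩
  refine (tsupport_smul_subset_right (fun _ => _) _).trans ?_
  refine subset_trans ?_ hΩ
  have := tsupport_comp_eq_preimage φ (affineHomeo hM b)
  rw [Function.comp_def] at this
  rw [this]
  exact preimage_mono h3

-- At the frequency Mᵀη the phase is ⟨x, Mᵀη⟩ = ⟨Mx + b, η⟩ - ⟨b, η⟩. The translation contributes a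
-- factor z of modulus one, and the substitution y = Mx + b contributes |det M|⁻¹, which the
-- normalising factor turns into |det M|^(-1/2) before squaring.
open Real in
theorem norm_fourier_comp_affine_sq (hM : LinearMap.det M ≠ 0) (b : Eucl d) (φ : Eucl d → ℂ)
    (η : Eucl d) :
    ‖𝓕 (fun x => ((√|LinearMap.det M| : ℝ) : ℂ) • φ (affineHomeo hM b x))
      (LinearMap.adjoint M η)‖ ^ 2 = |LinearMap.det M|⁻¹ * ‖𝓕 φ η‖ ^ 2 := by
  obtain ⟨z, hz1, hz⟩ : ∃ z : ℂ, ‖z‖ = 1 ∧ ∀ w : ℂ, Real.fourierChar ⟪b, η⟫_ℝ • w = z * w :=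
    ⟨_, Circle.norm_coe _, fun w => Circle.smul_def _ _⟩
  have h1 : 𝓕 (fun x => ((√|LinearMap.det M| : ℝ) : ℂ) • φ (affineHomeo hM b x))
      (LinearMap.adjoint M η) = ∫ x, (fun y => z *
        ((√|LinearMap.det M| : ℝ) : ℂ) * (Real.fourierChar (-⟪y, η⟫_ℝ) • φ y))
          (affineHomeo hM b x) := by
    rw [Real.fourier_eq]
    refine integral_congr_ae (Eventually.of_forall fun x => ?_)
    have h2 : -⟪x, LinearMap.adjoint M η⟫_ℝ =
        ⟪b, η⟫_ℝ + -⟪affineHomeo hM b x, η⟫_ℝ := by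
      rw [LinearMap.adjoint_inner_right, affineHomeo_apply, inner_add_left]; ring
    simp only
    rw [h2, AddChar.map_add_eq_mul, mul_smul, hz, mul_assoc, smul_comm, smul_eq_mul]
  rw [h1.trans (integral_comp_affineHomeo hM b fun y => z * ((√|LinearMap.det M| : ℝ) : ℂ) *
    (Real.fourierChar (-⟪y, η⟫_ℝ) • φ y)), integral_const_mul, ← Real.fourier_eq, norm_smul, norm_mul,
    norm_mul, hz1, Complex.norm_real, Real.norm_eq_abs, Real.norm_eq_abs, one_mul, mul_pow, mul_pow,
    sq_abs, sq_abs, Real.sq_sqrt (abs_nonneg _), ← mul_assoc]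
  congr 1
  have := abs_ne_zero.2 hM
  field_simp

/-- Substituting ξ = Mᵀη cancels the Jacobian: the pullback by M acts on multipliers by composition
with Mᵀ, and b has no effect. No measurability of h is needed, since the substitution is a
homeomorphism. -/
theorem lintegral_fourier_affinePullback (hM : LinearMap.det M ≠ 0) (b : Eucl d)
    {Ω : Set (Eucl d)} {u : L2Space d} (hu : u ∈ testFunctions Ω) (h : Eucl d → ℝ) :
    ∫⁻ ξ, ENNReal.ofReal (h ξ * ‖(𝓕 (affinePullback hM b u) : L2Space d) ξ‖ ^ 2) =
      ∫⁻ η, ENNReal.ofReal (h (LinearMap.adjoint M η) * ‖(𝓕 u : L2Space d) η‖ ^ 2) := by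
  obtain ⟨φ, h1, h2, -, hφ⟩ := hu
  have hM' : LinearMap.det (LinearMap.adjoint M) ≠ 0 := by rwa [LinearMap.det_adjoint_real]
  have hF1 := fourier_ae_eq_of_mem_testFunctions (contDiff_comp_affineHomeo hM b _ h1)
    (hasCompactSupport_comp_affineHomeo hM b _ h2) (affinePullback_representative hM b hφ)
  have hF2 := fourier_ae_eq_of_mem_testFunctions h1 h2 hφ
  have hL : ∫⁻ ξ, ENNReal.ofReal (h ξ * ‖(𝓕 (affinePullback hM b u) : L2Space d) ξ‖ ^ 2) =
      ∫⁻ ξ, ENNReal.ofReal (h ξ * ‖𝓕 (fun x => ((√|LinearMap.det M| : ℝ) : ℂ) •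
        φ (affineHomeo hM b x)) ξ‖ ^ 2) := by
    refine lintegral_congr_ae ?_
    filter_upwards [hF1] with ξ hξ
    rw [hξ]; rfl
  have hR : ∫⁻ η, ENNReal.ofReal (h (LinearMap.adjoint M η) * ‖(𝓕 u : L2Space d) η‖ ^ 2) =
      ∫⁻ η, ENNReal.ofReal (h (LinearMap.adjoint M η) * ‖𝓕 φ η‖ ^ 2) := by
    refine lintegral_congr_ae ?_
    filter_upwards [hF2] with ξ hξ
    rw [hξ]; rfl
  have hpos : 0 < |LinearMap.det M|⁻¹ := inv_pos.2 (abs_pos.2 hM)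
  have hc := lintegral_comp_affineHomeo hM' 0 (fun ξ => ENNReal.ofReal
    (h ξ * ‖𝓕 (fun x => ((√|LinearMap.det M| : ℝ) : ℂ) • φ (affineHomeo hM b x)) ξ‖ ^ 2))
  simp only [affineHomeo_apply, add_zero] at hc
  rw [LinearMap.det_adjoint_real] at hc
  have hc' : ∀ η, ENNReal.ofReal (h (LinearMap.adjoint M η) *
      ‖𝓕 (fun x => ((√|LinearMap.det M| : ℝ) : ℂ) • φ (M x + b)) (LinearMap.adjoint M η)‖ ^ 2) =
      ENNReal.ofReal |LinearMap.det M|⁻¹ *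
        ENNReal.ofReal (h (LinearMap.adjoint M η) * ‖𝓕 φ η‖ ^ 2) := by
    intro η
    have := norm_fourier_comp_affine_sq hM b φ η
    simp only [affineHomeo_apply] at this
    rw [this, ← ENNReal.ofReal_mul hpos.le]
    congr 1; ring
  simp_rw [hc'] at hc
  rw [lintegral_const_mul' _ _ ENNReal.ofReal_ne_top,
    ENNReal.mul_right_inj (ENNReal.ofReal_pos.2 hpos).ne' ENNReal.ofReal_ne_top] at hc
  rw [hL, hR, hc]
  rfl

/-- The signed counterpart, needed because multipliers may take negative values. -/
theorem integral_fourier_affinePullback (hM : LinearMap.det M ≠ 0) (b : Eucl d)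
    {Ω : Set (Eucl d)} {u : L2Space d} (hu : u ∈ testFunctions Ω) (h : Eucl d → ℝ) :
    ∫ ξ, h ξ * ‖(𝓕 (affinePullback hM b u) : L2Space d) ξ‖ ^ 2 =
      ∫ η, h (LinearMap.adjoint M η) * ‖(𝓕 u : L2Space d) η‖ ^ 2 := by
  obtain ⟨φ, h1, h2, -, hφ⟩ := hu
  have hM' : LinearMap.det (LinearMap.adjoint M) ≠ 0 := by rwa [LinearMap.det_adjoint_real]
  have hF1 := fourier_ae_eq_of_mem_testFunctions (contDiff_comp_affineHomeo hM b _ h1)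
    (hasCompactSupport_comp_affineHomeo hM b _ h2) (affinePullback_representative hM b hφ)
  have hF2 := fourier_ae_eq_of_mem_testFunctions h1 h2 hφ
  have hL : ∫ ξ, h ξ * ‖(𝓕 (affinePullback hM b u) : L2Space d) ξ‖ ^ 2 =
      ∫ ξ, h ξ * ‖𝓕 (fun x => ((√|LinearMap.det M| : ℝ) : ℂ) •
        φ (affineHomeo hM b x)) ξ‖ ^ 2 := by
    refine integral_congr_ae ?_
    filter_upwards [hF1] with ξ hξ
    rw [hξ]; rfl
  have hR : ∫ η, h (LinearMap.adjoint M η) * ‖(𝓕 u : L2Space d) η‖ ^ 2 =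
      ∫ η, h (LinearMap.adjoint M η) * ‖𝓕 φ η‖ ^ 2 := by
    refine integral_congr_ae ?_
    filter_upwards [hF2] with ξ hξ
    rw [hξ]; rfl
  have hpos : 0 < |LinearMap.det M|⁻¹ := inv_pos.2 (abs_pos.2 hM)
  have hc := integral_comp_affineHomeo hM' 0 (fun ξ =>
    (h ξ * ‖𝓕 (fun x => ((√|LinearMap.det M| : ℝ) : ℂ) • φ (affineHomeo hM b x)) ξ‖ ^ 2))
  simp only [affineHomeo_apply, add_zero] at hc
  rw [LinearMap.det_adjoint_real] at hc
  have hc' : ∀ η, h (LinearMap.adjoint M η) *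
      ‖𝓕 (fun x => ((√|LinearMap.det M| : ℝ) : ℂ) • φ (M x + b)) (LinearMap.adjoint M η)‖ ^ 2 =
      |LinearMap.det M|⁻¹ * (h (LinearMap.adjoint M η) * ‖𝓕 φ η‖ ^ 2) := by
    intro η
    have := norm_fourier_comp_affine_sq hM b φ η
    simp only [affineHomeo_apply] at this
    rw [this]
    ring
  simp_rw [hc'] at hc
  rw [integral_const_mul, smul_eq_mul, mul_right_inj' hpos.ne'] at hc
  rw [hL, hR, hc]
  rfl

end AffinePullback

/-! ### Comparing eigenvalue sums by transplanting test functions -/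

section Comparison

variable {d : ℕ}

/-- Completeness in L²(Ω) gives Parseval's identity for ψ, which is all that `sum_le_quad` requires.
The bound therefore holds for every eigenvalue sequence, not only for the one obtained by
minimisation. -/
theorem IsEigenvalueSequence.exists_lower_bound (hd : 0 < d) {g : ℝ → ℝ} (hg : IsSymbol d g)
    {Ω : Set (Eucl d)} {a : ℕ → ℝ} (ha : IsEigenvalueSequence g Ω a) :
    ∃ u : ℕ → L2Space d, Orthonormal ℂ u ∧ ∀ ψ ∈ testFunctions Ω, ∀ n,
      ∑ k ∈ Finset.range n, (a k - a n) * ‖⟪u k, ψ⟫_ℂ‖ ^ 2 ≤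
        (∫ ξ : Eucl d, g (‖ξ‖ ^ 2) * ‖(𝓕 ψ : L2Space d) ξ‖ ^ 2) - a n * ‖ψ‖ ^ 2 := by
  obtain ⟨hmono, -, u, hu, heig, hcompl⟩ := ha
  obtain ⟨C, hC0, hC⟩ := hg.bddBelow
  refine ⟨u, hu, fun ψ hψ n => ?_⟩
  let u' : ℕ → formSubmodule hg Ω := fun k => ⟨u k, (heig k).1⟩
  let ψ' : formSubmodule hg Ω := ⟨ψ, testFunctions_subset_formDomain g Ω hψ⟩
  have hlow : ∀ v, 0 ≤ (symbolForm hd hg Ω).quad v + C * ‖v‖ ^ 2 := by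
    intro v
    have := neg_mul_norm_sq_le_integral hd hg.aemeasurable hC
      (energy_lt_top_of_mem_formDomain hd hg v.2)
    rw [symbolForm_quad]
    have h : ‖v‖ = ‖(v : L2Space d)‖ := rfl
    rw [h]
    linarith
  have h := (symbolForm_isHerm hd hg).sum_le_quad hlow (u := u') hu hmono
    (fun k v => (heig k).2 v v.2) (ψ := ψ')
    (hu.tendsto_sum_norm_inner_sq (isClosed_supportedSubmodule Ω)
      (fun k => formDomain_subset_supported (heig k).1) hcompl
      (testFunctions_subset_supported hψ)) n
  rw [symbolForm_quad] at h
  exact h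

/-- Expand Q(φ) around v. By the weak equation the cross term is l⟨φ - v, v⟩, controlled by L²
distance, and the quadratic remainder is at most the energy of v - φ. -/
theorem IsWeakEigenfunction.exists_approximation (hd : 0 < d) {g : ℝ → ℝ} (hg : IsSymbol d g)
    {Ω : Set (Eucl d)} {l : ℝ} {v : L2Space d} (hv : IsWeakEigenfunction g Ω l v) :
    ∃ (φ : ℕ → L2Space d) (e : ℕ → ℝ), (∀ m, φ m ∈ testFunctions Ω) ∧ Tendsto φ atTop (𝓝 v) ∧
      Tendsto e atTop (𝓝 (l * ‖v‖ ^ 2)) ∧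
      ∀ m, ∫ ξ : Eucl d, g (‖ξ‖ ^ 2) * ‖(𝓕 (φ m) : L2Space d) ξ‖ ^ 2 ≤ e m := by
  obtain ⟨φ, hφ, hen, hlim⟩ := exists_seq_testFunctions hv.1
  let v' : formSubmodule hg Ω := ⟨v, hv.1⟩
  let φ' : ℕ → formSubmodule hg Ω := fun m => ⟨φ m, testFunctions_subset_formDomain g Ω (hφ m)⟩
  have hvv : (symbolForm hd hg Ω).quad v' = l * ‖v‖ ^ 2 := by
    have h1 : symbolForm hd hg Ω v' v' = (l : ℂ) * ⟪v, v⟫_ℂ := hv.2 v hv.1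
    have h2 : ⟪v, v⟫_ℂ = ((‖v‖ ^ 2 : ℝ) : ℂ) := by
      rw [inner_self_eq_norm_sq_to_K]; norm_cast
    rw [SesqForm.quad, h1, h2, ← Complex.ofReal_mul, Complex.ofReal_re]
  refine ⟨φ, fun m => l * ‖v‖ ^ 2 + (energy g (v - φ m)).toReal +
    2 * ((l : ℂ) * ⟪φ m - v, v⟫_ℂ).re, hφ, hlim, ?_, fun m => ?_⟩
  · have h1 : Tendsto (fun m => ((l : ℂ) * ⟪φ m - v, v⟫_ℂ).re) atTop (𝓝 0) := by
      have h2 : Tendsto (fun m => (l : ℂ) * ⟪φ m - v, v⟫_ℂ) atTop (𝓝 ((l : ℂ) * ⟪v - v, v⟫_ℂ)) :=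
        ((hlim.sub_const v).inner tendsto_const_nhds).const_mul _
      rw [sub_self, inner_zero_left, mul_zero] at h2
      have h3 := (Complex.continuous_re.tendsto _).comp h2
      rwa [Complex.zero_re] at h3
    have h3 := (ENNReal.tendsto_toReal ENNReal.zero_ne_top).comp hen
    have h4 := (h3.const_add (l * ‖v‖ ^ 2)).add (h1.const_mul 2)
    simpa using h4
  · have h1 : φ' m = (φ' m - v') + v' := by simp
    have h2 : (symbolForm hd hg Ω).quad (φ' m) = (symbolForm hd hg Ω).quad (φ' m - v') +
        (symbolForm hd hg Ω).quad v' + 2 * (symbolForm hd hg Ω (φ' m - v') v').re := by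
      conv_lhs => rw [h1]
      exact (symbolForm_isHerm hd hg).quad_add _ _
    have h3 : symbolForm hd hg Ω (φ' m - v') v' = (l : ℂ) * ⟪φ m - v, v⟫_ℂ :=
      hv.2 _ (φ' m - v').2
    have hfin : energy g (v - φ m) < ⊤ := energy_lt_top_of_mem_formDomain hd hg (v' - φ' m).2
    have h4 : (symbolForm hd hg Ω).quad (φ' m - v') ≤ (energy g (v - φ m)).toReal := by
      have h5 := ofReal_integral_le_energy hg.aemeasurable
        (energy_lt_top_of_mem_formDomain hd hg (φ' m - v').2)
      rw [← symbolForm_quad hd hg (φ' m - v')] at h5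
      have h6 : energy g ((φ' m - v' : formSubmodule hg Ω) : L2Space d) = energy g (v - φ m) := by
        rw [← energy_neg]
        congr 1
        exact neg_sub _ _
      rw [h6] at h5
      exact (ENNReal.ofReal_le_iff_le_toReal hfin.ne).1 h5
    have h7 := symbolForm_quad hd hg (φ' m)
    rw [h3, hvv] at h2
    change (symbolForm hd hg Ω).quad (φ' m) =
      ∫ ξ : Eucl d, g (‖ξ‖ ^ 2) * ‖(𝓕 (φ m) : L2Space d) ξ‖ ^ 2 at h7
    linarith

/-- Up to a change of variable this is the multiplier g acting on a pulled-back test function, whose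
energy is finite. -/
theorem integrable_comp_adjoint (hd : 0 < d) {g : ℝ → ℝ} (hg : IsSymbol d g)
    {M : Eucl d →ₗ[ℝ] Eucl d} (hM : LinearMap.det M ≠ 0) {Ω : Set (Eucl d)} {u : L2Space d}
    (hu : u ∈ testFunctions Ω) :
    Integrable (fun η : Eucl d => g (‖LinearMap.adjoint M η‖ ^ 2) *
      ‖(𝓕 u : L2Space d) η‖ ^ 2) volume := by
  have hM' : LinearMap.det (LinearMap.adjoint M) ≠ 0 := by rwa [LinearMap.det_adjoint_real]
  have hm : AEMeasurable (fun η : Eucl d => g (‖LinearMap.adjoint M η‖ ^ 2)) volume := by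
    have := hg.aemeasurable.comp_quasiMeasurePreserving
      (quasiMeasurePreserving_affineHomeo hM' 0)
    refine this.congr (Eventually.of_forall fun η => ?_)
    simp [affineHomeo_apply]
  have hfin : energy g (affinePullback hM 0 u) < ⊤ :=
    energy_lt_top_of_mem_testFunctions (Ω := affineHomeo hM 0 ⁻¹' Ω) hd hg.polynomiallyBounded
      (affinePullback_mem_testFunctions hM 0 subset_rfl hu)
  rw [energy, lintegral_fourier_affinePullback hM 0 hu fun ξ => 1 + |g (‖ξ‖ ^ 2)|] at hfin
  refine ⟨(hm.mul ((aemeasurable_fourier u).norm.pow_const 2)).aestronglyMeasurable,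
    lt_of_le_of_lt (lintegral_mono fun ξ => ?_) hfin⟩
  rw [← ofReal_norm]
  refine ENNReal.ofReal_le_ofReal ?_
  rw [norm_mul, Real.norm_eq_abs, norm_pow, norm_norm]
  gcongr
  linarith [abs_nonneg (g (‖LinearMap.adjoint M ξ‖ ^ 2))]

/-- Comparison of eigenvalue sums: pulling back test functions by finitely many affine maps and
averaging. -/
theorem sum_eigenvalues_le_of_average (hd : 0 < d) {f₁ f₂ : ℝ → ℝ} (hf₁ : IsSymbol d f₁)
    (hf₂ : IsSymbol d f₂) {Ω₁ Ω₂ : Set (Eucl d)} {ι : Type*} [Fintype ι] {w : ι → ℝ}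
    (hw0 : ∀ k, 0 ≤ w k) (hw1 : ∑ k, w k = 1) {M : ι → Eucl d →ₗ[ℝ] Eucl d}
    (hM : ∀ k, LinearMap.det (M k) ≠ 0) (c : ι → Eucl d)
    (hΩ : ∀ k, affineHomeo (hM k) (c k) ⁻¹' Ω₂ ⊆ Ω₁)
    (hle : ∀ ξ : Eucl d, 0 < ‖ξ‖ ^ 2 →
      ∑ k, w k * f₁ (‖LinearMap.adjoint (M k) ξ‖ ^ 2) ≤ f₂ (‖ξ‖ ^ 2))
    {a b : ℕ → ℝ} (ha : IsEigenvalueSequence f₁ Ω₁ a) (hb : IsEigenvalueSequence f₂ Ω₂ b)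
    (n : ℕ) : ∑ k ∈ Finset.range n, a k ≤ ∑ k ∈ Finset.range n, b k := by
  have hmono := ha.1
  obtain ⟨u, hu, hlow⟩ := ha.exists_lower_bound hd hf₁
  obtain ⟨-, -, v, hv, hveig, -⟩ := hb
  choose φ e hφ hφv he hQ using fun j => (hveig j).exists_approximation hd hf₂
  let U : ι → L2Space d →ₗᵢ[ℂ] L2Space d := fun k => affinePullback (hM k) (c k)
  have hUtest : ∀ k j m, U k (φ j m) ∈ testFunctions Ω₁ := fun k j m =>
    affinePullback_mem_testFunctions (hM k) (c k) (hΩ k) (hφ j m)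
  -- Each transplant composes the symbol with the adjoint of M k; the averaged symbol is at most f₂
  -- pointwise, by hypothesis.
  have hav : ∀ j m, ∑ k, w k * ∫ ξ : Eucl d, f₁ (‖ξ‖ ^ 2) *
      ‖(𝓕 (U k (φ j m)) : L2Space d) ξ‖ ^ 2 ≤ e j m := by
    intro j m
    refine le_trans ?_ (hQ j m)
    have h1 : ∀ k, Integrable (fun η : Eucl d => w k * (f₁ (‖LinearMap.adjoint (M k) η‖ ^ 2) *
        ‖(𝓕 (φ j m) : L2Space d) η‖ ^ 2)) volume := fun k =>
      (integrable_comp_adjoint hd hf₁ (hM k) (hφ j m)).const_mul _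
    have h2 : ∀ k, w k * ∫ ξ : Eucl d, f₁ (‖ξ‖ ^ 2) * ‖(𝓕 (U k (φ j m)) : L2Space d) ξ‖ ^ 2 =
        ∫ η : Eucl d, w k * (f₁ (‖LinearMap.adjoint (M k) η‖ ^ 2) *
          ‖(𝓕 (φ j m) : L2Space d) η‖ ^ 2) := fun k => by
      rw [integral_const_mul, integral_fourier_affinePullback (hM k) (c k) (hφ j m)
        fun ξ => f₁ (‖ξ‖ ^ 2)]
    simp_rw [h2]
    rw [← integral_finsetSum _ fun k _ => h1 k]
    refine integral_mono_ae (integrable_finsetSum _ fun k _ => h1 k)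
      (integrable_of_energy_lt_top hf₂.aemeasurable
        (energy_lt_top_of_mem_testFunctions hd hf₂.polynomiallyBounded (hφ j m))) ?_
    filter_upwards [ae_norm_sq_pos hd] with ξ hξ
    simp_rw [← mul_assoc]
    rw [← Finset.sum_mul]
    gcongr
    exact hle ξ hξ
  -- The averaged squared overlap of u l with the n transplanted approximants. Only such inner
  -- products pass to the limit m → ∞, so the transplanted eigenfunctions need not lie in the form
  -- domain of f₁.
  let P : ℕ → ℕ → ℝ := fun l m =>
    ∑ k, w k * ∑ j ∈ Finset.range n, ‖⟪u l, U k (φ j m)⟫_ℂ‖ ^ 2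
  have hmain : ∀ m, ∑ l ∈ Finset.range n, (a l - a n) * P l m ≤
      ∑ j ∈ Finset.range n, (e j m - a n * ‖φ j m‖ ^ 2) := by
    intro m
    have h1 : ∀ j ∈ Finset.range n, ∑ k, w k * ∑ l ∈ Finset.range n,
        (a l - a n) * ‖⟪u l, U k (φ j m)⟫_ℂ‖ ^ 2 ≤ e j m - a n * ‖φ j m‖ ^ 2 := by
      intro j _
      calc ∑ k, w k * ∑ l ∈ Finset.range n, (a l - a n) * ‖⟪u l, U k (φ j m)⟫_ℂ‖ ^ 2
          ≤ ∑ k, w k * ((∫ ξ : Eucl d, f₁ (‖ξ‖ ^ 2) *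
            ‖(𝓕 (U k (φ j m)) : L2Space d) ξ‖ ^ 2) - a n * ‖φ j m‖ ^ 2) := by
            refine Finset.sum_le_sum fun k _ => mul_le_mul_of_nonneg_left ?_ (hw0 k)
            have := hlow _ (hUtest k j m) n
            rwa [(U k).norm_map] at this
        _ = (∑ k, w k * ∫ ξ : Eucl d, f₁ (‖ξ‖ ^ 2) *
            ‖(𝓕 (U k (φ j m)) : L2Space d) ξ‖ ^ 2) - a n * ‖φ j m‖ ^ 2 := by
            simp_rw [mul_sub]
            rw [Finset.sum_sub_distrib, ← Finset.sum_mul, hw1, one_mul]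
        _ ≤ _ := by linarith [hav j m]
    refine le_trans (le_of_eq ?_) (Finset.sum_le_sum h1)
    simp only [P, Finset.mul_sum]
    rw [Finset.sum_comm' (s := Finset.range n) (t := fun _ => Finset.univ)
      (t' := Finset.univ) (s' := fun _ => Finset.range n) (by simp)]
    rw [Finset.sum_comm' (s := Finset.range n) (t := fun _ => Finset.univ)
      (t' := Finset.univ) (s' := fun _ => Finset.range n) (by simp)]
    refine Finset.sum_congr rfl fun k _ => ?_
    rw [Finset.sum_comm]
    refine Finset.sum_congr rfl fun j _ => Finset.sum_congr rfl fun l _ => ?_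
    ring
  let P' : ℕ → ℝ := fun l => ∑ k, w k * ∑ j ∈ Finset.range n, ‖⟪u l, U k (v j)⟫_ℂ‖ ^ 2
  have hP : ∀ l, Tendsto (P l) atTop (𝓝 (P' l)) := by
    intro l
    refine tendsto_finsetSum _ fun k _ => Tendsto.const_mul _ (tendsto_finsetSum _ fun j _ => ?_)
    exact (((tendsto_const_nhds.inner (((U k).continuous.tendsto _).comp (hφv j))).norm).pow 2)
  -- Bessel's inequality for the orthonormal family U k (v j) and the unit vector u l, averaged over
  -- k.
  have hP1 : ∀ l, P' l ≤ 1 := by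
    intro l
    rw [← hw1]
    refine Finset.sum_le_sum fun k _ => mul_le_of_le_one_right (hw0 k) ?_
    have h1 : Orthonormal ℂ fun j => U k (v j) := hv.comp_linearIsometry (U k)
    have h2 := h1.sum_inner_products_le (u l) (s := Finset.range n)
    rw [hu.1, one_pow] at h2
    refine le_trans (le_of_eq (Finset.sum_congr rfl fun j _ => ?_)) h2
    rw [norm_inner_symm]
  have hL : Tendsto (fun m => ∑ l ∈ Finset.range n, (a l - a n) * P l m) atTop
      (𝓝 (∑ l ∈ Finset.range n, (a l - a n) * P' l)) :=
    tendsto_finsetSum _ fun l _ => (hP l).const_mul _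
  have hR : Tendsto (fun m => ∑ j ∈ Finset.range n, (e j m - a n * ‖φ j m‖ ^ 2)) atTop
      (𝓝 (∑ j ∈ Finset.range n, (b j - a n))) := by
    refine tendsto_finsetSum _ fun j _ => ?_
    have h1 := (he j).sub ((((hφv j).norm).pow 2).const_mul (a n))
    rwa [hv.1, one_pow, mul_one, mul_one] at h1
  have hfin := le_of_tendsto_of_tendsto' hL hR hmain
  -- The coefficients a l - a n are nonpositive for l < n, so replacing P' l ≤ 1 by 1 lowers the
  -- sum.
  have h1 : ∑ l ∈ Finset.range n, (a l - a n) ≤ ∑ l ∈ Finset.range n, (a l - a n) * P' l := by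
    refine Finset.sum_le_sum fun l hl => ?_
    have h2 : a l ≤ a n := hmono (Finset.mem_range.1 hl).le
    nlinarith [hP1 l]
  have h3 := h1.trans hfin
  rw [Finset.sum_sub_distrib, Finset.sum_sub_distrib] at h3
  linarith

end Comparison

/-! ### Compactness from ellipticity -/

section Compactness

variable {d : ℕ}

/-- Compactness of the Sobolev embedding on `Ω` gives compactness for elliptic multipliers on
affine preimages of `Ω`. -/
theorem hasCompactTestFunctions_of_elliptic (hd : 0 < d) {β : ℝ} (hβ : 0 < β) {Ω : Set (Eucl d)}
    (hcomp : SobolevCompactEmbedding β Ω) {g : ℝ → ℝ} (hg : EllipticOfOrder β g)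
    {D : Set (Eucl d)} {M : Eucl d →ₗ[ℝ] Eucl d} (hM : LinearMap.det M ≠ 0) (b : Eucl d)
    (hD : affineHomeo hM b ⁻¹' D ⊆ Ω) : HasCompactTestFunctions g D := by
  obtain ⟨c, C, hc, hell⟩ := hg
  let N : Eucl d →L[ℝ] Eucl d := LinearMap.toContinuousLinearMap (LinearMap.adjoint M)
  set A : ℝ := (‖N‖ ^ 2) ^ β with hA
  have hA0 : 0 ≤ A := by positivity
  -- Ellipticity gives t^β ≤ (1 + |C|)(1 + |g t|)/c, while composing with the adjoint of M costs the
  -- factor A = ‖M‖^(2β).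
  set K : ℝ := 1 + A * (1 + |C|) / c with hKdef
  have hK0 : 0 ≤ K := by positivity
  have hK : ∀ ξ : Eucl d, 0 < ‖ξ‖ ^ 2 →
      1 + |(‖LinearMap.adjoint M ξ‖ ^ 2) ^ β| ≤ K * (1 + |g (‖ξ‖ ^ 2)|) := by
    intro ξ hξ
    have h1 : ‖LinearMap.adjoint M ξ‖ ^ 2 ≤ ‖N‖ ^ 2 * ‖ξ‖ ^ 2 := by
      rw [← mul_pow]
      exact pow_le_pow_left₀ (norm_nonneg _) (N.le_opNorm ξ) 2
    have h2 : (‖LinearMap.adjoint M ξ‖ ^ 2) ^ β ≤ A * (‖ξ‖ ^ 2) ^ β := by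
      rw [hA, ← Real.mul_rpow (by positivity) (by positivity)]
      exact Real.rpow_le_rpow (by positivity) h1 hβ.le
    have h3 : (‖ξ‖ ^ 2) ^ β ≤ (1 + |C|) * (1 + |g (‖ξ‖ ^ 2)|) / c := by
      rw [le_div_iff₀ hc]
      have := hell _ hξ
      nlinarith [abs_nonneg C, abs_nonneg (g (‖ξ‖ ^ 2)), le_abs_self C,
        le_abs_self (g (‖ξ‖ ^ 2)), mul_nonneg (abs_nonneg C) (abs_nonneg (g (‖ξ‖ ^ 2)))]
    rw [abs_of_nonneg (by positivity)]
    have h4 := mul_le_mul_of_nonneg_left h3 hA0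
    have h5 : K * (1 + |g (‖ξ‖ ^ 2)|) = 1 + |g (‖ξ‖ ^ 2)| +
        A * ((1 + |C|) * (1 + |g (‖ξ‖ ^ 2)|) / c) := by
      rw [hKdef]; ring
    rw [h5]
    linarith [abs_nonneg (g (‖ξ‖ ^ 2))]
  intro φ R hφ hR
  set U := affinePullback hM b with hU
  -- An energy bound that is positive whatever the sign of R; multiplication by S^(-1/2) brings the
  -- pullbacks into the Sobolev unit ball.
  set S : ℝ := K * |R| + 1 with hS
  have hSpos : 0 < S := by positivity
  have hUtest : ∀ m, U (φ m) ∈ testFunctions Ω := fun m =>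
    affinePullback_mem_testFunctions hM b hD (hφ m)
  have hen : ∀ m, energy (fun t : ℝ => t ^ β) (U (φ m)) ≤ ENNReal.ofReal S := by
    intro m
    rw [energy, hU, lintegral_fourier_affinePullback hM b (hφ m)
      fun ξ => 1 + |(fun t : ℝ => t ^ β) (‖ξ‖ ^ 2)|]
    have h1 : ∫⁻ η : Eucl d, ENNReal.ofReal ((1 + |(fun t : ℝ => t ^ β)
        (‖LinearMap.adjoint M η‖ ^ 2)|) * ‖(𝓕 (φ m) : L2Space d) η‖ ^ 2) ≤
        ENNReal.ofReal K * energy g (φ m) := by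
      rw [energy, ← lintegral_const_mul' _ _ ENNReal.ofReal_ne_top]
      refine lintegral_mono_ae ?_
      filter_upwards [ae_norm_sq_pos hd] with ξ hξ
      rw [← ENNReal.ofReal_mul hK0, ← mul_assoc]
      refine ENNReal.ofReal_le_ofReal ?_
      gcongr
      exact hK ξ hξ
    refine h1.trans ?_
    calc ENNReal.ofReal K * energy g (φ m) ≤ ENNReal.ofReal K * ENNReal.ofReal R := by
          gcongr; exact hR m
      _ = ENNReal.ofReal (K * R) := (ENNReal.ofReal_mul hK0).symm
      _ ≤ ENNReal.ofReal S := by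
          refine ENNReal.ofReal_le_ofReal ?_
          have := mul_le_mul_of_nonneg_left (le_abs_self R) hK0
          linarith
  have hmem : ∀ m, (((√S)⁻¹ : ℝ) : ℂ) • U (φ m) ∈ closure {u : L2Space d | u ∈ sobolevZero β Ω ∧
      energy (fun t : ℝ => t ^ β) u ≤ 1} := by
    intro m
    refine subset_closure ⟨testFunctions_subset_formDomain _ _
      ((testSubmodule Ω).smul_mem _ (hUtest m)), ?_⟩
    rw [energy_smul, Complex.norm_real, norm_inv, Real.norm_eq_abs, inv_pow, sq_abs,
      Real.sq_sqrt hSpos.le]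
    calc ENNReal.ofReal S⁻¹ * energy (fun t : ℝ => t ^ β) (U (φ m))
        ≤ ENNReal.ofReal S⁻¹ * ENNReal.ofReal S := by gcongr; exact hen m
      _ = 1 := by
        rw [← ENNReal.ofReal_mul (by positivity), inv_mul_cancel₀ hSpos.ne', ENNReal.ofReal_one]
  obtain ⟨w, -, σ, hσ, hlim⟩ := hcomp.tendsto_subseq hmem
  have hlim' : Tendsto (fun m => U (φ (σ m))) atTop (𝓝 (((√S : ℝ) : ℂ) • w)) := by
    refine (hlim.const_smul ((√S : ℝ) : ℂ)).congr fun m => ?_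
    have : √S ≠ 0 := (Real.sqrt_pos.2 hSpos).ne'
    simp only [Function.comp_apply]
    rw [smul_smul, ← Complex.ofReal_mul, mul_inv_cancel₀ this, Complex.ofReal_one, one_smul]
  -- The pullback is an isometry with closed range, so convergence of the images gives convergence
  -- of the φ themselves.
  have hcl := U.isometry.isClosedEmbedding
  obtain ⟨z, hz⟩ := hcl.isClosed_range.mem_of_tendsto hlim'
    (Eventually.of_forall fun m => ⟨_, rfl⟩)
  refine ⟨z, σ, hσ, ?_⟩
  rw [hcl.isInducing.tendsto_nhds_iff]
  rw [← hz] at hlim'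
  exact hlim'

end Compactness

/-! ### The transformed multiplier through the eigenvalues of T⁻¹T⁻ᵀ -/

section TransformedMultiplier

variable {d : ℕ}

theorem isHermitian_mul_transpose_self (S : Matrix (Fin d) (Fin d) ℝ) :
    (S * S.transpose).IsHermitian := by
  simpa using isHermitian_smul_mul_transpose 1 S

/-- The scaling is absorbed into the function, so a single spectral decomposition of A serves every
t. -/
theorem trace_cfc_smul {A : Matrix (Fin d) (Fin d) ℝ} (hA : A.IsHermitian) (t : ℝ)
    (htA : (t • A).IsHermitian) (Φ : ℝ → ℝ) :
    Matrix.trace (htA.cfc Φ) = ∑ i, Φ (t * hA.eigenvalues i) := by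
  have h : cfc Φ (t • A) = cfc (fun x => Φ (t * x)) A :=
    (cfc_comp_const_mul t Φ A ((A.finite_real_spectrum.image _).continuousOn _) hA).symm
  rw [← Matrix.IsHermitian.cfc_eq, h, Matrix.IsHermitian.cfc_eq hA,
    Matrix.IsHermitian.cfc, Unitary.conjStarAlgAut_apply, Matrix.trace_mul_comm, ← mul_assoc]
  simp [Matrix.trace_diagonal]

/-- The eigenvalues of `T⁻¹ T⁻ᵀ`. -/
def stretchEigenvalues (T : Matrix (Fin d) (Fin d) ℝ) : Fin d → ℝ :=
  (isHermitian_mul_transpose_self T⁻¹).eigenvalues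

/-- This exhibits F as the mean of Φ₁ minus Φ₂ at the mean, over the points tμᵢ with equal weights
1/d, which is the shape that Jensen's inequality produces. -/
theorem transformedMultiplier_eq (Φ₁ Φ₂ : ℝ → ℝ) (T : Matrix (Fin d) (Fin d) ℝ) (t : ℝ) :
    transformedMultiplier Φ₁ Φ₂ T t = (∑ i, (1 / (d : ℝ)) * Φ₁ (t * stretchEigenvalues T i)) -
      Φ₂ (∑ i, (1 / (d : ℝ)) * (t * stretchEigenvalues T i)) := by
  rw [transformedMultiplier, trace_cfc_smul (isHermitian_mul_transpose_self T⁻¹) t,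
    (isHermitian_mul_transpose_self T⁻¹).trace_eq_sum_eigenvalues, Finset.mul_sum, Finset.mul_sum]
  congr 2
  refine Finset.sum_congr rfl fun i _ => ?_
  simp only [stretchEigenvalues, RCLike.ofReal_real_eq_id, id]
  ring

/-- |Sᵀη|² = ⟨SSᵀη, η⟩, expanded in an eigenbasis of SSᵀ. With S = T⁻¹ it expresses the stretching
of frequencies through the μᵢ. -/
theorem norm_adjoint_toEuclideanLin_sq (S : Matrix (Fin d) (Fin d) ℝ) (η : Eucl d) :
    ‖LinearMap.adjoint (Matrix.toEuclideanLin S) η‖ ^ 2 =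
      ∑ i, (isHermitian_mul_transpose_self S).eigenvalues i *
        ⟪(isHermitian_mul_transpose_self S).eigenvectorBasis i, η⟫_ℝ ^ 2 := by
  set hA := isHermitian_mul_transpose_self S
  have h1 : ∀ x, Matrix.toEuclideanLin (S * S.transpose) x =
      Matrix.toEuclideanLin S (LinearMap.adjoint (Matrix.toEuclideanLin S) x) := by
    intro x
    rw [← Matrix.toEuclideanLin_conjTranspose_eq_adjoint,
      Matrix.conjTranspose_eq_transpose_of_trivial]
    simp [Matrix.toLpLin_apply, Matrix.mulVec_mulVec]
  have h2 : ∀ i, Matrix.toEuclideanLin (S * S.transpose) (hA.eigenvectorBasis i) =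
      hA.eigenvalues i • hA.eigenvectorBasis i := by
    intro i
    rw [Matrix.toLpLin_apply, hA.mulVec_eigenvectorBasis]
    rfl
  have h3 : ∀ x y, ⟪Matrix.toEuclideanLin (S * S.transpose) x, y⟫_ℝ =
      ⟪LinearMap.adjoint (Matrix.toEuclideanLin S) x,
        LinearMap.adjoint (Matrix.toEuclideanLin S) y⟫_ℝ := fun x y => by
    rw [h1, LinearMap.adjoint_inner_right]
  rw [← real_inner_self_eq_norm_sq, ← h3, ← hA.eigenvectorBasis.sum_inner_mul_inner]
  refine Finset.sum_congr rfl fun i _ => ?_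
  rw [h3, real_inner_comm, ← h3, h2, real_inner_smul_left]
  ring

theorem stretchEigenvalues_pos {T : Matrix (Fin d) (Fin d) ℝ} (hT : IsUnit T.det) (i : Fin d) :
    0 < stretchEigenvalues T i := by
  set hA := isHermitian_mul_transpose_self T⁻¹
  have h0 : LinearMap.adjoint (Matrix.toEuclideanLin T⁻¹) (hA.eigenvectorBasis i) ≠ 0 := by
    intro h
    have h1 : LinearMap.adjoint (Matrix.toEuclideanLin T)
        (LinearMap.adjoint (Matrix.toEuclideanLin T⁻¹) (hA.eigenvectorBasis i)) =
        hA.eigenvectorBasis i := by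
      rw [← LinearMap.comp_apply, ← LinearMap.adjoint_comp]
      have : Matrix.toEuclideanLin T⁻¹ ∘ₗ Matrix.toEuclideanLin T = LinearMap.id := by
        refine LinearMap.ext fun x => ?_
        simp [Matrix.toLpLin_apply, Matrix.mulVec_mulVec, Matrix.nonsing_inv_mul _ hT]
      rw [this, LinearMap.adjoint_id, LinearMap.id_apply]
    rw [h, map_zero] at h1
    exact hA.eigenvectorBasis.orthonormal.ne_zero i h1.symm
  have h2 := norm_adjoint_toEuclideanLin_sq T⁻¹ (hA.eigenvectorBasis i)
  rw [Finset.sum_eq_single i (fun j _ hj => by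
    rw [hA.eigenvectorBasis.orthonormal.2 hj]; ring) (fun h => absurd (Finset.mem_univ i) h),
    real_inner_self_eq_norm_sq, hA.eigenvectorBasis.orthonormal.1] at h2
  simp only [one_pow, mul_one] at h2
  change 0 < hA.eigenvalues i
  rw [← h2]
  have := norm_pos_iff.2 h0
  positivity

theorem exists_stretch_bounds {T : Matrix (Fin d) (Fin d) ℝ} (hT : IsUnit T.det) :
    ∃ m K : ℝ, 0 < m ∧ ∀ i, m ≤ stretchEigenvalues T i ∧ stretchEigenvalues T i ≤ K := by
  rcases isEmpty_or_nonempty (Fin d) with h | h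
  · exact ⟨1, 1, one_pos, fun i => h.elim i⟩
  · obtain ⟨i, hi⟩ := Finite.exists_min (stretchEigenvalues T)
    obtain ⟨j, hj⟩ := Finite.exists_max (stretchEigenvalues T)
    exact ⟨_, _, stretchEigenvalues_pos hT i, fun k => ⟨hi k, hj k⟩⟩

theorem sum_one_div_card (hd : 0 < d) : ∑ _i : Fin d, (1 / (d : ℝ)) = 1 := by
  have : (d : ℝ) ≠ 0 := by positivity
  simp [this]

/-- For T = cO one has T⁻¹T⁻ᵀ = c⁻²I: all μᵢ coincide and the means over i collapse. The guard `0 <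
d` is there because c = 0 is possible in dimension zero. -/
theorem stretchEigenvalues_of_isMultipleOfOrthogonal {T : Matrix (Fin d) (Fin d) ℝ}
    (hT : IsUnit T.det) (h : IsMultipleOfOrthogonal T) :
    ∃ c : ℝ, (0 < d → c ≠ 0) ∧ (∀ i, stretchEigenvalues T i = (c ^ 2)⁻¹) ∧
      ∀ ξ : Eucl d, ‖LinearMap.adjoint (Matrix.toEuclideanLin T) ξ‖ ^ 2 = c ^ 2 * ‖ξ‖ ^ 2 := by
  obtain ⟨c, O, hO, rfl⟩ := h
  have hc : 0 < d → c ≠ 0 := by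
    rintro hd rfl
    have : Nonempty (Fin d) := ⟨⟨0, hd⟩⟩
    simp at hT
  have hO1 : O.transpose * O = 1 := (Matrix.mem_orthogonalGroup_iff' (Fin d) ℝ).1 hO
  have hO2 : O * O.transpose = 1 := (Matrix.mem_orthogonalGroup_iff (Fin d) ℝ).1 hO
  refine ⟨c, hc, fun i => ?_, fun ξ => ?_⟩
  · have hcne := hc (Fin.pos i)
    set hA := isHermitian_mul_transpose_self (c • O)⁻¹
    have h1 : ((c • O)⁻¹ * ((c • O)⁻¹).transpose) = (c ^ 2)⁻¹ • (1 : Matrix (Fin d) (Fin d) ℝ) := by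
      have h2 : (c • O)⁻¹ = c⁻¹ • O.transpose := by
        refine Matrix.inv_eq_right_inv ?_
        rw [Matrix.smul_mul, Matrix.mul_smul, hO2, smul_smul, mul_inv_cancel₀ hcne, one_smul]
      rw [h2, Matrix.transpose_smul, Matrix.transpose_transpose, Matrix.smul_mul, Matrix.mul_smul,
        hO1, smul_smul, sq, mul_inv]
    have h2 : ∀ x, ((c • O)⁻¹ * ((c • O)⁻¹).transpose).mulVec x = (c ^ 2)⁻¹ • x := fun x => by
      rw [h1, Matrix.smul_mulVec, Matrix.one_mulVec]
    have h3 := hA.mulVec_eigenvectorBasis i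
    rw [h2] at h3
    have h4 : (hA.eigenvalues i - (c ^ 2)⁻¹) • hA.eigenvectorBasis i = 0 := by
      ext j
      have := congrFun h3 j
      simp only [Pi.smul_apply, smul_eq_mul] at this
      simp only [PiLp.smul_apply, smul_eq_mul, PiLp.zero_apply]
      linarith
    rcases smul_eq_zero.1 h4 with h5 | h5
    · exact sub_eq_zero.1 h5
    · exact absurd h5 (hA.eigenvectorBasis.orthonormal.ne_zero i)
  · rw [← real_inner_self_eq_norm_sq, LinearMap.adjoint_inner_right,
      ← Matrix.toEuclideanLin_conjTranspose_eq_adjoint,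
      Matrix.conjTranspose_eq_transpose_of_trivial]
    have h1 : Matrix.toEuclideanLin (c • O) (Matrix.toEuclideanLin (c • O).transpose ξ) =
        c ^ 2 • ξ := by
      have h2 : (c • O) * (c • O).transpose = c ^ 2 • (1 : Matrix (Fin d) (Fin d) ℝ) := by
        rw [Matrix.transpose_smul, Matrix.smul_mul, Matrix.mul_smul, hO2, smul_smul, sq]
      simp only [Matrix.toLpLin_apply, Matrix.mulVec_mulVec]
      rw [h2, Matrix.smul_mulVec, Matrix.one_mulVec]
      rfl
    rw [h1, real_inner_smul_left, real_inner_self_eq_norm_sq]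

end TransformedMultiplier

/-! ### Measurability, growth, ellipticity and monotonicity of multipliers -/

section Symbols

variable {d : ℕ}

theorem aemeasurable_comp_norm_sq (hd : 0 < d) {g : ℝ → ℝ}
    (hg : Measurable fun t : Ioi (0 : ℝ) => g t) :
    AEMeasurable (fun ξ : Eucl d => g (‖ξ‖ ^ 2)) volume := by
  obtain ⟨g', hg', hext⟩ :=
    (MeasurableEmbedding.subtype_coe (measurableSet_Ioi (a := (0 : ℝ)))).exists_measurable_extend
      hg (fun _ => ⟨0⟩)
  refine ⟨fun ξ => g' (‖ξ‖ ^ 2), hg'.comp (measurable_norm.pow_const 2), ?_⟩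
  filter_upwards [ae_norm_sq_pos hd] with ξ hξ
  exact (congrFun hext ⟨‖ξ‖ ^ 2, hξ⟩).symm

theorem isSymbol_of_elliptic (hd : 0 < d) {β : ℝ} {g : ℝ → ℝ}
    (hm : Measurable fun t : Ioi (0 : ℝ) => g t) (hp : PolynomiallyBounded g)
    (he : EllipticOfOrder β g) : IsSymbol d g := by
  obtain ⟨c, C, hc, h⟩ := he
  refine ⟨aemeasurable_comp_norm_sq hd hm, hp, |C|, abs_nonneg C, fun t ht => ?_⟩
  have h1 := h t ht
  have h2 : 0 ≤ c * t ^ β := mul_nonneg hc.le (Real.rpow_nonneg ht.le β)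
  linarith [le_abs_self C]

theorem measurable_of_continuousOn_Ioi {g : ℝ → ℝ} (hg : ContinuousOn g (Ioi 0)) :
    Measurable fun t : Ioi (0 : ℝ) => g t :=
  (continuousOn_iff_continuous_domRestrict.1 hg).measurable

/-- Superlevel sets of a concave function on the line are intervals, hence Borel. Continuity is not
available, as Ψ may jump at endpoints of J. -/
theorem ConcaveOn.measurable_comp {J : Set ℝ} {Ψ : ℝ → ℝ} (hΨ : ConcaveOn ℝ J Ψ) {α : Type*}
    [MeasurableSpace α] {s : α → ℝ} (hs : Measurable s) (hsJ : ∀ x, s x ∈ J) :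
    Measurable fun x => Ψ (s x) := by
  refine measurable_of_Ioi fun r => ?_
  have h : (fun x => Ψ (s x)) ⁻¹' Ioi r = s ⁻¹' {x ∈ J | r < Ψ x} := by
    ext x
    simp [hsJ x]
  rw [h]
  exact hs (hΨ.convex_gt r).ordConnected.measurableSet

theorem continuousOn_transformedMultiplier {Φ₁ Φ₂ : ℝ → ℝ} (h₁ : ContinuousOn Φ₁ (Ioi 0))
    (h₂ : ContinuousOn Φ₂ (Ioi 0)) (hd : 0 < d) {T : Matrix (Fin d) (Fin d) ℝ}
    (hT : IsUnit T.det) : ContinuousOn (transformedMultiplier Φ₁ Φ₂ T) (Ioi 0) := by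
  have heq : transformedMultiplier Φ₁ Φ₂ T = fun t => _ := funext (transformedMultiplier_eq Φ₁ Φ₂ T)
  have hpos := stretchEigenvalues_pos hT
  have : Nonempty (Fin d) := ⟨⟨0, hd⟩⟩
  have hd' : (0 : ℝ) < 1 / d := by positivity
  rw [heq]
  refine ContinuousOn.sub ?_ ?_
  · refine continuousOn_finsetSum _ fun i _ => ContinuousOn.mul continuousOn_const ?_
    exact h₁.comp (by fun_prop) fun t ht => mul_pos ht (hpos i)
  · refine h₂.comp (by fun_prop) fun t ht => ?_
    exact Finset.sum_pos (fun i _ => mul_pos hd' (mul_pos ht (hpos i))) Finset.univ_nonempty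

/-- Ellipticity is inherited by a multiplier that dominates an average of dilates. -/
theorem EllipticOfOrder.of_average_le (hd : 0 < d) {β : ℝ} (hβ : 0 < β) {f g : ℝ → ℝ}
    (hf : EllipticOfOrder β f) {T : Matrix (Fin d) (Fin d) ℝ} (hT : IsUnit T.det)
    (h : ∀ t : ℝ, 0 < t → ∑ i, (1 / (d : ℝ)) * f (t * stretchEigenvalues T i) ≤ g t) :
    EllipticOfOrder β g := by
  obtain ⟨c, C, hc, hfc⟩ := hf
  obtain ⟨m, K, hm, hmK⟩ := exists_stretch_bounds hT
  refine ⟨c * m ^ β, C, by positivity, fun t ht => le_trans ?_ (h t ht)⟩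
  have h1 : ∀ i, c * m ^ β * t ^ β - C ≤ f (t * stretchEigenvalues T i) := by
    intro i
    have h2 : 0 < stretchEigenvalues T i := hm.trans_le (hmK i).1
    refine le_trans ?_ (hfc _ (mul_pos ht h2))
    have h3 : m ^ β * t ^ β ≤ (t * stretchEigenvalues T i) ^ β := by
      rw [← Real.mul_rpow hm.le ht.le, mul_comm]
      exact Real.rpow_le_rpow (by positivity) (by gcongr; exact (hmK i).1) hβ.le
    nlinarith
  calc c * m ^ β * t ^ β - C = ∑ _i : Fin d, (1 / (d : ℝ)) * (c * m ^ β * t ^ β - C) := by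
        rw [← Finset.sum_mul, sum_one_div_card hd, one_mul]
    _ ≤ _ := Finset.sum_le_sum fun i _ => mul_le_mul_of_nonneg_left (h1 i) (by positivity)

/-- An average of the values of a continuous function at comparable points is a value. -/
theorem exists_eq_average (hd : 0 < d) {Φ : ℝ → ℝ} (hΦ : ContinuousOn Φ (Ioi 0))
    {T : Matrix (Fin d) (Fin d) ℝ} (hT : IsUnit T.det) {K : ℝ}
    (hK : ∀ i, stretchEigenvalues T i ≤ K) {t : ℝ} (ht : 0 < t) :
    ∃ s, 0 < s ∧ s ≤ t * K ∧ ∑ i, (1 / (d : ℝ)) * Φ (t * stretchEigenvalues T i) = Φ s := by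
  -- The continuous image of an interval is an interval, so it contains averages of its points.
  have hconv : Convex ℝ (Φ '' Ioc 0 (t * K)) :=
    (isPreconnected_Ioc.image Φ (hΦ.mono Ioc_subset_Ioi_self)).ordConnected.convex
  have h := hconv.sum_mem (t := Finset.univ) (w := fun _ : Fin d => 1 / (d : ℝ))
    (z := fun i => Φ (t * stretchEigenvalues T i)) (fun i _ => by positivity)
    (sum_one_div_card hd) (fun i _ => ⟨_, ⟨mul_pos ht (stretchEigenvalues_pos hT i), by
      gcongr; exact hK i⟩, rfl⟩)
  obtain ⟨s, ⟨hs1, hs2⟩, hs⟩ := h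
  exact ⟨s, hs1, hs2, by simpa using hs.symm⟩

/-- In the second part no growth of the transformed multiplier is assumed. By the intermediate value
property it equals f(s) with s ≤ tK, which transfers the bound. -/
theorem polynomiallyBounded_of_eq_value {f g : ℝ → ℝ} (hf : PolynomiallyBounded f) {K : ℝ}
    (h : ∀ t : ℝ, 0 < t → ∃ s, 0 < s ∧ s ≤ t * K ∧ g t = f s) : PolynomiallyBounded g := by
  obtain ⟨C, m, hC⟩ := hf
  refine ⟨|C| * (1 + |K|) ^ m, m, fun t ht => ?_⟩
  obtain ⟨s, hs, hsK, hgs⟩ := h t ht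
  rw [hgs, mul_assoc, ← mul_pow]
  refine (hC s hs).trans ?_
  have h1 : 1 + s ≤ (1 + |K|) * (1 + t) := by
    nlinarith [mul_le_mul_of_nonneg_left (le_abs_self K) ht.le, abs_nonneg K]
  exact mul_le_mul (le_abs_self C) (pow_le_pow_left₀ (by positivity) h1 m) (by positivity)
    (abs_nonneg C)

theorem EllipticOfOrder.exists_gt {β : ℝ} (hβ : 0 < β) {f : ℝ → ℝ} (hf : EllipticOfOrder β f)
    (r : ℝ) : ∃ t : ℝ, 0 < t ∧ r < f t := by
  obtain ⟨c, C, hc, h⟩ := hf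
  have h1 := ((tendsto_rpow_atTop hβ).const_mul_atTop hc).eventually_gt_atTop (r + C)
  obtain ⟨t, ht1, ht2⟩ := (h1.and (eventually_gt_atTop 0)).exists
  exact ⟨t, ht2, by linarith [h t ht2]⟩

/-- A concave function that is unbounded above along a set that is bounded below is monotone. -/
theorem ConcaveOn.monotoneOn_of_unbounded {J : Set ℝ} {Ψ : ℝ → ℝ} (hΨ : ConcaveOn ℝ J Ψ) {S : Set ℝ}
    (hSJ : S ⊆ J) (hS : BddBelow S) (hunb : ∀ r, ∃ z ∈ S, r < Ψ z) : MonotoneOn Ψ J := by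
  intro x hx y hy hxy
  by_contra! hlt
  have hxy' : x < y := lt_of_le_of_ne hxy (by rintro rfl; exact lt_irrefl _ hlt)
  obtain ⟨B, hB⟩ := hS
  -- If Ψ dropped from x to y, concavity would bound it above on S: by Ψ y beyond y, by the slope s₁
  -- over [x, q] between q and y, and by the slope s₂ over [q, y] between B and q. The point z is
  -- chosen above all three bounds.
  set q := (x + y) / 2 with hq
  have hxq : x < q := by rw [hq]; linarith
  have hqy : q < y := by rw [hq]; linarith
  have hqJ : q ∈ J := hΨ.1.ordConnected.out hx hy ⟨hxq.le, hqy.le⟩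
  set s₁ := (Ψ q - Ψ x) / (q - x)
  set s₂ := (Ψ y - Ψ q) / (y - q)
  obtain ⟨z, hzS, hz⟩ := hunb (max (Ψ y) (Ψ q + |s₁| * (y - q) + |s₂| * |q - B|))
  have hzJ := hSJ hzS
  have hz1 := (le_max_left _ _).trans_lt hz
  have hz2 := (le_max_right _ _).trans_lt hz
  have hp1 : 0 ≤ |s₁| * (y - q) := mul_nonneg (abs_nonneg _) (by linarith)
  have hp2 : 0 ≤ |s₂| * |q - B| := by positivity
  rcases lt_trichotomy z q with h | h | h
  · have h1 := hΨ.slope_anti_adjacent hzJ hy h hqy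
    rw [le_div_iff₀ (by linarith)] at h1
    have h2 : |s₂| * (q - z) ≤ |s₂| * |q - B| := by
      refine mul_le_mul_of_nonneg_left ?_ (abs_nonneg _)
      have := hB hzS
      exact le_trans (by linarith) (le_abs_self _)
    have h3 : -|s₂| * (q - z) ≤ s₂ * (q - z) :=
      mul_le_mul_of_nonneg_right (neg_abs_le _) (by linarith)
    linarith
  · rw [h] at hz2
    linarith
  · rcases le_or_gt z y with hzy | hzy
    · have h1 := hΨ.slope_anti_adjacent hx hzJ hxq h
      rw [div_le_iff₀ (by linarith)] at h1
      have h2 : s₁ * (z - q) ≤ |s₁| * (y - q) :=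
        mul_le_mul (le_abs_self _) (by linarith) (by linarith) (abs_nonneg _)
      change Ψ z - Ψ q ≤ s₁ * (z - q) at h1
      linarith
    · have h1 := hΨ.slope_anti_adjacent hx hzJ hxy' hzy
      rw [div_le_iff₀ (by linarith)] at h1
      have h2 : (Ψ y - Ψ x) / (y - x) * (z - y) ≤ 0 :=
        mul_nonpos_of_nonpos_of_nonneg (div_nonpos_of_nonpos_of_nonneg (by linarith) (by linarith))
          (by linarith)
      linarith

end Symbols

/-! ### Averaging maps, Jensen's inequality and discreteness on both domains -/

section Main

variable {d : ℕ}

theorem toEuclideanLin_inv_comp {T : Matrix (Fin d) (Fin d) ℝ} (hT : IsUnit T.det) (x : Eucl d) :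
    Matrix.toEuclideanLin T (Matrix.toEuclideanLin T⁻¹ x) = x := by
  simp [Matrix.toLpLin_apply, Matrix.mulVec_mulVec, Matrix.mul_nonsing_inv _ hT]

theorem toEuclideanLin_comp_inv {T : Matrix (Fin d) (Fin d) ℝ} (hT : IsUnit T.det) (x : Eucl d) :
    Matrix.toEuclideanLin T⁻¹ (Matrix.toEuclideanLin T x) = x := by
  simp [Matrix.toLpLin_apply, Matrix.mulVec_mulVec, Matrix.nonsing_inv_mul _ hT]

theorem det_toEuclideanLin_ne_zero {T : Matrix (Fin d) (Fin d) ℝ} (hT : IsUnit T.det) :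
    LinearMap.det (Matrix.toEuclideanLin T) ≠ 0 ∧ LinearMap.det (Matrix.toEuclideanLin T⁻¹) ≠ 0 := by
  have h : Matrix.toEuclideanLin T ∘ₗ Matrix.toEuclideanLin T⁻¹ = LinearMap.id :=
    LinearMap.ext (toEuclideanLin_inv_comp hT)
  have h1 := congrArg LinearMap.det h
  rw [LinearMap.det_comp, LinearMap.det_id] at h1
  exact ⟨left_ne_zero_of_mul_eq_one h1, right_ne_zero_of_mul_eq_one h1⟩

/-- Finitely many isometries of `Ω`, composed with `T⁻¹`, spread every frequency evenly over the
eigendirections of `T⁻¹ T⁻ᵀ`. -/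
theorem exists_averaging_maps (hd : 0 < d) {Ω : Set (Eucl d)}
    (hirr : HasIrreducibleIsometryGroup Ω) {T : Matrix (Fin d) (Fin d) ℝ} (hT : IsUnit T.det) :
    ∃ (ι : Type) (_ : Fintype ι) (w : ι → ℝ) (M : ι → Eucl d →ₗ[ℝ] Eucl d)
      (hM : ∀ k, LinearMap.det (M k) ≠ 0) (c : ι → Eucl d), (∀ k, 0 ≤ w k) ∧ ∑ k, w k = 1 ∧
      (∀ k, affineHomeo (hM k) (c k) ⁻¹' Ω ⊆ linearImage T Ω) ∧
      ∀ ξ : Eucl d, 0 < ‖ξ‖ ^ 2 → ∃ p : ι → Fin d → ℝ, (∀ k i, 0 ≤ p k i) ∧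
        (∀ k, ∑ i, p k i = 1) ∧ (∀ i, ∑ k, w k * p k i = 1 / d) ∧
        ∀ k, ‖LinearMap.adjoint (M k) ξ‖ ^ 2 =
          ∑ i, p k i * (‖ξ‖ ^ 2 * stretchEigenvalues T i) := by
  set hA := isHermitian_mul_transpose_self T⁻¹
  obtain ⟨ι, hι, w, g, hw0, hw1, hg, hav⟩ :=
    hirr.exists_average hd fun i => hA.eigenvectorBasis i
  let R : ι → Eucl d ≃ₗᵢ[ℝ] Eucl d := fun k => (g k).linearIsometryEquiv
  let M : ι → Eucl d →ₗ[ℝ] Eucl d := fun k =>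
    (R k).toLinearEquiv.toLinearMap ∘ₗ Matrix.toEuclideanLin T⁻¹
  have hM : ∀ k, LinearMap.det (M k) ≠ 0 := fun k => by
    rw [LinearMap.det_comp]
    exact mul_ne_zero (R k).toLinearEquiv.isUnit_det'.ne_zero (det_toEuclideanLin_ne_zero hT).2
  -- The translation g k 0 makes the affine map with linear part M k equal to g k ∘ T⁻¹, which
  -- carries T(Ω) onto Ω.
  refine ⟨ι, hι, w, M, hM, fun k => g k 0, hw0, hw1, fun k x hx => ?_, fun ξ hξ => ?_⟩
  · have h1 : affineHomeo (hM k) (g k 0) x = g k (Matrix.toEuclideanLin T⁻¹ x) := by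
      rw [affineHomeo_apply]
      have := (g k).map_vadd 0 (Matrix.toEuclideanLin T⁻¹ x)
      simp only [vadd_eq_add, add_zero] at this
      exact this.symm
    rw [mem_preimage, h1] at hx
    rw [← hg k] at hx
    obtain ⟨y, hy, hyx⟩ := hx
    refine ⟨y, hy, ?_⟩
    rw [(g k).injective hyx]
    exact toEuclideanLin_inv_comp hT x
  · have hξ0 : ‖ξ‖ ≠ 0 := by
      rintro h
      norm_num [h] at hξ
    have hadj : ∀ k x, LinearMap.adjoint (M k) x =
        LinearMap.adjoint (Matrix.toEuclideanLin T⁻¹) ((R k).symm x) := by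
      intro k x
      refine ext_inner_left ℝ fun y => ?_
      rw [LinearMap.adjoint_inner_right, LinearMap.adjoint_inner_right]
      have := (R k).inner_map_map (Matrix.toEuclideanLin T⁻¹ y) ((R k).symm x)
      rw [(R k).apply_symm_apply] at this
      exact this
    have hinner : ∀ k i, ⟪hA.eigenvectorBasis i, (R k).symm ξ⟫_ℝ =
        ⟪R k (hA.eigenvectorBasis i), ξ⟫_ℝ := by
      intro k i
      rw [← (R k).inner_map_map, (R k).apply_symm_apply]
    -- Squared direction cosines of ξ in the rotated eigenbasis: Parseval gives the sums over i, the
    -- group average the weighted sums over k.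
    refine ⟨fun k i => ⟪R k (hA.eigenvectorBasis i), ξ⟫_ℝ ^ 2 / ‖ξ‖ ^ 2, fun k i => by positivity,
      fun k => ?_, fun i => ?_, fun k => ?_⟩
    · rw [← Finset.sum_div, div_eq_one_iff_eq hξ.ne', ← (R k).symm.norm_map ξ,
        ← hA.eigenvectorBasis.sum_sq_inner_right]
      exact Finset.sum_congr rfl fun i _ => by rw [hinner]
    · simp_rw [← mul_div_assoc]
      rw [← Finset.sum_div, hav, hA.eigenvectorBasis.orthonormal.1]
      field_simp
    · rw [hadj, norm_adjoint_toEuclideanLin_sq]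
      refine Finset.sum_congr rfl fun i _ => ?_
      rw [hinner]
      change hA.eigenvalues i * _ = _ * (_ * hA.eigenvalues i)
      field_simp

/-- Jensen is used twice: for Φ₁ with the weights p k i at fixed k, and for Φ₂ with the weights w k.
Both double averages reduce to weights 1/d by the column sums of p. -/
theorem average_le_transformedMultiplier {T : Matrix (Fin d) (Fin d) ℝ} (hT : IsUnit T.det)
    {Φ₁ Φ₂ : ℝ → ℝ} (h₁ : ConvexOn ℝ (Ioi 0) Φ₁) (h₂ : ConvexOn ℝ (Ioi 0) Φ₂) {ι : Type*} [Fintype ι]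
    {w : ι → ℝ} (hw0 : ∀ k, 0 ≤ w k) (hw1 : ∑ k, w k = 1) {p : ι → Fin d → ℝ}
    (hp0 : ∀ k i, 0 ≤ p k i) (hp1 : ∀ k, ∑ i, p k i = 1) (hwp : ∀ i, ∑ k, w k * p k i = 1 / d)
    {t : ℝ} (ht : 0 < t) :
    ∑ k, w k * (Φ₁ (∑ i, p k i * (t * stretchEigenvalues T i)) -
      Φ₂ (∑ i, p k i * (t * stretchEigenvalues T i))) ≤ transformedMultiplier Φ₁ Φ₂ T t := by
  have hpos : ∀ i, t * stretchEigenvalues T i ∈ Ioi (0 : ℝ) := fun i =>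
    mul_pos ht (stretchEigenvalues_pos hT i)
  have hs : ∀ k, ∑ i, p k i * (t * stretchEigenvalues T i) ∈ Ioi (0 : ℝ) := fun k =>
    (convex_Ioi (0 : ℝ)).sum_mem (fun i _ => hp0 k i) (hp1 k) fun i _ => hpos i
  have hswap : ∀ F : Fin d → ℝ, ∑ k, w k * ∑ i, p k i * F i = ∑ i, (1 / (d : ℝ)) * F i := by
    intro F
    simp_rw [Finset.mul_sum]
    rw [Finset.sum_comm]
    refine Finset.sum_congr rfl fun i _ => ?_
    rw [← hwp i, Finset.sum_mul]
    exact Finset.sum_congr rfl fun k _ => by ring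
  rw [transformedMultiplier_eq]
  simp_rw [mul_sub]
  rw [Finset.sum_sub_distrib]
  refine sub_le_sub ?_ ?_
  · rw [← hswap]
    refine Finset.sum_le_sum fun k _ => mul_le_mul_of_nonneg_left ?_ (hw0 k)
    exact h₁.map_sum_le (fun i _ => hp0 k i) (hp1 k) fun i _ => hpos i
  · rw [← hswap]
    exact h₂.map_sum_le (fun k _ => hw0 k) hw1 fun k _ => hs k

/-- Only Jensen for Φ₂ is involved. It lets the transformed multiplier inherit ellipticity from f.
-/
theorem average_dilates_le_transformedMultiplier (hd : 0 < d) {T : Matrix (Fin d) (Fin d) ℝ}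
    (hT : IsUnit T.det) {Φ₁ Φ₂ : ℝ → ℝ} (h₂ : ConvexOn ℝ (Ioi 0) Φ₂) {t : ℝ} (ht : 0 < t) :
    ∑ i, (1 / (d : ℝ)) * (Φ₁ (t * stretchEigenvalues T i) - Φ₂ (t * stretchEigenvalues T i)) ≤
      transformedMultiplier Φ₁ Φ₂ T t := by
  rw [transformedMultiplier_eq]
  simp_rw [mul_sub]
  rw [Finset.sum_sub_distrib]
  refine sub_le_sub_left ?_ _
  exact h₂.map_sum_le (fun _ _ => by positivity) (sum_one_div_card hd) fun i _ =>
    mul_pos ht (stretchEigenvalues_pos hT i)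

theorem isOpen_linearImage {T : Matrix (Fin d) (Fin d) ℝ} (hT : IsUnit T.det) {Ω : Set (Eucl d)}
    (hΩ : IsOpen Ω) : IsOpen (linearImage T Ω) := by
  have h : linearImage T Ω = affineHomeo (det_toEuclideanLin_ne_zero hT).1 0 '' Ω := by
    refine image_congr fun x _ => ?_
    rw [affineHomeo_apply, add_zero]
  rw [h]
  exact (affineHomeo _ 0).isOpenMap _ hΩ

theorem preimage_linearImage_subset {T : Matrix (Fin d) (Fin d) ℝ} (hT : IsUnit T.det)
    (Ω : Set (Eucl d)) :
    affineHomeo (det_toEuclideanLin_ne_zero hT).1 0 ⁻¹' linearImage T Ω ⊆ Ω := by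
  rintro x ⟨y, hy, hyx⟩
  simp only [affineHomeo_apply, add_zero] at hyx
  have := congrArg (Matrix.toEuclideanLin T⁻¹) hyx
  rw [toEuclideanLin_comp_inv hT, toEuclideanLin_comp_inv hT] at this
  rwa [← this]

/-- Discreteness on `T(Ω)` and on `Ω`. -/
theorem exists_spectra (hd : 0 < d) {Ω : Set (Eucl d)} (hΩ : IsOpen Ω) (hne : Ω.Nonempty)
    {T : Matrix (Fin d) (Fin d) ℝ} (hT : IsUnit T.det) {β : ℝ} (hβ : 0 < β)
    (hcomp : SobolevCompactEmbedding β Ω) {f g : ℝ → ℝ} (hf : IsSymbol d f)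
    (hfe : EllipticOfOrder β f) (hg : IsSymbol d g) (hge : EllipticOfOrder β g) :
    (∃ a, IsEigenvalueSequence f (linearImage T Ω) a) ∧ ∃ b, IsEigenvalueSequence g Ω b := by
  refine ⟨exists_isEigenvalueSequence hd hf (isOpen_linearImage hT hΩ) (hne.image _)
    (hasCompactTestFunctions_of_elliptic hd hβ hcomp hfe _ 0 (preimage_linearImage_subset hT Ω)),
    exists_isEigenvalueSequence hd hg hΩ hne ?_⟩
  refine hasCompactTestFunctions_of_elliptic hd hβ hcomp hge (M := LinearMap.id) (by simp) 0 ?_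
  intro x hx
  simpa [affineHomeo_apply] using hx

end Main

end

/-! ### The two inequalities and the case of equality -/

theorem mainTheorem2 (d : ℕ) (hd : 0 < d)
    (Ω : Set (Eucl d)) (hΩ : IsOpen Ω) (hΩne : Ω.Nonempty)
    (hirr : HasIrreducibleIsometryGroup Ω)
    (T : Matrix (Fin d) (Fin d) ℝ) (hT : IsUnit T.det)
    (β : ℝ) (hβ : 0 < β) (hcomp : SobolevCompactEmbedding β Ω) :
    (∀ f Φ₁ Φ₂ : ℝ → ℝ,
      PolynomiallyBounded f → EllipticOfOrder β f →
      ConvexOn ℝ (Ioi 0) Φ₁ → ConvexOn ℝ (Ioi 0) Φ₂ →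
      (∀ t : ℝ, 0 < t → f t = Φ₁ t - Φ₂ t) →
      PolynomiallyBounded (transformedMultiplier Φ₁ Φ₂ T) →
        (∃ a, IsEigenvalueSequence f (linearImage T Ω) a) ∧
        (∃ b, IsEigenvalueSequence (transformedMultiplier Φ₁ Φ₂ T) Ω b) ∧
        ∀ a b : ℕ → ℝ, IsEigenvalueSequence f (linearImage T Ω) a →
          IsEigenvalueSequence (transformedMultiplier Φ₁ Φ₂ T) Ω b →
          ∀ n : ℕ,
            (∑ k ∈ Finset.range n, a k ≤ ∑ k ∈ Finset.range n, b k) ∧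
            (IsMultipleOfOrthogonal T →
              ∑ k ∈ Finset.range n, a k = ∑ k ∈ Finset.range n, b k)) ∧
    (∀ (f Φ Ψ : ℝ → ℝ) (J : Set ℝ),
      PolynomiallyBounded f → EllipticOfOrder β f →
      ConvexOn ℝ (Ioi 0) Φ → BddBelow (Φ '' Ioi 0) →
      ConcaveOn ℝ J Ψ → MapsTo Φ (Ioi 0) J →
      (∀ t : ℝ, 0 < t → f t = Ψ (Φ t)) →
        (∃ a, IsEigenvalueSequence f (linearImage T Ω) a) ∧
        (∃ b, IsEigenvalueSequence (Ψ ∘ transformedMultiplier Φ 0 T) Ω b) ∧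
        ∀ a b : ℕ → ℝ, IsEigenvalueSequence f (linearImage T Ω) a →
          IsEigenvalueSequence (Ψ ∘ transformedMultiplier Φ 0 T) Ω b →
          ∀ n : ℕ, ∑ k ∈ Finset.range n, a k ≤ ∑ k ∈ Finset.range n, b k) := by
  obtain ⟨ι, _, w, M, hM, c, hw0, hw1, hMΩ, hp⟩ := exists_averaging_maps hd hirr hT
  have hμ := stretchEigenvalues_pos hT
  have hd' : (d : ℝ) ≠ 0 := by positivity
  constructor
  · intro f Φ₁ Φ₂ hfp hfe h₁ h₂ hf hFp
    have hc₁ : ContinuousOn Φ₁ (Ioi 0) := h₁.continuousOn isOpen_Ioi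
    have hc₂ : ContinuousOn Φ₂ (Ioi 0) := h₂.continuousOn isOpen_Ioi
    have hFe : EllipticOfOrder β (transformedMultiplier Φ₁ Φ₂ T) :=
      hfe.of_average_le hd hβ hT fun t ht => by
        refine le_trans (le_of_eq (Finset.sum_congr rfl fun i _ => ?_))
          (average_dilates_le_transformedMultiplier hd hT h₂ ht)
        rw [hf _ (mul_pos ht (hμ i))]
    have hfs : IsSymbol d f := isSymbol_of_elliptic hd
      (measurable_of_continuousOn_Ioi ((hc₁.sub hc₂).congr hf)) hfp hfe
    have hFs : IsSymbol d (transformedMultiplier Φ₁ Φ₂ T) := isSymbol_of_elliptic hd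
      (measurable_of_continuousOn_Ioi (continuousOn_transformedMultiplier hc₁ hc₂ hd hT)) hFp hFe
    obtain ⟨hA, hB⟩ := exists_spectra hd hΩ hΩne hT hβ hcomp hfs hfe hFs hFe
    refine ⟨hA, hB, fun a b ha hb n => ?_⟩
    have hle : ∑ k ∈ Finset.range n, a k ≤ ∑ k ∈ Finset.range n, b k := by
      refine sum_eigenvalues_le_of_average hd hfs hFs hw0 hw1 hM c hMΩ (fun ξ hξ => ?_) ha hb n
      obtain ⟨p, hp0, hp1, hwp, hnorm⟩ := hp ξ hξ
      refine le_trans (le_of_eq (Finset.sum_congr rfl fun k _ => ?_))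
        (average_le_transformedMultiplier hT h₁ h₂ hw0 hw1 hp0 hp1 hwp hξ)
      rw [hnorm, hf]
      exact (convex_Ioi (0 : ℝ)).sum_mem (fun i _ => hp0 k i) (hp1 k) fun i _ =>
        mul_pos hξ (hμ i)
    refine ⟨hle, fun hortho => le_antisymm hle ?_⟩
    obtain ⟨r, hr, hμr, hadj⟩ := stretchEigenvalues_of_isMultipleOfOrthogonal hT hortho
    have hr0 := hr hd
    -- For the reverse inequality no averaging is needed: the single map T transplants from T(Ω)
    -- back to Ω, and F composed with the stretching of T is exactly f.
    refine sum_eigenvalues_le_of_average (ι := Unit) (w := fun _ => 1)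
      (M := fun _ => Matrix.toEuclideanLin T) hd hFs hfs (fun _ => zero_le_one) (by simp)
      (fun _ => (det_toEuclideanLin_ne_zero hT).1) (fun _ => 0)
      (fun _ => preimage_linearImage_subset hT Ω) (fun ξ hξ => ?_) hb ha n
    have hs : r ^ 2 * ‖ξ‖ ^ 2 * (r ^ 2)⁻¹ = ‖ξ‖ ^ 2 := by field_simp
    simp only [Finset.univ_unique, Finset.sum_singleton, one_mul]
    rw [hadj, transformedMultiplier_eq, hf _ hξ]
    simp only [hμr, hs]
    rw [← Finset.sum_mul, ← Finset.sum_mul, sum_one_div_card hd, one_mul, one_mul]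
  · intro f Φ Ψ J hfp hfe hΦ hbdd hΨ hJ hf
    have hc : ContinuousOn Φ (Ioi 0) := hΦ.continuousOn isOpen_Ioi
    -- Ellipticity makes Ψ unbounded above on the range of Φ, which is bounded below; a concave
    -- function can do this only if it is nondecreasing.
    have hmono : MonotoneOn Ψ J := hΨ.monotoneOn_of_unbounded hJ.image_subset hbdd fun r => by
      obtain ⟨t, ht, hr⟩ := hfe.exists_gt hβ r
      exact ⟨_, ⟨t, ht, rfl⟩, by rwa [← hf t ht]⟩
    have hF : ∀ t, transformedMultiplier Φ 0 T t =
        ∑ i, (1 / (d : ℝ)) * Φ (t * stretchEigenvalues T i) := fun t => by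
      rw [transformedMultiplier_eq, Pi.zero_apply, sub_zero]
    have hFJ : ∀ t, 0 < t → transformedMultiplier Φ 0 T t ∈ J := fun t ht => by
      rw [hF]
      exact hΨ.1.sum_mem (fun _ _ => by positivity) (sum_one_div_card hd) fun i _ =>
        hJ (mul_pos ht (hμ i))
    have hGe : EllipticOfOrder β (Ψ ∘ transformedMultiplier Φ 0 T) :=
      hfe.of_average_le hd hβ hT fun t ht => by
        rw [Function.comp_apply, hF]
        refine le_trans (le_of_eq (Finset.sum_congr rfl fun i _ => ?_))
          (hΨ.le_map_sum (fun _ _ => by positivity) (sum_one_div_card hd) fun i _ =>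
            hJ (mul_pos ht (hμ i)))
        rw [hf _ (mul_pos ht (hμ i)), smul_eq_mul]
    have hGp : PolynomiallyBounded (Ψ ∘ transformedMultiplier Φ 0 T) := by
      obtain ⟨m, K, -, hK⟩ := exists_stretch_bounds hT
      refine polynomiallyBounded_of_eq_value hfp (K := K) fun t ht => ?_
      obtain ⟨s, hs, hsK, heq⟩ := exists_eq_average hd hc hT (fun i => (hK i).2) ht
      exact ⟨s, hs, hsK, by rw [Function.comp_apply, hF, heq, hf s hs]⟩
    have hfs : IsSymbol d f := by
      refine isSymbol_of_elliptic hd ?_ hfp hfe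
      have h := hΨ.measurable_comp (measurable_of_continuousOn_Ioi hc) fun t => hJ t.2
      have heq : (fun t : Ioi (0 : ℝ) => f t) = fun t : Ioi (0 : ℝ) => Ψ (Φ t) :=
        funext fun t => hf t t.2
      rwa [heq]
    have hGs : IsSymbol d (Ψ ∘ transformedMultiplier Φ 0 T) := by
      refine isSymbol_of_elliptic hd ?_ hGp hGe
      exact hΨ.measurable_comp (measurable_of_continuousOn_Ioi
        (continuousOn_transformedMultiplier hc continuousOn_const hd hT)) fun t => hFJ t t.2
    obtain ⟨hA, hB⟩ := exists_spectra hd hΩ hΩne hT hβ hcomp hfs hfe hGs hGe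
    refine ⟨hA, hB, fun a b ha hb n => ?_⟩
    refine sum_eigenvalues_le_of_average hd hfs hGs hw0 hw1 hM c hMΩ (fun ξ hξ => ?_) ha hb n
    obtain ⟨p, hp0, hp1, hwp, hnorm⟩ := hp ξ hξ
    have hspos : ∀ k, ∑ i, p k i * (‖ξ‖ ^ 2 * stretchEigenvalues T i) ∈ Ioi (0 : ℝ) := fun k =>
      (convex_Ioi (0 : ℝ)).sum_mem (fun i _ => hp0 k i) (hp1 k) fun i _ => mul_pos hξ (hμ i)
    have h0 : ConvexOn ℝ (Ioi 0) (0 : ℝ → ℝ) := convexOn_const 0 (convex_Ioi 0)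
    have h1 := average_le_transformedMultiplier hT hΦ h0 hw0 hw1 hp0 hp1 hwp hξ
    simp only [Pi.zero_apply, sub_zero] at h1
    have hsumJ : ∑ k, w k * Φ (∑ i, p k i * (‖ξ‖ ^ 2 * stretchEigenvalues T i)) ∈ J :=
      hΨ.1.sum_mem (fun k _ => hw0 k) hw1 fun k _ => hJ (hspos k)
    -- Jensen for the concave Ψ moves the average over k inside; monotonicity of Ψ then applies the
    -- convexity bound for Φ.
    refine le_trans ?_ (hmono hsumJ (hFJ _ hξ) h1)
    refine le_trans (le_of_eq (Finset.sum_congr rfl fun k _ => ?_))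
      (hΨ.le_map_sum (fun k _ => hw0 k) hw1 fun k _ => hJ (hspos k))
    rw [hnorm, hf _ (hspos k), smul_eq_mul]
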